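/- **Setting.** Let $k\ge 0$ and let $p_1,\dots,p_k\in\mathbb R^3$ be such that $0,\pm p_1,\dots,\pm p_k$ are $2k+1$ distinct points; put $P=\{\pm p_1,\dots,\pm p_k\}$. Let $\delta\in(0,\tfrac12)$ be so small that any two points of $P\cup\{0\}$ have distance at least $4\delta$, and let $0<\varepsilon_0\le\delta^2$, $I=[0,\varepsilon_0)$. Put $$h_\varepsilon(x)=1-\frac{2\varepsilon}{|x|}+\sum_{\nu=1}^k\Big(\frac{\varepsilon}{2|x-p_\nu|}+\frac{\varepsilon}{2|x+p_\nu|}\Big).$$ Let $N\to\mathbb R^3\setminus(P\cup\{0\})$ be the principal circle bundle with connection form $\alpha$ such that $d\alpha=*_\varepsilon dh_\varepsilon$, where $*_\varepsilon$ is the Hodge star of $|dx|^2/\varepsilon^2$ for the orientation of $\mathbb R^3$ that makes the forms $$\omega_{\mathrm{ad},i}=\alpha\wedge\frac{dx_i}{\varepsilon}+h_\varepsilon\frac{dx_j\wedge dx_l}{\varepsilon^2}\qquad((i,j,l)\text{ cyclic})$$ closed. The map $x\mapsto -x$ is covered by an involution $\iota$ of $N$ with $\iota^*\alpha=-\alpha$.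 Let $\sigma_0$ be a smooth function of $|x|$, equal to $|x|$ for $|x|\le\delta$ and to $1$ for $|x|\ge2\delta$ and positive for $x\neq 0$; let $\sigma_\nu$ ($1\le\nu\le k$) be the product of the corresponding functions of $|x-p_\nu|$ and of $|x+p_\nu|$; let $\sigma_I=(1+|x|^2)^{-1/2}$, $\sigma=\sigma_0\sigma_1\cdots\sigma_k\sigma_I$, and define $\rho$ by $\rho\,\sigma_0\cdots\sigma_k=\varepsilon$. Let $\overline{\mathbb R^3}$ be the radial compactification of $\mathbb R^3$, and let $\widetilde V$ be the manifold with corners given by the extension of the circle bundle $N$ to the part $\{\rho<\delta\}$ of the real blow-up $[\overline{\mathbb R^3}\times I;\,(c,0),\,c\in P\cup\{0\}]$. Put $V=\widetilde V/\iota$; it is a collar neighbourhood of the adiabatic face $X_{\mathrm{ad}}=\{\rho=0\}$, and its other boundary faces are $\{\sigma_\nu=0\}$, $\nu=0,\dots,k$, and $I_\infty=\{\sigma_I=0\}$. Functions and forms on $V$ are the $\iota$-invariant ones on $\widetilde V$, and smoothness is meant up to and including all boundary faces. Let $T_\phi$ be the rank $4$ bundle whose pull-back to $\widetilde V$ has the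 frame $\partial_\theta,\varepsilon\nabla_1,\varepsilon\nabla_2,\varepsilon\nabla_3$ ($\partial_\theta$ the generator of the circle action, $\nabla_j$ the $\alpha$-horizontal lift of $\partial/\partial x_j$), with dual coframe $\alpha,dx_1/\varepsilon,dx_2/\varepsilon,dx_3/\varepsilon$; put $\lambda=\Lambda^4T_\phi^*$, let $\Omega^m_\phi(V)$ be the space of smooth sections of $\Lambda^mT^*_\phi$ over $V$, and let $d$ be the exterior derivative along the fibres $\varepsilon=\text{const}$. For a product $w$ of boundary defining functions, $O(w^\infty)$ denotes elements of $\bigcap_N w^NC^\infty$. A smooth section $\beta$ of $\Lambda^mT_\phi^*$ is *essentially invariant* (ei) if $\mathcal L_{\partial_\theta}\beta=O((\rho\sigma_I)^\infty)$, and *essentially basic* (eb) if moreover $\iota_{\partial_\theta}\beta=O((\rho\sigma_I)^\infty)$ (contraction with $\partial_\theta$). For triples $\omega,\eta$ of $2$-forms let $Q(\omega,\eta)$ be the trace-free symmetric part of the matrix $(\omega_i\wedge\eta_j)$. **Theorem.** Let $G\in\sigma^\infty C^\infty_{\mathrm{ei}}(V,S^2_0\mathbb R^3\otimes\lambda)$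 be an essentially invariant section that vanishes to infinite order in $\sigma$. Then there exists $b\in\sigma_I^2\,\Omega^1_{\phi,\mathrm{eb}}(V)\otimes\mathbb R^3$ such that $$Q(\omega_{\mathrm{ad}},db)=\varepsilon G+O(\varepsilon^\infty\sigma_I^\infty)\quad\text{in }V.$$ -/

import Mathlib

open scoped ContDiff Topology Matrix

noncomputable section

namespace SenGluing

/-- Euclidean 3-space. -/
abbrev E3 := EuclideanSpace ℝ (Fin 3)

/-! ### The configuration of points and the Gibbons-Hawking potential -/

/-- The points blown up: `none` is the origin, `some (ν, true)` is `p ν` and `some (ν, false)`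
is `-p ν`. -/
def centre {k : ℕ} (p : Fin k → E3) : Option (Fin k × Bool) → E3
  | none => 0
  | some (ν, true) => p ν
  | some (ν, false) => -p ν

/-- The adiabatic potential
`h_ε(x) = 1 - 2ε/|x| + ∑_ν (ε/(2|x - p_ν|) + ε/(2|x + p_ν|))`. -/
def potential {k : ℕ} (p : Fin k → E3) (ε : ℝ) (x : E3) : ℝ :=
  1 - 2 * ε / ‖x‖ + ∑ ν, (ε / (2 * ‖x - p ν‖) + ε / (2 * ‖x + p ν‖))

/-! ### The circle bundle with its connection

The circle bundle over `ℝ³ ∖ {0, ±p_ν}` is the unit circle bundle of a Hermitian line bundle, which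
is a tensor product of one line bundle for each of the points `±p_ν` and four for the origin. The
factor at `c` is the line of spinors `v ∈ ℂ²` with `((x - c)·σ) v = s |x - c| v` (`σ` the Pauli
matrices), with `s = 1` for `c = ±p_ν` and `s = -1` for `c = 0`. The connection is the one induced
from the flat trivial bundle; it is the sum of the corresponding Dirac monopoles. -/

/-- The factors of the tensor product. -/
abbrev Site (k : ℕ) := (Fin k × Bool) ⊕ Fin 4

/-- The position of a factor. -/
def sitePos {k : ℕ} (p : Fin k → E3) : Site k → E3
  | .inl a => centre p (some a)
  | .inr _ => 0

/-- The charge of a factor. -/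
def siteSign {k : ℕ} : Site k → ℝ
  | .inl _ => 1
  | .inr _ => -1

/-- The factor at the opposite point. -/
def siteRefl {k : ℕ} : Site k → Site k
  | .inl (ν, s) => .inl (ν, !s)
  | .inr a => .inr a

/-- The space `⨂_j ℂ²` of spinor tensors, by components. -/
abbrev Tens (k : ℕ) := (Site k → Fin 2) → ℂ

/-- The Hermitian inner product of tensors, antilinear in the first argument. -/
def tinner {k : ℕ} (S T : Tens k) : ℂ := ∑ i, starRingEnd ℂ (S i) * T i

/-- The associated norm. -/
def tnorm {k : ℕ} (T : Tens k) : ℝ := √(∑ i, Complex.normSq (T i))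

/-- The direction `(x - c)/|x - c|`. -/
def dir (c x : E3) : E3 := ‖x - c‖⁻¹ • (x - c)

/-- For a unit vector `u`, the projection `(1 + u·σ)/2` of `ℂ²` onto the `+1` eigenline
of `u·σ`. -/
def spinProj (u : E3) : Matrix (Fin 2) (Fin 2) ℂ :=
  (1 / 2 : ℂ) • !![1 + (u 2 : ℂ), (u 0 : ℂ) - Complex.I * (u 1 : ℂ);
                   (u 0 : ℂ) + Complex.I * (u 1 : ℂ), 1 - (u 2 : ℂ)]

/-- The orthogonal projection of the tensor space onto the line over `x`: the tensor product
of the spinor projections. -/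
def lineProj {k : ℕ} (p : Fin k → E3) (x : E3) (T : Tens k) : Tens k := fun i =>
  ∑ i' : Site k → Fin 2,
    (∏ j, spinProj (siteSign j • dir (sitePos p j) x) (i j) (i' j)) * T i'

/-- The fibre of the circle bundle over `x`: unit vectors in the line over `x`. -/
def fibre {k : ℕ} (p : Fin k → E3) (x : E3) : Set (Tens k) :=
  {T | lineProj p x T = T ∧ tnorm T = 1}

/-- The local section of the circle bundle which is obtained from the point `T` of a fibre by
projecting `T` to the nearby lines and normalizing. It is horizontal at the base point of `T`. -/
def localSection {k : ℕ} (p : Fin k → E3) (T : Tens k) (x : E3) : Tens k :=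
  (tnorm (lineProj p x T))⁻¹ • lineProj p x T

/-- The coordinate vectors of `ℝ³`. -/
def coordVec (j : Fin 3) : E3 := EuclideanSpace.single j 1

/-- The component `A_j(x) = Im⟨s, ∂_j s⟩` of the connection form, `s` being `localSection p T`. -/
def connForm {k : ℕ} (p : Fin k → E3) (T : Tens k) (x : E3) (j : Fin 3) : ℝ :=
  (tinner (localSection p T x)
    (deriv (fun t : ℝ => localSection p T (x + t • coordVec j)) 0)).im

/-- The curvature `(dα)_{ij} = ∂_i A_j - ∂_j A_i` of the connection at the point `T` of the fibre
over `x`. -/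
def curvature {k : ℕ} (p : Fin k → E3) (x : E3) (T : Tens k) (i j : Fin 3) : ℝ :=
  deriv (fun t : ℝ => connForm p T (x + t • coordVec i) j) 0 -
    deriv (fun t : ℝ => connForm p T (x + t • coordVec j) i) 0

/-! ### The total space over the interior, and the defining functions of the faces -/

/-- A triple `(x, T, ε)`: a point `x` of the base, a tensor `T` (in the fibre over `x`), and
the adiabatic parameter. -/
structure Pt (k : ℕ) where
  x : E3
  T : Tens k
  eps : ℝ

/-- A smooth function equal to `t` for `t ≤ δ` and to `1` for `t ≥ 2δ`, positive for `t > 0`. -/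
def profile (δ t : ℝ) : ℝ :=
  (1 - Real.smoothTransition (t / δ - 1)) * t + Real.smoothTransition (t / δ - 1)

/-- The product `σ_0 σ_1 ⋯ σ_k` of the defining functions of the faces `X_0, …, X_k`. The function
`σ_0` is `|x|` near `0` and `1` away from it, and `σ_ν` is `|x ∓ p_ν|` near `±p_ν` and `1` away
from these two points. -/
def sigmaFin {k : ℕ} (p : Fin k → E3) (δ : ℝ) (x : E3) : ℝ :=
  profile δ ‖x‖ * ∏ ν, (profile δ ‖x - p ν‖ * profile δ ‖x + p ν‖)

/-- A defining function of the face `I_∞` at spatial infinity. -/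
def sigmaI (x : E3) : ℝ := (√(1 + ‖x‖ ^ 2))⁻¹

/-- `σ = σ_0 σ_1 ⋯ σ_k σ_I`. -/
def sigma {k : ℕ} (p : Fin k → E3) (δ : ℝ) (z : Pt k) : ℝ := sigmaFin p δ z.x * sigmaI z.x

/-- The defining function of the adiabatic face, determined by `ρ σ_0 ⋯ σ_k = ε`. -/
def rho {k : ℕ} (p : Fin k → E3) (δ : ℝ) (z : Pt k) : ℝ := z.eps / sigmaFin p δ z.x

/-- The interior of the double cover of the collar neighbourhood `V = {ρ < δ}` of `X_ad`. -/
def interiorV {k : ℕ} (p : Fin k → E3) (δ ε₀ : ℝ) : Set (Pt k) :=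
  {z | (∀ c, z.x ≠ centre p c) ∧ z.T ∈ fibre p z.x ∧ 0 < z.eps ∧ z.eps < ε₀ ∧ rho p δ z < δ}

/-- The involution `ι` covering `x ↦ -x`. It is induced by the quaternionic structure
`(v₀, v₁) ↦ (-v̄₁, v̄₀)` on the factors, and interchanges the factors at opposite points. -/
def iota {k : ℕ} (z : Pt k) : Pt k where
  x := -z.x
  T := fun i => (∏ j, if i j = 0 then (-1 : ℂ) else 1) *
    starRingEnd ℂ (z.T fun j => 1 - i (siteRefl j))
  eps := z.eps

/-! ### Smooth functions on `V`

A smooth function on the manifold with corners `V` is determined by its restriction to the interior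
(the other points are limits of interior points), so we describe it as a function on the interior
that extends smoothly to the boundary faces. The coordinates are: `(x, T, ε)` away from the front
faces and infinity; `(y, T, ρ, σ)` with `x = c + σ y`, `ε = ρ σ`, `|y| = 1`, near the front face of
the blow-up of `(c, 0)`; `(y, T, s, ε)` with `x = y / s`, `|y| = 1`, near `I_∞`. Here `y` and `T` run
over submanifolds of a vector space, on which the smooth functions are locally the restrictions of
smooth functions on the vector space. -/

/-- Coordinates away from the front faces and infinity. -/
def chartBase {k : ℕ} (z : Pt k) : E3 × Tens k × ℝ := (z.x, z.T, z.eps)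

/-- Coordinates `(y, T, ρ, σ)` near the front face over `c`. -/
def chartFront {k : ℕ} (c : E3) (z : Pt k) : E3 × Tens k × ℝ × ℝ :=
  (dir c z.x, z.T, z.eps / ‖z.x - c‖, ‖z.x - c‖)

/-- Coordinates `(y, T, s, ε)` near spatial infinity. -/
def chartInfty {k : ℕ} (z : Pt k) : E3 × Tens k × ℝ × ℝ :=
  (dir 0 z.x, z.T, ‖z.x‖⁻¹, z.eps)

/-- In the coordinates `Ψ`, the function `f` on `S` is near `w` the restriction of a smooth
function. -/
def ExtendsSmoothlyAt {k : ℕ} {X : Type} [NormedAddCommGroup X] [NormedSpace ℝ X]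
    (S : Set (Pt k)) (Ψ : Pt k → X) (w : X) (f : Pt k → ℝ) : Prop :=
  ∃ (U : Set X) (F : X → ℝ), IsOpen U ∧ w ∈ U ∧ ContDiffOn ℝ ∞ F U ∧
    ∀ z ∈ S, Ψ z ∈ U → f z = F (Ψ z)

/-- `f` belongs to `C^∞` of the double cover of `V`. The three clauses are about: the points with
`0 ≤ ε` and `x` finite and different from the centres (interior points, and points of `X_ad`); the
points of the front faces `{σ = 0}`; the points of `I_∞ = {s = 0}`. -/
def IsSmooth {k : ℕ} (p : Fin k → E3) (δ ε₀ : ℝ) (f : Pt k → ℝ) : Prop :=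
  (∀ w ∈ closure (chartBase '' interiorV p δ ε₀),
      (∀ c, w.1 ≠ centre p c) → w.2.2 < ε₀ → w.2.2 / sigmaFin p δ w.1 < δ →
      ExtendsSmoothlyAt (interiorV p δ ε₀) chartBase w f) ∧
  (∀ c, ∀ w ∈ closure (chartFront (centre p c) '' interiorV p δ ε₀),
      w.2.2.2 = 0 → w.2.2.1 < δ →
      ExtendsSmoothlyAt (interiorV p δ ε₀) (chartFront (centre p c)) w f) ∧
  (∀ w ∈ closure (chartInfty '' interiorV p δ ε₀),
      w.2.2.1 = 0 → w.2.2.2 < ε₀ →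
      ExtendsSmoothlyAt (interiorV p δ ε₀) chartInfty w f)

/-- `f = O(w^∞)`, that is, `f ∈ w^N C^∞` for all `N`, where `w` is a product of defining
functions. -/
def IsRapid {k : ℕ} (p : Fin k → E3) (δ ε₀ : ℝ) (w f : Pt k → ℝ) : Prop :=
  ∀ N : ℕ, IsSmooth p δ ε₀ fun z => f z / w z ^ N

/-! ### Forms

The bundle `T_φ` has the frame `E_0 = ∂_θ` and `E_j = ε ∇_j`, `j = 1, 2, 3`, with `∇_j` the
horizontal lift of `∂/∂x_j`; the dual coframe of `T_φ^*` is `e_0 = α`, `e_j = dx_j / ε`. Forms are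
given by their components in this frame. -/

/-- The derivative along the generator `∂_θ` of the circle action. -/
def derivTheta {k : ℕ} (f : Pt k → ℝ) (z : Pt k) : ℝ :=
  deriv (fun t : ℝ => f ⟨z.x, Complex.exp (t * Complex.I) • z.T, z.eps⟩) 0

/-- The derivative along the horizontal lift `∇_j` of `∂/∂x_j`. -/
def derivHor {k : ℕ} (p : Fin k → E3) (j : Fin 3) (f : Pt k → ℝ) (z : Pt k) : ℝ :=
  deriv (fun t : ℝ => f ⟨z.x + t • coordVec j,
    localSection p z.T (z.x + t • coordVec j), z.eps⟩) 0

/-- The derivative along the frame field `E_a`. -/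
def frameDeriv {k : ℕ} (p : Fin k → E3) (a : Fin 4) (f : Pt k → ℝ) (z : Pt k) : ℝ :=
  Fin.cases (derivTheta f z) (fun j => z.eps * derivHor p j f z) a

/-- Components `β(E_a)` of a 1-form along the fibres of `π`. -/
abbrev Form1 (k : ℕ) := Fin 4 → Pt k → ℝ

/-- Components `η(E_a, E_b)` of a 2-form along the fibres of `π`. -/
abbrev Form2 (k : ℕ) := Fin 4 → Fin 4 → Pt k → ℝ

/-- Component `μ(E_0, E_1, E_2, E_3)` of a section of `λ = Λ⁴ T_φ^*`. -/
abbrev Form4 (k : ℕ) := Pt k → ℝ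

/-- The components `dα(E_a, E_b)`: zero if `a` or `b` is zero, and the curvature otherwise. -/
def dAlpha {k : ℕ} (p : Fin k → E3) : Form2 k := fun a b z =>
  Fin.cases 0 (fun i => Fin.cases 0 (fun j => z.eps ^ 2 * curvature p z.x z.T i j) b) a

/-- The relative exterior derivative of `β = β_0 α + ∑ β_j dx_j/ε` along the fibres of `π`, namely
`dβ = ∑_a dβ_a ∧ e_a + β_0 dα` (the forms `dx_j/ε` are closed along the fibres). -/
def extD {k : ℕ} (p : Fin k → E3) (β : Form1 k) : Form2 k := fun a b z =>
  frameDeriv p a (β b) z - frameDeriv p b (β a) z + β 0 z * dAlpha p a b z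

/-- The wedge product of two 2-forms. -/
def wedge {k : ℕ} (ξ η : Form2 k) : Form4 k := fun z =>
  ξ 0 1 z * η 2 3 z - ξ 0 2 z * η 1 3 z + ξ 0 3 z * η 1 2 z +
    ξ 1 2 z * η 0 3 z - ξ 1 3 z * η 0 2 z + ξ 2 3 z * η 0 1 z

/-- The components of the 2-form `e_c ∧ e_d`. -/
def coframeWedge (c d a b : Fin 4) : ℝ :=
  (if a = c ∧ b = d then 1 else 0) - (if a = d ∧ b = c then 1 else 0)

/-- The triple `ω_ad` near `X_ad`, the hyperkähler triple
`ω_i = α ∧ dx_i/ε + h_ε dx_j ∧ dx_l/ε²` (`(i, j, l)` cyclic) of the adiabatic Gibbons-Hawking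
metrics `h_ε |dx|²/ε² + h_ε⁻¹ α²`. -/
def omegaAd {k : ℕ} (p : Fin k → E3) (i : Fin 3) : Form2 k := fun a b z =>
  coframeWedge 0 i.succ a b +
    potential p z.eps z.x * coframeWedge (i + 1).succ (i + 2).succ a b

/-- The polarization of `Q`: the trace-free symmetric part of the matrix `(ξ_i ∧ η_j)`. -/
def Qpol {k : ℕ} (ξ η : Fin 3 → Form2 k) (i j : Fin 3) : Form4 k := fun z =>
  (wedge (ξ i) (η j) z + wedge (ξ j) (η i) z) / 2 -
    if i = j then (∑ l, wedge (ξ l) (η l) z) / 3 else 0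

/-- Smooth essentially invariant functions: `∂f/∂θ = O((ρ σ_I)^∞)`. These are also the components
of essentially invariant forms, as the frame is invariant. -/
def EssInv {k : ℕ} (p : Fin k → E3) (δ ε₀ : ℝ) (f : Pt k → ℝ) : Prop :=
  IsSmooth p δ ε₀ f ∧
    IsRapid p δ ε₀ (fun z => rho p δ z * sigmaI z.x) (derivTheta f)

/-- `β` descends from the double cover to `V`: it satisfies `ι^* β = β`. As `ι` covers `x ↦ -x`
and reverses the circles, it maps each frame field `E_a` to `-E_a`. -/
def IotaInvariant1 {k : ℕ} (p : Fin k → E3) (δ ε₀ : ℝ) (β : Form1 k) : Prop :=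
  ∀ z ∈ interiorV p δ ε₀, ∀ a, -β a (iota z) = β a z

/-- `μ` descends from the double cover to `V`: it satisfies `ι^* μ = μ`. -/
def IotaInvariant4 {k : ℕ} (p : Fin k → E3) (δ ε₀ : ℝ) (μ : Form4 k) : Prop :=
  ∀ z ∈ interiorV p δ ε₀, μ (iota z) = μ z

/-- The space `Ω¹_{φ,eb}(V)` of essentially basic 1-forms on `V`. -/
def EssBasic {k : ℕ} (p : Fin k → E3) (δ ε₀ : ℝ) (β : Form1 k) : Prop :=
  IotaInvariant1 p δ ε₀ β ∧ (∀ a, EssInv p δ ε₀ (β a)) ∧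
    IsRapid p δ ε₀ (fun z => rho p δ z * sigmaI z.x) (β 0)

/-- The space `σ^∞ C^∞_ei(V, S²₀ℝ³ ⊗ λ)`. -/
def RapidEssInvSym {k : ℕ} (p : Fin k → E3) (δ ε₀ : ℝ) (G : Fin 3 → Fin 3 → Form4 k) : Prop :=
  (∀ i j, IotaInvariant4 p δ ε₀ (G i j)) ∧
  (∀ z ∈ interiorV p δ ε₀, (∀ i j, G i j z = G j i z) ∧ ∑ i, G i i z = 0) ∧
  ∀ i j, ∀ N : ℕ, EssInv p δ ε₀ fun z => G i j z / sigma p δ z ^ N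

end SenGluing

end

open scoped ContDiff Topology Matrix

noncomputable section

namespace SenGluing

open MeasureTheory Set Filter Asymptotics

section

/-! ### Parametric integrals, Hadamard's lemma, and asymptotic expansions -/

/-! The form `b` is sought among basic forms
$b_i=\sum_j\varphi_{ij}(x,\varepsilon)\,dx_j/\varepsilon$ pulled back from the base. Then $db_i$ has
no component containing $\alpha$, so the $h_\varepsilon$-part of $\omega_{\mathrm{ad}}$ pairs to
zero with it, and $\omega_i\wedge db_l$ is $\varepsilon$ times the $i$-th component of the curl of
$\varphi_l$ (`wedge_omegaAd`, `extD_basicForm_succ`). The equation thus has constant coefficients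
and does not couple different powers of $\varepsilon$.

For a matrix $u$ of functions with rows $u_i$, let
$\varphi_{ij}=-(\mathrm{curl}\,u_i)_j+\sum_l\epsilon_{ijl}\,\mathrm{div}\,u_l$. By
$\mathrm{curl}\,\mathrm{curl}=\mathrm{grad}\,\mathrm{div}-\Delta$, the matrix of curls is the
transpose of $\Delta u$ up to antisymmetric terms and a multiple of the identity
(`sym_curl_gaugeForm`). Since $G$ is symmetric and trace-free, it suffices to solve $\Delta
u_{ij}=G_{ij}$ entry by entry, modulo $O((\varepsilon\sigma_I)^\infty)$
(`exists_potential_of_essInv`).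

Essential invariance makes the Taylor coefficients of $G_{ij}$ at $\varepsilon=0$ constant on the
circles (`EssInv.exists_expansion`), so they are functions $G_n$ on the base. Vanishing to infinite
order at the other faces makes $G_n$ extend smoothly over the centres and, after inversion, over
infinity (`exists_coefficients`, `PolarFlat.contDiffOn`). Invariance under the involution makes
$G_n$ even. The Newtonian potential gives even solutions $H_n$ of $\Delta H_n=G_n$ whose Kelvin
transforms are smooth at the origin (`exists_even_potential`). Hence $H_n$ decays like $|x|^{-1}$
with a full expansion, and its derivatives lie in $\sigma_I^2C^\infty$ (`isOddDecaying_pd`); they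
are odd, as the invariance of $b$ requires.

The $H_n$ are Borel summed. For fixed $\varepsilon\ne0$ the Borel sum is a finite sum whose weights
depend on $\varepsilon$ alone, so all linear relations in $x$ (Poisson equation, Kelvin transform,
parity) survive summation (`exists_borelSum`). What remains vanishes to infinite order at every
face; Hadamard division in each chart turns this into divisibility by all powers of
$\varepsilon\sigma_I$ (`isRapid_of_pointwise`). -/

/-- The integral is a convolution in the second variable, evaluated at the point 0, with `g`
reflected. Only local integrability of `f` matters, so an indicator function is admissible. -/
theorem contDiffOn_integral_smul {P G F : Type*} [NormedAddCommGroup P] [NormedSpace ℝ P]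
    [NormedAddCommGroup G] [NormedSpace ℝ G] [MeasurableSpace G] [BorelSpace G]
    [NormedAddCommGroup F] [NormedSpace ℝ F] {μ : Measure G}
    {f : G → ℝ} {g : P × G → F} {s : Set P} {k : Set G} (hs : IsOpen s) (hk : IsCompact k)
    (hgs : ∀ p x, p ∈ s → x ∉ k → g (p, x) = 0) (hf : LocallyIntegrable f μ)
    (hg : ContDiffOn ℝ ∞ g (s ×ˢ univ)) :
    ContDiffOn ℝ ∞ (fun p => ∫ t, f t • g (p, t) ∂μ) s := by
  have h := contDiffOn_convolution_right_with_param_comp (n := ⊤) (μ := μ)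
    (ContinuousLinearMap.lsmul ℝ ℝ : ℝ →L[ℝ] F →L[ℝ] F) (v := fun _ : P => (0 : G))
    (g := fun p x => g (p, -x)) (k := (fun x : G => -x) '' k) contDiffOn_const hs
    (hk.image continuous_neg) (fun p x hp hx => hgs p _ hp fun h => hx ⟨-x, h, neg_neg x⟩) hf
    (hg.comp (contDiff_fst.prodMk contDiff_snd.neg).contDiffOn fun q hq => ⟨hq.1, mem_univ _⟩)
  refine h.congr fun p _ => ?_
  simp [convolution]

variable {X : Type*} [NormedAddCommGroup X] [NormedSpace ℝ X]

/-- The fundamental theorem of calculus on the segment from `x - t x • e` to `x`: the quotient is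
the integral over $[0,1]$ of the derivative of `F` in the direction `e`. -/
theorem exists_hadamard_quotient (t : X →L[ℝ] ℝ) (e : X) {F : X → ℝ} (hF : ContDiff ℝ ∞ F) :
    ∃ F₁ : X → ℝ, ContDiff ℝ ∞ F₁ ∧ ∀ x, F x = F (x - t x • e) + t x * F₁ x := by
  -- The bump equals 1 on the interval of integration, so it does not change the integral; it
  -- supplies the compact support required by `contDiffOn_integral_smul`.
  let χ : ContDiffBump (0 : ℝ) := ⟨1, 2, one_pos, one_lt_two⟩
  let D : X × ℝ → ℝ := fun q => fderiv ℝ F (q.1 - t q.1 • e + q.2 • t q.1 • e) e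
  have hD : ContDiff ℝ ∞ D := by
    have h1 : ContDiff ℝ ∞ (fderiv ℝ F) := hF.fderiv_right (by simp)
    have h2 : ContDiff ℝ ∞ fun q : X × ℝ => q.1 - t q.1 • e + q.2 • t q.1 • e := by fun_prop
    exact (h1.comp h2).clm_apply contDiff_const
  refine ⟨fun x => ∫ τ : ℝ, (indicator (Ioc 0 1) (fun _ => (1 : ℝ)) τ) • (χ τ * D (x, τ)), ?_, ?_⟩
  · rw [← contDiffOn_univ]
    refine contDiffOn_integral_smul (g := fun q : X × ℝ => χ q.2 * D q) isOpen_univ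
      (isCompact_closedBall (0 : ℝ) 2) ?_ ?_ ?_
    · intro p x _ hx
      have : χ x = 0 := χ.zero_of_le_dist (by
        simp only [Metric.mem_closedBall, not_le] at hx; exact hx.le)
      simp [this]
    · exact ((integrable_indicator_iff measurableSet_Ioc).2 (by simp)).locallyIntegrable
    · exact ((χ.contDiff.comp contDiff_snd).mul hD).contDiffOn
  · intro x
    have h1 : ∫ τ : ℝ, (indicator (Ioc 0 1) (fun _ => (1 : ℝ)) τ) • (χ τ * D (x, τ)) =
        ∫ τ in (0 : ℝ)..1, D (x, τ) := by
      rw [intervalIntegral.integral_of_le zero_le_one, ← integral_indicator measurableSet_Ioc]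
      congr 1
      ext τ
      by_cases hτ : τ ∈ Ioc (0 : ℝ) 1
      · have : χ τ = 1 := χ.one_of_mem_closedBall (by
          simp only [Metric.mem_closedBall, dist_zero_right, Real.norm_eq_abs, abs_of_pos hτ.1]
          exact hτ.2)
        simp [hτ, this]
      · simp [hτ]
    have h2 : ∀ τ ∈ uIcc (0 : ℝ) 1, HasDerivAt (fun τ => F (x - t x • e + τ • t x • e))
        (t x * D (x, τ)) τ := by
      intro τ _
      have h3 : HasDerivAt (fun τ : ℝ => x - t x • e + τ • t x • e) (t x • e) τ := by
        simpa using ((hasDerivAt_id τ).smul_const (t x • e)).const_add (x - t x • e)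
      have h4 := ((hF.differentiable (by simp)) (x - t x • e + τ • t x • e)).hasFDerivAt
      have h5 := h4.comp_hasDerivAt τ h3
      rw [map_smul, smul_eq_mul] at h5
      exact h5
    have h5 := intervalIntegral.integral_eq_sub_of_hasDerivAt h2
      (Continuous.intervalIntegrable (by
        exact continuous_const.mul (hD.continuous.comp (by fun_prop))) _ _)
    rw [intervalIntegral.integral_const_mul] at h5
    simp only [h1, h5]
    simp

/-- Taylor's formula in the direction `e`, for all orders simultaneously. -/
theorem exists_taylor_coeff (t : X →L[ℝ] ℝ) (e : X) {F : X → ℝ} (hF : ContDiff ℝ ∞ F) :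
    ∃ a : ℕ → X → ℝ, (∀ n, ContDiff ℝ ∞ (a n)) ∧ ∀ N x,
      F x = ∑ n ∈ Finset.range N, t x ^ n * a n (x - t x • e) + t x ^ N * a N x := by
  choose q hq hqe using fun G : {G : X → ℝ // ContDiff ℝ ∞ G} =>
    exists_hadamard_quotient t e G.2
  let a : ℕ → {G : X → ℝ // ContDiff ℝ ∞ G} :=
    fun n => Nat.rec ⟨F, hF⟩ (fun _ G => ⟨q G, hq G⟩) n
  refine ⟨fun n => (a n).1, fun n => (a n).2, fun N x => ?_⟩
  induction N with
  | zero => simp [a]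
  | succ N ih =>
    have h1 : (a (N + 1)).1 x = q (a N) x := rfl
    have h2 := hqe (a N) x
    simp only [Finset.sum_range_succ] at ih ⊢
    rw [ih, h1, h2]
    ring

/-- The function `φ` has the one-sided asymptotic expansion `∑ a_n ε^n` at `0`. -/
def HasExpansion (φ : ℝ → ℝ) (a : ℕ → ℝ) : Prop :=
  ∀ N, (fun ε => φ ε - ∑ n ∈ Finset.range N, ε ^ n * a n) =O[𝓝[>] 0] fun ε : ℝ => ε ^ N

theorem HasExpansion.congr {φ ψ : ℝ → ℝ} {a : ℕ → ℝ} (h : HasExpansion φ a)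
    (he : φ =ᶠ[𝓝[>] 0] ψ) : HasExpansion ψ a := fun N =>
  (h N).congr' (he.mono fun ε hε => by simp [hε]) EventuallyEq.rfl

theorem HasExpansion.sub {φ ψ : ℝ → ℝ} {a b : ℕ → ℝ} (h : HasExpansion φ a)
    (h' : HasExpansion ψ b) : HasExpansion (fun ε => φ ε - ψ ε) fun n => a n - b n := fun N => by
  refine ((h N).sub (h' N)).congr_left fun ε => ?_
  simp only [mul_sub, Finset.sum_sub_distrib]
  ring

theorem HasExpansion.const_mul {φ : ℝ → ℝ} {a : ℕ → ℝ} (c : ℝ) (h : HasExpansion φ a) :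
    HasExpansion (fun ε => c * φ ε) fun n => c * a n := fun N => by
  refine ((h N).const_mul_left c).congr_left fun ε => ?_
  simp only [mul_sub, Finset.mul_sum]
  congr 2
  ext n
  ring

theorem HasExpansion.comp_mul {φ : ℝ → ℝ} {a : ℕ → ℝ} (h : HasExpansion φ a) {c : ℝ}
    (hc : 0 < c) : HasExpansion (fun ε => φ (c * ε)) fun n => c ^ n * a n := fun N => by
  have ht : Tendsto (fun ε : ℝ => c * ε) (𝓝[>] 0) (𝓝[>] 0) := by
    refine tendsto_nhdsWithin_iff.2 ⟨?_, ?_⟩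
    · have : Tendsto (fun ε : ℝ => c * ε) (𝓝 0) (𝓝 (c * 0)) := tendsto_id.const_mul c
      rw [mul_zero] at this
      exact this.mono_left nhdsWithin_le_nhds
    · filter_upwards [self_mem_nhdsWithin] with ε hε using mul_pos hc hε
  have h1 := (h N).comp_tendsto ht
  have h2 : (fun ε : ℝ => (c * ε) ^ N) =O[𝓝[>] 0] fun ε : ℝ => ε ^ N := by
    simp only [mul_pow]
    exact isBigO_const_mul_self _ _ _
  refine (h1.trans h2).congr_left fun ε => ?_
  simp only [Function.comp]
  congr 2
  ext n
  ring

/-- If all earlier coefficients vanish, the expansion to order $n+1$ says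
$\varepsilon^na_n=O(\varepsilon^{n+1})$; divide by $\varepsilon^n$ and let $\varepsilon\to0$. -/
theorem HasExpansion.eq_zero {a : ℕ → ℝ} (h : HasExpansion (fun _ => 0) a) (n : ℕ) : a n = 0 := by
  induction n using Nat.strong_induction_on with
  | _ n ih =>
    have h1 := h (n + 1)
    have h2 : (fun ε : ℝ => ε ^ n * a n) =O[𝓝[>] 0] fun ε : ℝ => ε ^ (n + 1) := by
      refine h1.neg_left.congr_left fun ε => ?_
      rw [Finset.sum_range_succ, Finset.sum_eq_zero]
      · ring
      · intro m hm
        rw [ih m (Finset.mem_range.1 hm), mul_zero]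
    have h3 : (fun _ : ℝ => a n) =O[𝓝[>] 0] fun ε : ℝ => ε := by
      have h4 := h2.mul (isBigO_refl (fun ε : ℝ => (ε ^ n)⁻¹) (𝓝[>] 0))
      refine h4.congr' ?_ ?_
      · filter_upwards [self_mem_nhdsWithin] with ε (hε : 0 < ε)
        field_simp
      · filter_upwards [self_mem_nhdsWithin] with ε (hε : 0 < ε)
        field_simp
        ring
    have h5 : Tendsto (fun _ : ℝ => a n) (𝓝[>] 0) (𝓝 0) :=
      h3.trans_tendsto (tendsto_id.mono_left nhdsWithin_le_nhds)
    exact tendsto_nhds_unique tendsto_const_nhds h5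

/-- Uniqueness is what identifies coefficients computed in different charts, at different points of
a fibre, or at points exchanged by the involution. -/
theorem HasExpansion.unique {φ : ℝ → ℝ} {a b : ℕ → ℝ} (h : HasExpansion φ a)
    (h' : HasExpansion φ b) : a = b := by
  ext n
  have := (h.sub h').congr (ψ := fun _ => 0) (by simp)
  exact sub_eq_zero.1 (this.eq_zero n)

theorem hasExpansion_zero_of_isBigO {φ : ℝ → ℝ} (h : ∀ N : ℕ, φ =O[𝓝[>] 0] fun ε : ℝ => ε ^ N) :
    HasExpansion φ fun _ => 0 := fun N => by simpa using h N

theorem HasExpansion.isBigO {φ : ℝ → ℝ} (h : HasExpansion φ fun _ => 0) (N : ℕ) :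
    φ =O[𝓝[>] 0] fun ε : ℝ => ε ^ N := by simpa using h N

theorem isBigO_pow_mul_of_continuous {c : ℝ → ℝ} (hc : Continuous c) (N : ℕ) :
    (fun ε => ε ^ N * c ε) =O[𝓝[>] 0] fun ε : ℝ => ε ^ N := by
  have h : Tendsto c (𝓝[>] 0) (𝓝 (c 0)) := (hc.tendsto 0).mono_left nhdsWithin_le_nhds
  simpa using (isBigO_refl (fun ε : ℝ => ε ^ N) (𝓝[>] 0)).mul (h.isBigO_one ℝ)

/-- The expansion of a smooth function along the ray in the direction `e`. -/
theorem hasExpansion_of_taylor {t : X →L[ℝ] ℝ} {e : X} (he : t e = 1) {F : X → ℝ}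
    {a : ℕ → X → ℝ} (ha : ∀ n, ContDiff ℝ ∞ (a n)) (hF : ∀ N x,
      F x = ∑ n ∈ Finset.range N, t x ^ n * a n (x - t x • e) + t x ^ N * a N x)
    {x : X} (hx : t x = 0) : HasExpansion (fun ε => F (x + ε • e)) fun n => a n x := fun N => by
  have h1 : ∀ ε : ℝ, F (x + ε • e) - ∑ n ∈ Finset.range N, ε ^ n * a n x =
      ε ^ N * a N (x + ε • e) := by
    intro ε
    rw [hF N]
    simp [hx, he]
  simp only [h1]
  exact isBigO_pow_mul_of_continuous ((ha N).continuous.comp (by fun_prop)) N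

/-- A smooth function all of whose Taylor coefficients vanish at a set of points is divisible by
the powers of the variable. -/
theorem exists_quotient_of_hasExpansion_zero {t : X →L[ℝ] ℝ} {e : X} (he : t e = 1) {F : X → ℝ}
    (hF : ContDiff ℝ ∞ F) (N : ℕ) : ∃ R : X → ℝ, ContDiff ℝ ∞ R ∧
      ∀ x, HasExpansion (fun ε => F (x - t x • e + ε • e)) (fun _ => 0) → F x = t x ^ N * R x := by
  obtain ⟨a, ha, hFa⟩ := exists_taylor_coeff t e hF
  refine ⟨a N, ha N, fun x hx => ?_⟩
  have h0 : t (x - t x • e) = 0 := by simp [he]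
  have h1 := (hasExpansion_of_taylor he ha hFa h0).unique hx
  rw [hFa N x, Finset.sum_eq_zero, zero_add]
  intro n _
  rw [congrFun h1 n, mul_zero]

/-! ### Smooth extensions -/

/-- Multiplication by a bump function makes a local extension global, so that the Taylor and
Hadamard lemmas, which are about functions on the whole space, apply to germs. -/
theorem exists_contDiff_eqOn_nhds [FiniteDimensional ℝ X] {U : Set X} {F : X → ℝ} {w : X}
    (hU : IsOpen U) (hw : w ∈ U) (hF : ContDiffOn ℝ ∞ F U) :
    ∃ (V : Set X) (G : X → ℝ), IsOpen V ∧ w ∈ V ∧ V ⊆ U ∧ ContDiff ℝ ∞ G ∧ EqOn F G V := by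
  obtain ⟨r, hr, hrU⟩ := Metric.isOpen_iff.1 hU w hw
  let χ : ContDiffBump w := ⟨r / 4, r / 2, by positivity, by linarith⟩
  refine ⟨Metric.ball w (r / 4), fun x => χ x * F x, Metric.isOpen_ball,
    Metric.mem_ball_self (by positivity),
    (Metric.ball_subset_ball (by linarith)).trans hrU, ?_, ?_⟩
  · rw [contDiff_iff_contDiffAt]
    intro x
    by_cases hx : x ∈ U
    · exact χ.contDiff.contDiffAt.mul (hF.contDiffAt (hU.mem_nhds hx))
    · have h1 : x ∈ (Metric.closedBall w (r / 2))ᶜ := fun h => hx (hrU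
        (Metric.closedBall_subset_ball (by linarith) h))
      have h2 : (fun x => χ x * F x) =ᶠ[𝓝 x] fun _ => 0 := by
        filter_upwards [Metric.isClosed_closedBall.isOpen_compl.mem_nhds h1] with y hy
        have : χ y = 0 := χ.zero_of_le_dist (by
          simp only [mem_compl_iff, Metric.mem_closedBall, not_le] at hy
          exact hy.le)
        simp [this]
      exact contDiffAt_const.congr_of_eventuallyEq h2
  · intro x hx
    have : χ x = 1 := χ.one_of_mem_closedBall (Metric.ball_subset_closedBall hx)
    simp [this]

theorem ExtendsSmoothlyAt.exists_contDiff {k : ℕ} {Y : Type} [NormedAddCommGroup Y]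
    [NormedSpace ℝ Y] [FiniteDimensional ℝ Y] {S : Set (Pt k)} {Ψ : Pt k → Y} {w : Y}
    {f : Pt k → ℝ} (h : ExtendsSmoothlyAt S Ψ w f) :
    ∃ (U : Set Y) (F : Y → ℝ), IsOpen U ∧ w ∈ U ∧ ContDiff ℝ ∞ F ∧
      ∀ z ∈ S, Ψ z ∈ U → f z = F (Ψ z) := by
  obtain ⟨U, F, hU, hw, hF, h⟩ := h
  obtain ⟨V, G, hV, hwV, hVU, hG, hFG⟩ := exists_contDiff_eqOn_nhds hU hw hF
  exact ⟨V, G, hV, hwV, hG, fun z hz hzV => (h z hz (hVU hzV)).trans (hFG hzV)⟩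

end

section

/-! ### The Laplacian and the Newtonian potential on `ℝ³` -/

/-- The partial derivative `∂_j`. -/
def pd (j : Fin 3) (u : E3 → ℝ) (x : E3) : ℝ := fderiv ℝ u x (coordVec j)

/-- The Laplacian of a function on `ℝ³`. -/
def lap (u : E3 → ℝ) (x : E3) : ℝ := ∑ j, pd j (pd j u) x

theorem contDiff_pd (j : Fin 3) {u : E3 → ℝ} (hu : ContDiff ℝ ∞ u) : ContDiff ℝ ∞ (pd j u) :=
  (hu.fderiv_right (by simp)).clm_apply contDiff_const

theorem contDiff_lap {u : E3 → ℝ} (hu : ContDiff ℝ ∞ u) : ContDiff ℝ ∞ (lap u) :=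
  ContDiff.sum fun j _ => contDiff_pd j (contDiff_pd j hu)

theorem hasCompactSupport_pd (j : Fin 3) {u : E3 → ℝ} (hu : HasCompactSupport u) :
    HasCompactSupport (pd j u) := hu.fderiv_apply ℝ (coordVec j)

theorem hasCompactSupport_lap {u : E3 → ℝ} (hu : HasCompactSupport u) :
    HasCompactSupport (lap u) := by
  have : lap u = pd 0 (pd 0 u) + pd 1 (pd 1 u) + pd 2 (pd 2 u) := by
    ext x
    simp [lap, Fin.sum_univ_three]
  rw [this]
  exact (((hasCompactSupport_pd 0 (hasCompactSupport_pd 0 hu)).add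
    (hasCompactSupport_pd 1 (hasCompactSupport_pd 1 hu))).add
    (hasCompactSupport_pd 2 (hasCompactSupport_pd 2 hu)))

theorem norm_sq_eq_sum (x : E3) : ‖x‖ ^ 2 = x 0 ^ 2 + x 1 ^ 2 + x 2 ^ 2 := by
  rw [EuclideanSpace.norm_sq_eq]
  simp [Fin.sum_univ_three]

theorem inner_coordVec (x : E3) (j : Fin 3) : inner ℝ x (coordVec j) = x j := by
  simp [coordVec, EuclideanSpace.inner_single_right]

/-- In polar coordinates the density is $r^2\cdot r^{-1}=r$. -/
theorem locallyIntegrable_norm_inv : LocallyIntegrable (fun z : E3 => ‖z‖⁻¹) volume := by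
  rw [locallyIntegrable_iff]
  intro K hK
  obtain ⟨r, hr⟩ := hK.isBounded.subset_ball 0
  refine IntegrableOn.mono_set ?_ hr
  rw [integrableOn_fun_norm_addHaar (μ := (volume : Measure E3)) (f := fun y : ℝ => y⁻¹)]
  have h1 : IntegrableOn (fun y : ℝ => y) (Ioo 0 r) :=
    (continuous_id.integrableOn_Icc (a := 0) (b := r)).mono_set Ioo_subset_Icc_self
  refine h1.congr_fun (fun y hy => ?_) measurableSet_Ioo
  have : y ≠ 0 := hy.1.ne'
  simp
  field_simp

/-- The regularized kernel `(|z|² + η²)^{-1/2}`. -/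
def regKernel (η : ℝ) (z : E3) : ℝ := (√(‖z‖ ^ 2 + η ^ 2))⁻¹

theorem sqrt_reg_pos {η : ℝ} (hη : 0 < η) (z : E3) : 0 < √(‖z‖ ^ 2 + η ^ 2) := by positivity

theorem contDiff_regKernel {η : ℝ} (hη : 0 < η) : ContDiff ℝ ∞ (regKernel η) := by
  refine ContDiff.inv (ContDiff.sqrt ?_ fun z => ?_) fun z => (sqrt_reg_pos hη z).ne'
  · exact (contDiff_norm_sq ℝ).add contDiff_const
  · positivity

theorem hasFDerivAt_sqrt_reg {η : ℝ} (hη : 0 < η) (z : E3) : HasFDerivAt (fun z : E3 => √(‖z‖ ^ 2 + η ^ 2))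
    ((√(‖z‖ ^ 2 + η ^ 2))⁻¹ • innerSL ℝ z) z := by
  have h1 : HasFDerivAt (fun z : E3 => ‖z‖ ^ 2 + η ^ 2) (2 • innerSL ℝ z) z :=
    ((hasStrictFDerivAt_norm_sq z).hasFDerivAt).add_const _
  have h2 := h1.sqrt (by positivity)
  rw [← Nat.cast_smul_eq_nsmul ℝ, smul_smul] at h2
  have h3 : (1 / (2 * √(‖z‖ ^ 2 + η ^ 2))) * ((2 : ℕ) : ℝ) = (√(‖z‖ ^ 2 + η ^ 2))⁻¹ := by
    have := sqrt_reg_pos hη z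
    push_cast
    field_simp
  rwa [h3] at h2

theorem pd_regKernel {η : ℝ} (hη : 0 < η) (j : Fin 3) :
    pd j (regKernel η) = fun z => - (z j * regKernel η z ^ 3) := by
  ext z
  have h := (hasDerivAt_inv (sqrt_reg_pos hη z).ne').comp_hasFDerivAt z
    (hasFDerivAt_sqrt_reg hη z)
  have h2 : HasFDerivAt (regKernel η) _ z := h
  rw [pd, h2.fderiv]
  have := (sqrt_reg_pos hη z).ne'
  simp only [regKernel, smul_apply, innerSL_apply_apply, inner_coordVec,
    smul_eq_mul]
  field_simp

theorem pd_pd_regKernel {η : ℝ} (hη : 0 < η) (j : Fin 3) (z : E3) :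
    pd j (pd j (regKernel η)) z = - regKernel η z ^ 3 + 3 * z j ^ 2 * regKernel η z ^ 5 := by
  have h0 : HasFDerivAt (regKernel η) (fderiv ℝ (regKernel η) z) z :=
    ((contDiff_regKernel hη).differentiable (by simp) z).hasFDerivAt
  have hc : HasFDerivAt (fun z : E3 => z j) (EuclideanSpace.proj j : E3 →L[ℝ] ℝ) z :=
    (EuclideanSpace.proj j : E3 →L[ℝ] ℝ).hasFDerivAt
  have h := (hc.mul (h0.pow 3)).neg
  have h1 := congrFun (pd_regKernel hη j) z
  rw [pd] at h1
  rw [pd, pd_regKernel hη]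
  rw [show (fun z : E3 => -(z j * regKernel η z ^ 3)) = -((fun z : E3 => z j) * fun z => regKernel η z ^ 3)
    from rfl, h.fderiv]
  have h2 : (EuclideanSpace.proj j : E3 →L[ℝ] ℝ) (coordVec j) = 1 := by simp [coordVec]
  simp only [neg_apply, add_apply, smul_apply, h1, h2, smul_eq_mul, nsmul_eq_mul]
  push_cast
  ring

theorem lap_regKernel {η : ℝ} (hη : 0 < η) (z : E3) : lap (regKernel η) z = - (3 * η ^ 2 * regKernel η z ^ 5) := by
  have h : regKernel η z ^ 2 * (‖z‖ ^ 2 + η ^ 2) = 1 := by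
    rw [regKernel, inv_pow, Real.sq_sqrt (by positivity)]
    exact inv_mul_cancel₀ (by positivity)
  rw [norm_sq_eq_sum] at h
  simp only [lap, pd_pd_regKernel hη, Fin.sum_univ_three]
  linear_combination 3 * regKernel η z ^ 3 * h

theorem integral_mul_pd {f g : E3 → ℝ} (j : Fin 3) (hf : ContDiff ℝ ∞ f) (hg : ContDiff ℝ ∞ g)
    (hgs : HasCompactSupport g) : ∫ z, f z * pd j g z = - ∫ z, pd j f z * g z := by
  refine integral_mul_fderiv_eq_neg_fderiv_mul_of_integrable ?_ ?_ ?_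
    (fun x _ => hf.differentiable (by simp) x) (fun x _ => hg.differentiable (by simp) x)
  · exact ((contDiff_pd j hf).continuous.mul hg.continuous).integrable_of_hasCompactSupport
      hgs.mul_left
  · exact (hf.continuous.mul (contDiff_pd j hg).continuous).integrable_of_hasCompactSupport
      (hasCompactSupport_pd j hgs).mul_left
  · exact (hf.continuous.mul hg.continuous).integrable_of_hasCompactSupport hgs.mul_left

theorem integral_mul_lap {f g : E3 → ℝ} (hf : ContDiff ℝ ∞ f) (hg : ContDiff ℝ ∞ g)
    (hgs : HasCompactSupport g) : ∫ z, f z * lap g z = ∫ z, lap f z * g z := by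
  have hi : ∀ j, Integrable fun z => f z * pd j (pd j g) z := fun j =>
    (hf.continuous.mul (contDiff_pd j (contDiff_pd j hg)).continuous).integrable_of_hasCompactSupport
      (hasCompactSupport_pd j (hasCompactSupport_pd j hgs)).mul_left
  have hi' : ∀ j, Integrable fun z => pd j (pd j f) z * g z := fun j =>
    ((contDiff_pd j (contDiff_pd j hf)).continuous.mul hg.continuous).integrable_of_hasCompactSupport
      hgs.mul_left
  simp only [lap, Finset.mul_sum, Finset.sum_mul]
  rw [integral_finsetSum _ fun j _ => hi j, integral_finsetSum _ fun j _ => hi' j]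
  refine Finset.sum_congr rfl fun j _ => ?_
  rw [integral_mul_pd j hf (contDiff_pd j hg) (hasCompactSupport_pd j hgs),
    integral_mul_pd j (contDiff_pd j hf) hg hgs, neg_neg]

/-- The total mass of `-Δ(1/|z|)`. -/
def kernelMass : ℝ := ∫ w : E3, 3 * regKernel 1 w ^ 5

theorem integrable_regKernel_pow : Integrable fun w : E3 => 3 * regKernel 1 w ^ 5 := by
  have h := (integrable_rpow_neg_one_add_norm_sq (E := E3) (μ := volume) (r := 5)
    (by simp; norm_num)).const_mul 3
  refine h.congr (Eventually.of_forall fun w => ?_)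
  have h1 : (0 : ℝ) < 1 + ‖w‖ ^ 2 := by positivity
  simp only [regKernel, one_pow]
  rw [add_comm (‖w‖ ^ 2), Real.sqrt_eq_rpow, ← Real.rpow_neg h1.le,
    ← Real.rpow_natCast (_ ^ (-(1 / 2) : ℝ)) 5, ← Real.rpow_mul h1.le]
  norm_num

/-- Only the invertibility of this constant is needed, to normalize the fundamental solution; its
value is never computed. -/
theorem kernelMass_pos : 0 < kernelMass := by
  have hpos : ∀ w : E3, 0 < 3 * regKernel 1 w ^ 5 := fun w => by
    have := sqrt_reg_pos one_pos w
    rw [regKernel]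
    positivity
  rw [kernelMass, integral_pos_iff_support_of_nonneg (fun w => (hpos w).le)
    integrable_regKernel_pow]
  have : Function.support (fun w : E3 => 3 * regKernel 1 w ^ 5) = univ :=
    eq_univ_of_forall fun w => (hpos w).ne'
  rw [this]
  exact Measure.measure_univ_pos.2 (NeZero.ne _)

/-- Under $z=\eta w$ the density $3\eta^2(|z|^2+\eta^2)^{-5/2}$ scales by $\eta^{-3}$, which cancels
the Jacobian: the Laplacians of the regularized kernels are, up to sign and total mass, an
approximate identity. -/
theorem integral_lap_regKernel_mul {η : ℝ} (hη : 0 < η) (φ : E3 → ℝ) :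
    ∫ z, lap (regKernel η) z * φ z = - ∫ w, 3 * regKernel 1 w ^ 5 * φ (η • w) := by
  have h := Measure.integral_comp_smul (volume : Measure E3)
    (fun z => lap (regKernel η) z * φ z) η
  have h1 : ∀ w : E3, lap (regKernel η) (η • w) = - (η ^ 3)⁻¹ * (3 * regKernel 1 w ^ 5) := by
    intro w
    rw [lap_regKernel hη]
    have h2 : regKernel η (η • w) = η⁻¹ * regKernel 1 w := by
      rw [regKernel, regKernel, norm_smul, Real.norm_of_nonneg hη.le,
        show (η * ‖w‖) ^ 2 + η ^ 2 = η ^ 2 * (‖w‖ ^ 2 + 1 ^ 2) by ring,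
        Real.sqrt_mul (by positivity), Real.sqrt_sq hη.le, mul_inv]
    rw [h2]
    field_simp
  simp only [h1] at h
  rw [show Module.finrank ℝ E3 = 3 by simp, abs_of_pos (by positivity), smul_eq_mul] at h
  simp only [mul_assoc] at h
  rw [integral_const_mul] at h
  have h3 : (η ^ 3)⁻¹ ≠ 0 := by positivity
  have h4 : (η ^ 3)⁻¹ * (∫ z, lap (regKernel η) z * φ z) =
      (η ^ 3)⁻¹ * (- ∫ w, 3 * regKernel 1 w ^ 5 * φ (η • w)) := by
    rw [← h]
    simp only [mul_assoc]
    ring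
  exact mul_left_cancel₀ h3 h4

/-- The regularized kernels increase to $1/|z|$ as $\eta\to0$, which dominates them. Integration by
parts moves the Laplacian to the kernel, where it concentrates at the origin; both sides are limits
of the same sequence. -/
theorem integral_norm_inv_mul_lap {φ : E3 → ℝ} (hφ : ContDiff ℝ ∞ φ) (hs : HasCompactSupport φ) :
    ∫ z, ‖z‖⁻¹ * lap φ z = - (kernelMass * φ 0) := by
  have hu0 : Tendsto (fun n : ℕ => (1 : ℝ) / (n + 1)) atTop (𝓝 0) :=
    tendsto_one_div_add_atTop_nhds_zero_nat
  have hup : ∀ n : ℕ, (0 : ℝ) < 1 / (n + 1) := fun n => by positivity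
  have hlc := (contDiff_lap hφ).continuous
  have h1 : Tendsto (fun n : ℕ => ∫ z, regKernel (1 / (n + 1)) z * lap φ z) atTop
      (𝓝 (∫ z, ‖z‖⁻¹ * lap φ z)) := by
    have hne : ∀ᵐ z : E3, z ≠ 0 := by
      rw [ae_iff]
      simp
    refine tendsto_integral_of_dominated_convergence (fun z => ‖z‖⁻¹ * ‖lap φ z‖) ?_ ?_ ?_ ?_
    · exact fun n => ((contDiff_regKernel (hup n)).continuous.mul hlc).aestronglyMeasurable
    · have := locallyIntegrable_norm_inv.integrable_smul_right_of_hasCompactSupport hlc.norm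
        (hasCompactSupport_lap hs).norm
      simpa using this
    · intro n
      filter_upwards [hne] with z hz
      rw [norm_mul]
      refine mul_le_mul_of_nonneg_right ?_ (norm_nonneg _)
      rw [regKernel, norm_inv, Real.norm_of_nonneg (Real.sqrt_nonneg _)]
      refine inv_anti₀ (norm_pos_iff.2 hz) (Real.le_sqrt_of_sq_le ?_)
      have := hup n
      nlinarith [sq_nonneg (1 / ((n : ℝ) + 1))]
    · filter_upwards [hne] with z hz
      refine Tendsto.mul_const _ ?_
      have h2 : Tendsto (fun n : ℕ => √(‖z‖ ^ 2 + (1 / ((n : ℝ) + 1)) ^ 2)) atTop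
          (𝓝 (√(‖z‖ ^ 2 + 0 ^ 2))) :=
        ((hu0.pow 2).const_add _).sqrt
      have h3 : √(‖z‖ ^ 2 + 0 ^ 2) = ‖z‖ := by simp
      rw [h3] at h2
      exact h2.inv₀ (norm_ne_zero_iff.2 hz)
  have h2 : Tendsto (fun n : ℕ => ∫ z, regKernel (1 / (n + 1)) z * lap φ z) atTop
      (𝓝 (- (kernelMass * φ 0))) := by
    have h3 : ∀ n : ℕ, ∫ z, regKernel (1 / (n + 1)) z * lap φ z =
        - ∫ w, 3 * regKernel 1 w ^ 5 * φ ((1 / ((n : ℝ) + 1)) • w) := fun n => by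
      rw [integral_mul_lap (contDiff_regKernel (hup n)) hφ hs,
        integral_lap_regKernel_mul (hup n)]
    simp only [h3]
    refine Tendsto.neg ?_
    rw [kernelMass, ← integral_mul_const]
    obtain ⟨C, hC⟩ := hs.exists_bound_of_continuous hφ.continuous
    refine tendsto_integral_of_dominated_convergence (fun w => 3 * regKernel 1 w ^ 5 * C) ?_
      (integrable_regKernel_pow.mul_const C) ?_ ?_
    · intro n
      refine Continuous.aestronglyMeasurable ?_
      have := (contDiff_regKernel one_pos).continuous
      have := hφ.continuous
      fun_prop
    · refine fun n => Eventually.of_forall fun w => ?_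
      have h4 : 0 ≤ 3 * regKernel 1 w ^ 5 := by
        rw [regKernel]
        positivity
      rw [norm_mul, Real.norm_of_nonneg h4]
      exact mul_le_mul_of_nonneg_left (hC _) h4
    · refine Eventually.of_forall fun w => Tendsto.const_mul _ ?_
      have h5 : Tendsto (fun n : ℕ => (1 / ((n : ℝ) + 1)) • w) atTop (𝓝 ((0 : ℝ) • w)) :=
        hu0.smul_const w
      rw [zero_smul] at h5
      exact (hφ.continuous.tendsto 0).comp h5
  exact tendsto_nhds_unique h1 h2

/-- The potential `∫ f(x - z) / |z| dz`. -/
def potentialOf (f : E3 → ℝ) (x : E3) : ℝ := ∫ z, ‖z‖⁻¹ * f (x - z)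

theorem potentialOf_eq_convolution (f : E3 → ℝ) : potentialOf f =
    convolution (fun z : E3 => ‖z‖⁻¹) f (ContinuousLinearMap.lsmul ℝ ℝ) volume := by
  ext x
  simp [potentialOf, convolution]

theorem contDiff_potentialOf {f : E3 → ℝ} (hf : ContDiff ℝ ∞ f) (hs : HasCompactSupport f) :
    ContDiff ℝ ∞ (potentialOf f) := by
  rw [potentialOf_eq_convolution]
  exact hs.contDiff_convolution_right (n := ⊤) _ locallyIntegrable_norm_inv hf

theorem pd_potentialOf (j : Fin 3) {f : E3 → ℝ} (hf : ContDiff ℝ ∞ f) (hs : HasCompactSupport f) :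
    pd j (potentialOf f) = potentialOf (pd j f) := by
  ext x
  have h := hs.hasFDerivAt_convolution_right (ContinuousLinearMap.lsmul ℝ ℝ)
    locallyIntegrable_norm_inv (hf.of_le (by simp)) x
  rw [← potentialOf_eq_convolution] at h
  rw [pd, h.fderiv, convolution_precompR_apply _ locallyIntegrable_norm_inv (hs.fderiv ℝ)
    (hf.continuous_fderiv (by simp))]
  simp [potentialOf, convolution, pd]

theorem potentialOf_neg_right (f : E3 → ℝ) (x : E3) :
    potentialOf f x = ∫ z, ‖z‖⁻¹ * f (x + z) := by
  rw [potentialOf, ← integral_neg_eq_self]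
  simp

/-- Derivatives of the potential fall on the density, so the claim at `x` is
`integral_norm_inv_mul_lap` for the translate of `f` by `x`. -/
theorem lap_potentialOf {f : E3 → ℝ} (hf : ContDiff ℝ ∞ f) (hs : HasCompactSupport f) (x : E3) :
    lap (potentialOf f) x = - (kernelMass * f x) := by
  have h1 : lap (potentialOf f) x = ∑ j, potentialOf (pd j (pd j f)) x := by
    refine Finset.sum_congr rfl fun j _ => ?_
    rw [pd_potentialOf j hf hs, pd_potentialOf j (contDiff_pd j hf) (hasCompactSupport_pd j hs)]
  have h2 : ∀ (j : Fin 3) (g : E3 → ℝ), pd j (fun z => g (x + z)) = fun z => pd j g (x + z) := by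
    intro j g
    ext z
    rw [pd, pd, fderiv_comp_add_left]
  have h3 := integral_norm_inv_mul_lap (φ := fun z => f (x + z)) (hf.comp (by fun_prop))
    (hs.comp_homeomorph (Homeomorph.addLeft x))
  simp only [add_zero] at h3
  rw [h1, ← h3]
  simp only [lap, h2, Finset.mul_sum, potentialOf_neg_right]
  rw [integral_finsetSum]
  intro j _
  have h4 := locallyIntegrable_norm_inv.integrable_smul_right_of_hasCompactSupport
    (g := fun z => pd j (pd j f) (x + z))
    ((contDiff_pd j (contDiff_pd j hf)).continuous.comp (by fun_prop))
    ((hasCompactSupport_pd j (hasCompactSupport_pd j hs)).comp_homeomorph (Homeomorph.addLeft x))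
  simpa using h4

end

section

/-! ### Inversion and the Kelvin transform -/

/-- The inversion in the unit sphere. -/
def inv3 (x : E3) : E3 := (‖x‖ ^ 2)⁻¹ • x

theorem norm_inv3 (x : E3) : ‖inv3 x‖ = ‖x‖⁻¹ := by
  rw [inv3, norm_smul, norm_inv, norm_pow, norm_norm]
  by_cases hx : ‖x‖ = 0
  · simp [hx]
  · field_simp

theorem inv3_inv3 (x : E3) : inv3 (inv3 x) = x := by
  rw [inv3, norm_inv3, inv3, smul_smul]
  by_cases hx : ‖x‖ = 0
  · simp [norm_eq_zero.1 hx]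
  · have : ((‖x‖⁻¹) ^ 2)⁻¹ * (‖x‖ ^ 2)⁻¹ = 1 := by field_simp
    rw [this, one_smul]

theorem inv3_ne_zero {x : E3} (hx : x ≠ 0) : inv3 x ≠ 0 := by
  rw [← norm_ne_zero_iff, norm_inv3]
  exact inv_ne_zero (norm_ne_zero_iff.2 hx)

theorem inv3_neg (x : E3) : inv3 (-x) = -inv3 x := by simp [inv3]

theorem contDiffAt_inv3 {x : E3} (hx : x ≠ 0) : ContDiffAt ℝ ∞ inv3 x :=
  ((contDiff_norm_sq ℝ).contDiffAt.inv (by simpa using hx)).smul contDiffAt_id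

theorem hasFDerivAt_norm_inv {x : E3} (hx : x ≠ 0) :
    HasFDerivAt (fun y : E3 => ‖y‖⁻¹) (-(‖x‖⁻¹ ^ 3) • innerSL ℝ x) x := by
  have h2 : HasFDerivAt (fun y : E3 => √(‖y‖ ^ 2)) (‖x‖⁻¹ • innerSL ℝ x) x := by
    have hn : (‖x‖ ^ 2) ≠ 0 := by simpa using hx
    have h3 := ((hasStrictFDerivAt_norm_sq x).hasFDerivAt).sqrt hn
    rw [← Nat.cast_smul_eq_nsmul ℝ, smul_smul] at h3
    have h4 : (1 / (2 * √(‖x‖ ^ 2))) * ((2 : ℕ) : ℝ) = ‖x‖⁻¹ := by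
      rw [Real.sqrt_sq (norm_nonneg x)]
      have : ‖x‖ ≠ 0 := by simpa using hx
      push_cast
      field_simp
    rwa [h4] at h3
  simp only [Real.sqrt_sq (norm_nonneg _)] at h2
  have h5 := (hasDerivAt_inv (norm_ne_zero_iff.2 hx)).comp_hasFDerivAt x h2
  rw [smul_smul] at h5
  have h6 : -(‖x‖ ^ 2)⁻¹ * ‖x‖⁻¹ = -(‖x‖⁻¹ ^ 3) := by ring
  rwa [h6] at h5

theorem hasFDerivAt_inv3 {x : E3} (hx : x ≠ 0) : HasFDerivAt inv3
    (‖x‖⁻¹ ^ 2 • ContinuousLinearMap.id ℝ E3 -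
      (2 * ‖x‖⁻¹ ^ 4) • (innerSL ℝ x).smulRight x) x := by
  have h1 := ((hasFDerivAt_norm_inv hx).pow 2).smul (hasFDerivAt_id x)
  have h2 : inv3 = fun y => (‖y‖⁻¹) ^ 2 • y := by
    ext1 y
    rw [inv3, inv_pow]
  rw [h2]
  refine h1.congr_fderiv ?_
  ext1 v
  simp [smul_smul, sub_eq_add_neg]
  ring_nf

theorem pd_eq_of_hasFDerivAt {u : E3 → ℝ} {L : E3 →L[ℝ] ℝ} {x : E3} (h : HasFDerivAt u L x)
    (j : Fin 3) : pd j u x = L (coordVec j) := by rw [pd, h.fderiv]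

theorem fderiv_apply_eq_sum (u : E3 → ℝ) (y x : E3) :
    fderiv ℝ u y x = x 0 * pd 0 u y + x 1 * pd 1 u y + x 2 * pd 2 u y := by
  have h : x = x 0 • coordVec 0 + x 1 • coordVec 1 + x 2 • coordVec 2 := by
    ext i
    fin_cases i <;> simp [coordVec]
  conv_lhs => rw [h]
  simp [pd]

theorem hasFDerivAt_comp_inv3 {u : E3 → ℝ} (hu : ContDiff ℝ ∞ u) {x : E3} (hx : x ≠ 0) :
    ∃ L : E3 →L[ℝ] ℝ, HasFDerivAt (fun y => u (inv3 y)) L x ∧ ∀ j, L (coordVec j) =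
      ‖x‖⁻¹ ^ 2 * pd j u (inv3 x) - 2 * ‖x‖⁻¹ ^ 4 * x j *
        (x 0 * pd 0 u (inv3 x) + x 1 * pd 1 u (inv3 x) + x 2 * pd 2 u (inv3 x)) := by
  refine ⟨_, ((hu.differentiable (by simp) _).hasFDerivAt).comp x (hasFDerivAt_inv3 hx),
    fun j => ?_⟩
  simp [inner_coordVec, fderiv_apply_eq_sum u _ x, pd]
  ring

/-- The Kelvin transform. -/
def kelvin (u : E3 → ℝ) (x : E3) : ℝ := ‖x‖⁻¹ * u (inv3 x)

theorem pd_kelvin (j : Fin 3) {u : E3 → ℝ} (hu : ContDiff ℝ ∞ u) {x : E3} (hx : x ≠ 0) :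
    pd j (kelvin u) x = -(‖x‖⁻¹ ^ 3 * (x j * u (inv3 x))) + ‖x‖⁻¹ ^ 3 * pd j u (inv3 x) -
      ‖x‖⁻¹ ^ 5 * (x j * (2 * (x 0 * pd 0 u (inv3 x) + x 1 * pd 1 u (inv3 x) +
        x 2 * pd 2 u (inv3 x)))) := by
  obtain ⟨L, hL, hLj⟩ := hasFDerivAt_comp_inv3 hu hx
  have h : HasFDerivAt (kelvin u) _ x := (hasFDerivAt_norm_inv hx).mul hL
  rw [pd, h.fderiv]
  simp [hLj, inner_coordVec]
  ring

/-- The conformal covariance of the Laplacian under inversion in dimension three, by direct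
differentiation. -/
theorem lap_kelvin {u : E3 → ℝ} (hu : ContDiff ℝ ∞ u) {x : E3} (hx : x ≠ 0) :
    lap (kelvin u) x = ‖x‖⁻¹ ^ 5 * lap u (inv3 x) := by
  obtain ⟨L, hL, hLj⟩ := hasFDerivAt_comp_inv3 hu hx
  choose M hM hMj using fun j => hasFDerivAt_comp_inv3 (contDiff_pd j hu) hx
  have hc : ∀ j : Fin 3, HasFDerivAt (fun z : E3 => z j) (EuclideanSpace.proj j : E3 →L[ℝ] ℝ) x :=
    fun j => (EuclideanSpace.proj j : E3 →L[ℝ] ℝ).hasFDerivAt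
  have hcc : ∀ i j : Fin 3, (EuclideanSpace.proj i : E3 →L[ℝ] ℝ) (coordVec j) =
      if i = j then 1 else 0 := fun i j => by simp [coordVec]
  have hι := hasFDerivAt_norm_inv hx
  have h1 : ∀ j, pd j (pd j (kelvin u)) x = pd j (fun x =>
      -(‖x‖⁻¹ ^ 3 * (x j * u (inv3 x))) + ‖x‖⁻¹ ^ 3 * pd j u (inv3 x) -
      ‖x‖⁻¹ ^ 5 * (x j * (2 * (x 0 * pd 0 u (inv3 x) + x 1 * pd 1 u (inv3 x) +
        x 2 * pd 2 u (inv3 x))))) x := by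
    intro j
    have := eventually_of_mem (isOpen_ne.mem_nhds hx) fun y hy => pd_kelvin j hu hy
    rw [pd, EventuallyEq.fderiv_eq this, pd]
  have h2 : ∀ j, HasFDerivAt (fun x =>
      -(‖x‖⁻¹ ^ 3 * (x j * u (inv3 x))) + ‖x‖⁻¹ ^ 3 * pd j u (inv3 x) -
      ‖x‖⁻¹ ^ 5 * (x j * (2 * (x 0 * pd 0 u (inv3 x) + x 1 * pd 1 u (inv3 x) +
        x 2 * pd 2 u (inv3 x))))) _ x := fun j =>
    (((hι.pow 3).mul ((hc j).mul hL)).neg.add ((hι.pow 3).mul (hM j))).sub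
      ((hι.pow 5).mul ((hc j).mul (((((hc 0).mul (hM 0)).add ((hc 1).mul (hM 1))).add
        ((hc 2).mul (hM 2))).const_mul 2)))
  have hr : ‖x‖⁻¹ ^ 2 * (x 0 ^ 2 + x 1 ^ 2 + x 2 ^ 2) = 1 := by
    rw [← norm_sq_eq_sum]
    have : ‖x‖ ≠ 0 := by simpa using hx
    field_simp
  simp only [lap, h1, Fin.sum_univ_three]
  rw [pd_eq_of_hasFDerivAt (h2 0), pd_eq_of_hasFDerivAt (h2 1), pd_eq_of_hasFDerivAt (h2 2)]
  simp only [add_apply, sub_apply, neg_apply, smul_apply, smul_eq_mul, nsmul_eq_mul,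
    innerSL_apply_apply, inner_coordVec, hLj, hMj, hcc]
  simp only [Pi.mul_apply, Fin.isValue, reduceIte, Fin.reduceEq]
  set ι := ‖x‖⁻¹
  set U := u (inv3 x)
  generalize hW : (fun i j => pd i (pd j u) (inv3 x)) = W
  have hW' : ∀ i j, pd i (pd j u) (inv3 x) = W i j := fun i j => by rw [← hW]
  simp only [hW']
  generalize pd 0 u (inv3 x) = V0 at *
  generalize pd 1 u (inv3 x) = V1 at *
  generalize pd 2 u (inv3 x) = V2 at *
  push_cast
  -- All unwanted terms, of order zero, one and two in `u`, cancel modulo the single relation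
  -- $|x|^{-2}(x_0^2+x_1^2+x_2^2)=1$.
  linear_combination (3 * ι ^ 3 * U + 12 * ι ^ 5 * (x 0 * V0 + x 1 * V1 + x 2 * V2) +
    4 * ι ^ 7 * (x 0 * (x 0 * W 0 0 + x 1 * W 0 1 + x 2 * W 0 2) +
      x 1 * (x 0 * W 1 0 + x 1 * W 1 1 + x 2 * W 1 2) +
      x 2 * (x 0 * W 2 0 + x 1 * W 2 1 + x 2 * W 2 2))) * hr

theorem kelvin_kelvin (u : E3 → ℝ) {x : E3} (hx : x ≠ 0) : kelvin (kelvin u) x = u x := by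
  have : ‖x‖ ≠ 0 := by simpa using hx
  rw [kelvin, kelvin, inv3_inv3, norm_inv3]
  field_simp

theorem contDiffAt_norm_inv {x : E3} (hx : x ≠ 0) : ContDiffAt ℝ ∞ (fun y : E3 => ‖y‖⁻¹) x :=
  (contDiffAt_norm ℝ hx).inv (norm_ne_zero_iff.2 hx)

theorem contDiffAt_kelvin {u : E3 → ℝ} (hu : ContDiff ℝ ∞ u) {x : E3} (hx : x ≠ 0) :
    ContDiffAt ℝ ∞ (kelvin u) x :=
  (contDiffAt_norm_inv hx).mul (hu.contDiffAt.comp x (contDiffAt_inv3 hx))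

theorem one_sub_two_inner_pos {x y : E3} (h : ‖x‖ * ‖y‖ < 1) :
    0 < 1 - 2 * inner ℝ x y + ‖x‖ ^ 2 * ‖y‖ ^ 2 := by
  have h1 := real_inner_le_norm x y
  nlinarith [sq_nonneg (1 - ‖x‖ * ‖y‖)]

/-- Since $|x|\,\bigl|x/|x|^2-y\bigr|=(1-2\langle x,y\rangle+|x|^2|y|^2)^{1/2}$, the transformed
kernel is smooth near $x=0$ for bounded $y$. This exhibits the regularity at infinity of the
potential of a compactly supported density. -/
theorem kelvin_potentialOf (f : E3 → ℝ) {x : E3} (hx : x ≠ 0) : kelvin (potentialOf f) x =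
    ∫ y, (1 : ℝ) • (f y * (√(1 - 2 * inner ℝ x y + ‖x‖ ^ 2 * ‖y‖ ^ 2))⁻¹) := by
  have hn : ‖x‖ ≠ 0 := by simpa using hx
  rw [kelvin, potentialOf, ← integral_const_mul,
    ← integral_sub_left_eq_self (fun z : E3 => ‖x‖⁻¹ * (‖z‖⁻¹ * f (inv3 x - z))) volume (inv3 x)]
  congr 1
  ext y
  have h1 : ‖x‖ * ‖inv3 x - y‖ = √(1 - 2 * inner ℝ x y + ‖x‖ ^ 2 * ‖y‖ ^ 2) := by
    rw [← Real.sqrt_sq (mul_nonneg (norm_nonneg x) (norm_nonneg (inv3 x - y))), mul_pow,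
      norm_sub_sq_real, norm_inv3, inv3, real_inner_smul_left]
    congr 1
    field_simp
  rw [← h1, mul_inv, sub_sub_cancel, one_smul]
  ring

/-- The Newtonian potential of a compactly supported function is smooth at infinity. -/
theorem exists_potential_of_hasCompactSupport {f : E3 → ℝ} (hf : ContDiff ℝ ∞ f)
    (hs : HasCompactSupport f) : ∃ u v : E3 → ℝ, ContDiff ℝ ∞ u ∧ ContDiff ℝ ∞ v ∧
      (∀ x, lap u x = f x) ∧ ∀ x ≠ 0, v x = kelvin u x := by
  set c : ℝ := -kernelMass⁻¹
  have hcf : ContDiff ℝ ∞ fun x => c * f x := contDiff_const.mul hf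
  have hcs : HasCompactSupport fun x => c * f x := hs.mul_left
  have hu := contDiff_potentialOf hcf hcs
  let K : E3 → ℝ := fun x => ∫ y, (1 : ℝ) •
    (c * f y * (√(1 - 2 * inner ℝ x y + ‖x‖ ^ 2 * ‖y‖ ^ 2))⁻¹)
  obtain ⟨r, hr, hrf⟩ : ∃ r : ℝ, 0 < r ∧ ∀ y ∈ tsupport f, ‖y‖ < r := by
    obtain ⟨r, hr⟩ := hs.isBounded.subset_ball 0
    exact ⟨max r 1, by positivity, fun y hy => lt_max_of_lt_left (by simpa using hr hy)⟩
  -- For $|x|<1/r$ and $|y|<r$ the radicand is at least $(1-|x||y|)^2>0$; off the support of `f` the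
  -- integrand vanishes identically, whatever the radicand.
  have hK : ContDiffOn ℝ ∞ K (Metric.ball 0 r⁻¹) := by
    refine contDiffOn_integral_smul (g := fun q : E3 × E3 =>
      c * f q.2 * (√(1 - 2 * inner ℝ q.1 q.2 + ‖q.1‖ ^ 2 * ‖q.2‖ ^ 2))⁻¹) Metric.isOpen_ball hs
      ?_ (continuous_const.locallyIntegrable) ?_
    · intro x y _ hy
      simp [image_eq_zero_of_notMem_tsupport hy]
    · rintro ⟨x, y⟩ ⟨hx, -⟩
      refine ContDiffAt.contDiffWithinAt ?_
      by_cases hy : y ∈ tsupport f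
      · have hpos : 0 < 1 - 2 * inner ℝ x y + ‖x‖ ^ 2 * ‖y‖ ^ 2 := by
          refine one_sub_two_inner_pos ?_
          have h1 : ‖x‖ < r⁻¹ := by simpa using hx
          have h2 := hrf y hy
          calc ‖x‖ * ‖y‖ < r⁻¹ * r := mul_lt_mul'' h1 h2 (norm_nonneg _) (norm_nonneg _)
            _ = 1 := inv_mul_cancel₀ hr.ne'
        have h3 : ContDiff ℝ ∞ fun q : E3 × E3 =>
            1 - 2 * inner ℝ q.1 q.2 + ‖q.1‖ ^ 2 * ‖q.2‖ ^ 2 :=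
          (contDiff_const.sub (contDiff_const.mul (contDiff_fst.inner ℝ contDiff_snd))).add
            ((contDiff_fst.norm_sq ℝ).mul (contDiff_snd.norm_sq ℝ))
        exact ((contDiff_const.mul (hf.comp contDiff_snd)).contDiffAt).mul
          ((h3.contDiffAt.sqrt hpos.ne').inv (Real.sqrt_pos.2 hpos).ne')
      · have h4 : ∀ᶠ q : E3 × E3 in 𝓝 (x, y), f q.2 = 0 := by
          have h5 := (isClosed_tsupport f).isOpen_compl.mem_nhds hy
          have h6 := continuous_snd.continuousAt.preimage_mem_nhds (x := (x, y)) h5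
          filter_upwards [h6] with q hq using image_eq_zero_of_notMem_tsupport hq
        refine (contDiffAt_const (c := (0 : ℝ))).congr_of_eventuallyEq ?_
        filter_upwards [h4] with q hq
        simp [hq]
  have hKe : ∀ x ≠ 0, K x = kelvin (potentialOf fun x => c * f x) x := fun x hx =>
    (kelvin_potentialOf _ hx).symm
  -- The value of `kelvin` at the origin is the junk value 0, so there it has to be replaced by the
  -- value of the integral `K`.
  refine ⟨potentialOf fun x => c * f x,
    fun x => if x = 0 then K 0 else kelvin (potentialOf fun x => c * f x) x, hu, ?_, ?_, ?_⟩
  · rw [contDiff_iff_contDiffAt]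
    intro x
    by_cases hx : x = 0
    · subst hx
      have h0 : Metric.ball (0 : E3) r⁻¹ ∈ 𝓝 0 := Metric.ball_mem_nhds _ (by positivity)
      refine (hK.contDiffAt h0).congr_of_eventuallyEq (Eventually.of_forall fun x => ?_)
      by_cases hx : x = 0
      · simp [hx]
      · simp [hx, hKe x hx]
    · refine (contDiffAt_kelvin hu hx).congr_of_eventuallyEq ?_
      filter_upwards [isOpen_ne.mem_nhds hx] with y hy
      simp [show y ≠ 0 from hy]
  · intro x
    rw [lap_potentialOf hcf hcs]
    have := kernelMass_pos.ne'
    simp only [c]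
    field_simp
  · intro x hx
    simp [hx]

/-- A radial cut-off function which is complementary to its pull-back under the inversion. -/
def invCutoff (x : E3) : ℝ := Real.smoothTransition (2 / (1 + ‖x‖ ^ 2) - 1 / 2)

theorem contDiff_invCutoff : ContDiff ℝ ∞ invCutoff := by
  refine Real.smoothTransition.contDiff.comp (ContDiff.sub ?_ contDiff_const)
  exact contDiff_const.div (contDiff_const.add (contDiff_norm_sq ℝ)) fun x => by positivity

theorem hasCompactSupport_invCutoff : HasCompactSupport invCutoff := by
  refine HasCompactSupport.intro (isCompact_closedBall (0 : E3) 2) fun x hx => ?_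
  refine Real.smoothTransition.zero_of_nonpos ?_
  have : 2 < ‖x‖ := by simpa using hx
  have h1 : (0 : ℝ) < 1 + ‖x‖ ^ 2 := by positivity
  rw [sub_nonpos, div_le_iff₀ h1]
  nlinarith

/-- Inversion replaces the argument $t=2/(1+|x|^2)-1/2$ of the transition function by $1-t$, and the
transition function is symmetric about $1/2$. -/
theorem invCutoff_inv3 {x : E3} (hx : x ≠ 0) : invCutoff (inv3 x) = 1 - invCutoff x := by
  have hn : ‖x‖ ≠ 0 := by simpa using hx
  have h1 : 2 / (1 + ‖x‖⁻¹ ^ 2) - 1 / 2 = 1 - (2 / (1 + ‖x‖ ^ 2) - 1 / 2) := by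
    field_simp
    ring
  have h2 : ∀ t : ℝ, Real.smoothTransition (1 - t) = 1 - Real.smoothTransition t := fun t => by
    have := (Real.smoothTransition.pos_denom t).ne'
    rw [Real.smoothTransition, Real.smoothTransition, sub_sub_cancel, eq_sub_iff_add_eq, add_comm,
      add_comm (expNegInvGlue (1 - t)), ← add_div, div_self this]
  rw [invCutoff, norm_inv3, h1, h2, invCutoff]

theorem lap_congr {u v : E3 → ℝ} {x : E3} (h : u =ᶠ[𝓝 x] v) : lap u x = lap v x := by
  refine Finset.sum_congr rfl fun j _ => ?_
  have h1 : pd j u =ᶠ[𝓝 x] pd j v := by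
    filter_upwards [h.fderiv (𝕜 := ℝ)] with y hy
    rw [pd, pd, hy]
  rw [pd, pd, h1.fderiv_eq]

theorem pd_add (j : Fin 3) {u v : E3 → ℝ} (hu : ContDiff ℝ ∞ u) (hv : ContDiff ℝ ∞ v) :
    pd j (fun y => u y + v y) = fun y => pd j u y + pd j v y := by
  ext x
  exact pd_eq_of_hasFDerivAt ((hu.differentiable (by simp) x).hasFDerivAt.add
    (hv.differentiable (by simp) x).hasFDerivAt) j

theorem pd_const_mul (j : Fin 3) (c : ℝ) {u : E3 → ℝ} (hu : ContDiff ℝ ∞ u) :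
    pd j (fun y => c * u y) = fun y => c * pd j u y := by
  ext x
  exact pd_eq_of_hasFDerivAt ((hu.differentiable (by simp) x).hasFDerivAt.const_mul c) j

theorem pd_comp_neg (j : Fin 3) (u : E3 → ℝ) :
    pd j (fun y => u (-y)) = fun y => -pd j u (-y) := by
  ext x
  have h := (ContinuousLinearEquiv.neg ℝ (M := E3)).comp_right_fderiv (f := u) (x := x)
  rw [pd, pd, show (fun y => u (-y)) = u ∘ ContinuousLinearEquiv.neg ℝ (M := E3) from rfl, h]
  simp

theorem lap_add {u v : E3 → ℝ} (hu : ContDiff ℝ ∞ u) (hv : ContDiff ℝ ∞ v) (x : E3) :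
    lap (fun y => u y + v y) x = lap u x + lap v x := by
  simp only [lap, pd_add _ hu hv, pd_add _ (contDiff_pd _ hu) (contDiff_pd _ hv),
    Finset.sum_add_distrib]

theorem lap_const_mul (c : ℝ) {u : E3 → ℝ} (hu : ContDiff ℝ ∞ u) (x : E3) :
    lap (fun y => c * u y) x = c * lap u x := by
  simp only [lap, pd_const_mul _ c hu, pd_const_mul _ c (contDiff_pd _ hu), Finset.mul_sum]

theorem lap_comp_neg (u : E3 → ℝ) (x : E3) : lap (fun y => u (-y)) x = lap u (-x) := by
  refine Finset.sum_congr rfl fun j _ => ?_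
  rw [pd_comp_neg, pd, fderiv_fun_neg, neg_apply, ← pd, pd_comp_neg, neg_neg]

/-- Solution of the Poisson equation on `ℝ³` for a right-hand side which is smooth and flat
at infinity. -/
theorem exists_potential {G g : E3 → ℝ} (hG : ContDiff ℝ ∞ G) (hg : ContDiff ℝ ∞ g)
    (hGg : ∀ x ≠ 0, G x = ‖x‖⁻¹ ^ 5 * g (inv3 x)) :
    ∃ u v : E3 → ℝ, ContDiff ℝ ∞ u ∧ ContDiff ℝ ∞ v ∧ (∀ x ≠ 0, lap u x = G x) ∧
      ∀ x ≠ 0, u x = kelvin v x := by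
  -- With $\chi$ = `invCutoff`, the part $\chi G$ has compact support, while $(1-\chi)G$ is
  -- $|x|^{-5}$ times the pull-back of $\chi g$ under inversion. By `lap_kelvin` the latter is
  -- solved by the Kelvin transform of a potential of $\chi g$.
  obtain ⟨u₁, v₁, hu₁, hv₁, hl₁, hk₁⟩ := exists_potential_of_hasCompactSupport
    (contDiff_invCutoff.mul hG) hasCompactSupport_invCutoff.mul_right
  obtain ⟨u₂, v₂, hu₂, hv₂, hl₂, hk₂⟩ := exists_potential_of_hasCompactSupport
    (contDiff_invCutoff.mul hg) hasCompactSupport_invCutoff.mul_right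
  refine ⟨fun x => u₁ x + v₂ x, fun x => v₁ x + u₂ x, hu₁.add hv₂, hv₁.add hu₂, fun x hx => ?_,
    fun x hx => ?_⟩
  · rw [lap_add hu₁ hv₂, hl₁]
    have h1 : lap v₂ x = lap (kelvin u₂) x :=
      lap_congr (eventually_of_mem (isOpen_ne.mem_nhds hx) hk₂)
    rw [h1, lap_kelvin hu₂ hx, hl₂, invCutoff_inv3 hx, hGg x hx]
    ring
  · have h1 : kelvin v₁ x = u₁ x := by
      rw [kelvin, hk₁ _ (inv3_ne_zero hx), ← kelvin, kelvin_kelvin _ hx]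
    have h2 : kelvin u₂ x = v₂ x := (hk₂ x hx).symm
    simp only [← h1, ← h2]
    simp only [kelvin]
    ring

/-- Averaging a solution with its reflection preserves the equation and the expansion at infinity.
Parity is required because the components of an invariant 1-form are odd. -/
theorem exists_even_potential {G g : E3 → ℝ} (hG : ContDiff ℝ ∞ G) (hg : ContDiff ℝ ∞ g)
    (hGg : ∀ x ≠ 0, G x = ‖x‖⁻¹ ^ 5 * g (inv3 x)) (he : ∀ x, G (-x) = G x) :
    ∃ u v : E3 → ℝ, ContDiff ℝ ∞ u ∧ ContDiff ℝ ∞ v ∧ (∀ x ≠ 0, lap u x = G x) ∧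
      (∀ x ≠ 0, u x = kelvin v x) ∧ ∀ x, u (-x) = u x := by
  obtain ⟨u, v, hu, hv, hl, hk⟩ := exists_potential hG hg hGg
  have hu' : ContDiff ℝ ∞ fun x => u (-x) := hu.comp contDiff_neg
  refine ⟨fun x => 1 / 2 * (u x + u (-x)), fun x => 1 / 2 * (v x + v (-x)),
    contDiff_const.mul (hu.add hu'), contDiff_const.mul (hv.add (hv.comp contDiff_neg)),
    fun x hx => ?_, fun x hx => ?_, fun x => ?_⟩
  · rw [lap_const_mul _ (hu.add hu'), lap_add hu hu', lap_comp_neg, hl x hx,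
      hl _ (neg_ne_zero.2 hx), he]
    ring
  · simp only [hk x hx, hk _ (neg_ne_zero.2 hx)]
    simp only [kelvin, norm_neg, inv3_neg]
    ring
  · simp only [neg_neg]
    ring

end

section

/-! ### Functions which are flat in polar coordinates -/

/-- In polar coordinates, `f(σ y) = O(σ^∞)` with smooth quotients, up to `σ = 0`. -/
def PolarFlat {F : Type} [NormedAddCommGroup F] [NormedSpace ℝ F] (f : E3 → F) : Prop :=
  ∀ (M : ℕ) (y₀ : E3), ‖y₀‖ = 1 → ∃ (U : Set (E3 × ℝ)) (B : E3 × ℝ → F), IsOpen U ∧ (y₀, 0) ∈ U ∧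
    ContDiffOn ℝ ∞ B U ∧ ∀ y σ, ‖y‖ = 1 → 0 < σ → (y, σ) ∈ U → f (σ • y) = σ ^ M • B (y, σ)

section

variable {F : Type} [NormedAddCommGroup F] [NormedSpace ℝ F]

theorem hasFDerivAt_norm_of_ne {x : E3} (hx : x ≠ 0) :
    HasFDerivAt (fun y : E3 => ‖y‖) (‖x‖⁻¹ • innerSL ℝ x) x := by
  have h := (hasDerivAt_inv (inv_ne_zero (norm_ne_zero_iff.2 hx))).comp_hasFDerivAt x
    (hasFDerivAt_norm_inv hx)
  have hn : ‖x‖ ≠ 0 := norm_ne_zero_iff.2 hx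
  rw [smul_smul] at h
  have h1 : -((‖x‖⁻¹) ^ 2)⁻¹ * -(‖x‖⁻¹ ^ 3) = ‖x‖⁻¹ := by field_simp
  rw [h1] at h
  refine h.congr_of_eventuallyEq (Eventually.of_forall fun y => ?_)
  simp

theorem hasFDerivAt_normalize {x : E3} (hx : x ≠ 0) : HasFDerivAt (fun y : E3 => ‖y‖⁻¹ • y)
    (‖x‖⁻¹ • ContinuousLinearMap.id ℝ E3 + (-(‖x‖⁻¹ ^ 3) • innerSL ℝ x).smulRight x) x :=
  (hasFDerivAt_norm_inv hx).smul (hasFDerivAt_id x)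

/-- Flatness is local in the direction; compactness of the unit sphere makes the bound uniform. -/
theorem PolarFlat.exists_bound {f : E3 → F} (hf : PolarFlat f) (M : ℕ) :
    ∃ C r : ℝ, 0 < r ∧ ∀ x : E3, x ≠ 0 → ‖x‖ < r → ‖f x‖ ≤ C * ‖x‖ ^ M := by
  have h1 : ∃ C r : ℝ, 0 < r ∧ ∀ y ∈ Metric.sphere (0 : E3) 1, ∀ σ : ℝ, ‖y‖ = 1 → 0 < σ → σ < r →
        ‖f (σ • y)‖ ≤ C * σ ^ M := by
    refine (isCompact_sphere (0 : E3) 1).induction_on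
      (p := fun V => ∃ C r : ℝ, 0 < r ∧ ∀ y ∈ V, ∀ σ : ℝ, ‖y‖ = 1 → 0 < σ → σ < r →
        ‖f (σ • y)‖ ≤ C * σ ^ M) ⟨0, 1, one_pos, by simp⟩ ?_ ?_ ?_
    · rintro s t hst ⟨C, r, hr, h⟩
      exact ⟨C, r, hr, fun y hy => h y (hst hy)⟩
    · rintro s t ⟨C, r, hr, h⟩ ⟨C', r', hr', h'⟩
      refine ⟨max C C', min r r', lt_min hr hr', fun y hy σ hy1 hσ hσr => ?_⟩
      rcases hy with hy | hy
      · exact (h y hy σ hy1 hσ (hσr.trans_le (min_le_left _ _))).trans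
          (mul_le_mul_of_nonneg_right (le_max_left _ _) (by positivity))
      · exact (h' y hy σ hy1 hσ (hσr.trans_le (min_le_right _ _))).trans
          (mul_le_mul_of_nonneg_right (le_max_right _ _) (by positivity))
    · intro y₀ hy₀
      obtain ⟨U, B, hU, hw, hB, h⟩ := hf M y₀ (by simpa using hy₀)
      have hc : ContinuousAt B (y₀, 0) := (hB.continuousOn).continuousAt (hU.mem_nhds hw)
      have h2 : ∀ᶠ q in 𝓝 (y₀, (0 : ℝ)), ‖B q‖ < ‖B (y₀, 0)‖ + 1 ∧ q ∈ U :=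
        (hc.norm.eventually_lt_const (by linarith)).and (hU.mem_nhds hw)
      obtain ⟨V, hV, W, hW, hVW⟩ := mem_nhds_prod_iff.1 h2
      obtain ⟨r, hr, hrW⟩ := Metric.mem_nhds_iff.1 hW
      refine ⟨V, mem_nhdsWithin_of_mem_nhds hV, ‖B (y₀, 0)‖ + 1, r, hr,
        fun y hy σ hy1 hσ hσr => ?_⟩
      have h3 := hVW (mk_mem_prod hy (hrW (a := σ) (by simpa [abs_of_pos hσ] using hσr)))
      rw [h y σ hy1 hσ h3.2, norm_smul, norm_pow, Real.norm_of_nonneg hσ.le, mul_comm]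
      exact mul_le_mul_of_nonneg_right h3.1.le (by positivity)
  obtain ⟨C, r, hr, h⟩ := h1
  refine ⟨C, r, hr, fun x hx hxr => ?_⟩
  have hn : 0 < ‖x‖ := norm_pos_iff.2 hx
  have h2 : ‖‖x‖⁻¹ • x‖ = 1 := by
    rw [norm_smul, norm_inv, norm_norm, inv_mul_cancel₀ hn.ne']
  have h3 := h (‖x‖⁻¹ • x) (by simpa using h2) ‖x‖ h2 hn hxr
  rwa [smul_smul, mul_inv_cancel₀ hn.ne', one_smul] at h3

theorem PolarFlat.hasFDerivAt_zero {f : E3 → F} (hf : PolarFlat f) (h0 : f 0 = 0) :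
    HasFDerivAt f (0 : E3 →L[ℝ] F) 0 := by
  obtain ⟨C, r, hr, h⟩ := hf.exists_bound 2
  refine HasFDerivAt.of_isLittleO ?_
  have h1 : (fun x : E3 => f x) =O[𝓝 0] fun x => ‖x‖ ^ 2 := by
    refine IsBigO.of_bound C ?_
    filter_upwards [Metric.ball_mem_nhds (0 : E3) hr] with x hx
    by_cases hx0 : x = 0
    · simp [hx0, h0]
    · rw [norm_pow, norm_norm]
      exact h x hx0 (by simpa using hx)
  have h2 : (fun x : E3 => ‖x‖ ^ 2) =o[𝓝 0] fun x => x := by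
    have := isLittleO_norm_pow_id (E' := E3) one_lt_two
    exact this
  simpa [h0] using h1.trans_isLittleO h2

theorem PolarFlat.fderiv {f : E3 → F} (hf : PolarFlat f) : PolarFlat (fderiv ℝ f) := by
  intro M y₀ hy₀
  -- Differentiation in polar coordinates costs one power of the radius, hence $M+1$.
  obtain ⟨U, B, hU, hw, hB, h⟩ := hf (M + 1) y₀ hy₀
  -- On the unit sphere of directions, `L` is the radius times the derivative of
  -- $x\mapsto(x/|x|,|x|)$, that is $v\mapsto(v-\langle y,v\rangle y,\ \sigma\langle y,v\rangle)$.
  -- It remains smooth at $\sigma=0$, and `B'` collects both terms of the product rule.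
  let L : E3 × ℝ → E3 →L[ℝ] E3 × ℝ := fun q =>
    (ContinuousLinearMap.inl ℝ E3 ℝ).comp
      (ContinuousLinearMap.id ℝ E3 - (innerSL ℝ q.1).smulRight q.1) +
    (ContinuousLinearMap.inr ℝ E3 ℝ).comp (q.2 • innerSL ℝ q.1)
  let B' : E3 × ℝ → E3 →L[ℝ] F := fun q =>
    ((M + 1 : ℕ) : ℝ) • (innerSL ℝ q.1).smulRight (B q) + (_root_.fderiv ℝ B q).comp (L q)
  have hi : ContDiff ℝ ∞ fun q : E3 × ℝ => innerSL ℝ q.1 := (innerSL ℝ).contDiff.comp contDiff_fst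
  have hL : ContDiff ℝ ∞ L :=
    (contDiff_const.clm_comp (contDiff_const.sub (hi.smulRight contDiff_fst))).add
      (contDiff_const.clm_comp (contDiff_snd.smul hi))
  refine ⟨U, B', hU, hw, ?_, ?_⟩
  · exact ((hi.contDiffOn.smulRight hB).const_smul ((M + 1 : ℕ) : ℝ)).add
      ((hB.fderiv_of_isOpen hU (by simp)).clm_comp hL.contDiffOn)
  · intro y σ hy hσ hyU
    have hy0 : y ≠ 0 := norm_ne_zero_iff.1 (by rw [hy]; exact one_ne_zero)
    have hx0 : σ • y ≠ 0 := smul_ne_zero hσ.ne' hy0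
    have hn : ‖σ • y‖ = σ := by rw [norm_smul, hy, mul_one, Real.norm_of_nonneg hσ.le]
    have hdir : ‖σ • y‖⁻¹ • σ • y = y := by rw [hn, smul_smul, inv_mul_cancel₀ hσ.ne', one_smul]
    have hp := (hasFDerivAt_normalize hx0).prodMk (hasFDerivAt_norm_of_ne hx0)
    have hBd : HasFDerivAt B (_root_.fderiv ℝ B (y, σ)) (‖σ • y‖⁻¹ • σ • y, ‖σ • y‖) := by
      rw [hdir, hn]
      exact ((hB.differentiableOn (by simp)).differentiableAt (hU.mem_nhds hyU)).hasFDerivAt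
    have h1 := ((hasFDerivAt_norm_of_ne hx0).pow (M + 1)).smul (hBd.comp (σ • y) hp)
    have h2 : f =ᶠ[𝓝 (σ • y)] fun x => ‖x‖ ^ (M + 1) • B (‖x‖⁻¹ • x, ‖x‖) := by
      have h3 : ∀ᶠ x in 𝓝 (σ • y), (‖x‖⁻¹ • x, ‖x‖) ∈ U := by
        have := hp.continuousAt
        refine this.preimage_mem_nhds (hU.mem_nhds ?_)
        rw [hdir, hn]
        exact hyU
      filter_upwards [h3, isOpen_ne.mem_nhds hx0] with x hx hx0
      have hxn : 0 < ‖x‖ := norm_pos_iff.2 hx0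
      rw [← h _ _ _ hxn hx, smul_smul, mul_inv_cancel₀ hxn.ne', one_smul]
      rw [norm_smul, norm_inv, norm_norm, inv_mul_cancel₀ hxn.ne']
    rw [h2.fderiv_eq]
    have h4 := h1.fderiv
    simp only [Function.comp_def] at h4
    rw [show (fun x : E3 => ‖x‖ ^ (M + 1) • B (‖x‖⁻¹ • x, ‖x‖)) =
      ((fun x : E3 => ‖x‖ ^ (M + 1)) • fun x : E3 => B (‖x‖⁻¹ • x, ‖x‖)) from rfl, h4]
    ext1 v
    rw [hdir, hn]
    simp [B', L, smul_smul, -map_add, -map_sub, -Nat.cast_add]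
    have harg : (σ⁻¹ • v + -(((σ ^ 3)⁻¹ * σ * inner ℝ y v * σ) • y), σ⁻¹ * σ * inner ℝ y v) =
        σ⁻¹ • ((v, (0 : ℝ)) - (inner ℝ y v • y, 0)) + (0, inner ℝ y v) := by
      have h5 : (σ ^ 3)⁻¹ * σ * inner ℝ y v * σ = σ⁻¹ * inner ℝ y v := by field_simp
      refine Prod.ext ?_ ?_
      · simp [h5, smul_smul, sub_eq_add_neg]
      · simp [inv_mul_cancel₀ hσ.ne']
    have h6 : σ ^ (M + 1) * σ⁻¹ = σ ^ M := by field_simp; ring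
    rw [harg, map_add, map_smul, map_sub, smul_add, smul_smul, h6, inv_mul_cancel₀ hσ.ne', ← pow_succ,
      mul_one, mul_comm (σ ^ M) ((M + 1 : ℕ) : ℝ), add_comm]

/-- A flat function vanishing at the origin is differentiable there with derivative zero, and its
derivative is flat again. The induction on the order therefore runs over all target spaces at once.
-/
theorem PolarFlat.contDiffOn {U : Set E3} (hU : IsOpen U) {f : E3 → F}
    (hf : PolarFlat f) (hf0 : f 0 = 0) (hd : ContDiffOn ℝ ∞ f (U \ {0})) : ContDiffOn ℝ ∞ f U := by
  rw [contDiffOn_infty]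
  intro n
  induction n generalizing F with
  | zero =>
    rw [CharP.cast_eq_zero, contDiffOn_zero]
    intro x hx
    refine ContinuousAt.continuousWithinAt ?_
    by_cases hx0 : x = 0
    · rw [hx0]
      exact (hf.hasFDerivAt_zero hf0).continuousAt
    · exact hd.continuousOn.continuousAt ((hU.sdiff isClosed_singleton).mem_nhds ⟨hx, hx0⟩)
  | succ n ih =>
    have ho := hU.sdiff (isClosed_singleton (x := (0 : E3)))
    rw [Nat.cast_succ, contDiffOn_succ_iff_fderiv_of_isOpen hU]
    refine ⟨fun x hx => ?_, fun h => absurd h (by simp), ?_⟩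
    · refine DifferentiableAt.differentiableWithinAt ?_
      by_cases hx0 : x = 0
      · rw [hx0]
        exact (hf.hasFDerivAt_zero hf0).differentiableAt
      · exact (hd.differentiableOn (by simp)).differentiableAt (ho.mem_nhds ⟨hx, hx0⟩)
    · exact ih hf.fderiv (hf.hasFDerivAt_zero hf0).fderiv (hd.fderiv_of_isOpen ho (by simp))

end

end

section

/-! ### Borel summation with parameters -/

theorem exists_bound_iteratedFDeriv {X F : Type*} [NormedAddCommGroup X] [NormedSpace ℝ X]
    [NormedAddCommGroup F] [NormedSpace ℝ F] {h : X → F} (hh : ContDiff ℝ ∞ h)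
    (hs : HasCompactSupport h) (n : ℕ) :
    ∃ C : ℝ, 0 ≤ C ∧ ∀ k < n, ∀ x, ‖iteratedFDeriv ℝ k h x‖ ≤ C := by
  have h1 : ∀ k : ℕ, ∃ C : ℝ, ∀ x, ‖iteratedFDeriv ℝ k h x‖ ≤ C := fun k =>
    (hs.iteratedFDeriv k).exists_bound_of_continuous
      (hh.continuous_iteratedFDeriv (by exact_mod_cast le_top))
  choose C hC using h1
  refine ⟨∑ k ∈ Finset.range n, |C k|, by positivity, fun k hk x => ?_⟩
  exact ((hC k x).trans (le_abs_self _)).trans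
    (Finset.single_le_sum (f := fun k => |C k|) (fun _ _ => abs_nonneg _) (Finset.mem_range.2 hk))

/-- The dilation of the parameter. -/
def dilate (r : ℝ) : E3 × ℝ →L[ℝ] E3 × ℝ :=
  (ContinuousLinearMap.fst ℝ E3 ℝ).prod (r⁻¹ • ContinuousLinearMap.snd ℝ E3 ℝ)

theorem norm_dilate_le {r : ℝ} (hr : 0 < r) (hr1 : r ≤ 1) : ‖dilate r‖ ≤ r⁻¹ := by
  refine ContinuousLinearMap.opNorm_le_bound _ (by positivity) fun q => ?_
  have h1 : 1 ≤ r⁻¹ := (one_le_inv₀ hr).2 hr1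
  simp only [dilate, ContinuousLinearMap.prod_apply, ContinuousLinearMap.coe_fst', smul_apply,
    ContinuousLinearMap.coe_snd', Prod.norm_def, norm_smul, norm_inv, Real.norm_of_nonneg hr.le]
  refine max_le ?_ ?_
  · calc ‖q.1‖ ≤ max ‖q.1‖ ‖q.2‖ := le_max_left _ _
      _ ≤ r⁻¹ * max ‖q.1‖ ‖q.2‖ := le_mul_of_one_le_left (by positivity) h1
  · exact mul_le_mul_of_nonneg_left (le_max_right _ _) (by positivity)

/-- Each derivative of the dilated function costs at most $r^{-1}$, so for $k<n$ the prefactor $r^n$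
leaves at least one factor $r$ to make the term small. -/
theorem norm_iteratedFDeriv_dilate_le {h : E3 × ℝ → ℝ} (hh : ContDiff ℝ ∞ h) {r : ℝ} (hr : 0 < r)
    (hr1 : r ≤ 1) {n k : ℕ} (hk : k < n) {C : ℝ} (hC : ∀ x, ‖iteratedFDeriv ℝ k h x‖ ≤ C)
    (q : E3 × ℝ) : ‖iteratedFDeriv ℝ k (fun q => r ^ n * h (dilate r q)) q‖ ≤ r * C := by
  have hC0 : 0 ≤ C := (norm_nonneg _).trans (hC q)
  have h1 : iteratedFDeriv ℝ k (fun q => r ^ n * h (dilate r q)) q =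
      r ^ n • iteratedFDeriv ℝ k (h ∘ dilate r) q :=
    iteratedFDeriv_const_smul_apply (a := r ^ n) (f := h ∘ dilate r)
      ((hh.comp (dilate r).contDiff).contDiffAt.of_le (by exact_mod_cast le_top))
  rw [h1, (dilate r).iteratedFDeriv_comp_right hh q (i := k) (by exact_mod_cast le_top), norm_smul,
    norm_pow, Real.norm_of_nonneg hr.le]
  have h2 : ‖(iteratedFDeriv ℝ k h (dilate r q)).compContinuousLinearMap fun _ => dilate r‖ ≤
      C * r⁻¹ ^ k := by
    refine (ContinuousMultilinearMap.norm_compContinuousLinearMap_le _ _).trans ?_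
    rw [Finset.prod_const, Finset.card_univ, Fintype.card_fin]
    exact mul_le_mul (hC _) (pow_le_pow_left₀ (norm_nonneg _) (norm_dilate_le hr hr1) k)
      (by positivity) hC0
  calc r ^ n * _ ≤ r ^ n * (C * r⁻¹ ^ k) := mul_le_mul_of_nonneg_left h2 (by positivity)
    _ = r ^ (n - k) * C := by
      rw [inv_pow, ← div_eq_mul_inv, ← Nat.sub_add_cancel hk.le, pow_add, Nat.add_sub_cancel]
      field_simp
    _ ≤ r * C := by
      refine mul_le_mul_of_nonneg_right ?_ hC0
      calc r ^ (n - k) ≤ r ^ 1 := pow_le_pow_of_le_one hr.le hr1 (by omega)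
        _ = r := pow_one r

/-- The cut-off function of the parameter. -/
def parCutoff : ContDiffBump (0 : ℝ) := ⟨1, 2, one_pos, one_lt_two⟩

/-- A cut-off function which is `1` on the ball of radius `n + 1`. -/
def ballCutoff (n : ℕ) : ContDiffBump (0 : E3) :=
  ⟨n + 1, n + 2, by positivity, by linarith⟩

/-- The coefficient functions of a Borel sum. -/
def borelCoeff (r : ℕ → ℝ) (n : ℕ) (ε : ℝ) : ℝ := ε ^ n * parCutoff (ε / r n)

theorem contDiff_borelCoeff (r : ℕ → ℝ) (n : ℕ) : ContDiff ℝ ∞ (borelCoeff r n) :=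
  (contDiff_id.pow n).mul (parCutoff.contDiff.comp (contDiff_id.div_const _))

theorem borelCoeff_eventually_eq {r : ℕ → ℝ} (hr : ∀ n, 0 < r n) (n : ℕ) :
    ∀ᶠ ε in 𝓝 0, borelCoeff r n ε = ε ^ n := by
  filter_upwards [Metric.closedBall_mem_nhds (0 : ℝ) (hr n)] with ε hε
  have : parCutoff (ε / r n) = 1 := parCutoff.one_of_mem_closedBall (by
    simp only [mem_closedBall_zero_iff, Real.norm_eq_abs, abs_div, abs_of_pos (hr n)] at hε ⊢
    exact (div_le_one (hr n)).2 hε)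
  rw [borelCoeff, this, mul_one]

theorem borelCoeff_eq_zero {r : ℕ → ℝ} (hr : ∀ n, 0 < r n) {n : ℕ} {ε : ℝ} (h : 2 * r n ≤ |ε|) :
    borelCoeff r n ε = 0 := by
  have : parCutoff (ε / r n) = 0 := parCutoff.zero_of_le_dist (by
    rw [dist_zero_right, Real.norm_eq_abs, abs_div, abs_of_pos (hr n), le_div_iff₀ (hr n)]
    exact h)
  rw [borelCoeff, this, mul_zero]

theorem abs_borelCoeff_le (r : ℕ → ℝ) (n : ℕ) (ε : ℝ) : |borelCoeff r n ε| ≤ |ε| ^ n := by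
  rw [borelCoeff, abs_mul, abs_pow, abs_of_nonneg parCutoff.nonneg]
  exact mul_le_of_le_one_right (by positivity) parCutoff.le_one

/-- One can choose the cut-off radii for finitely many sequences of smooth functions. -/
theorem exists_borel_radii {ι : Type*} [Fintype ι] {f : ι → ℕ → E3 → ℝ}
    (hf : ∀ i n, ContDiff ℝ ∞ (f i n)) : ∃ r : ℕ → ℝ, (∀ n, 0 < r n) ∧
      (∀ n, 2 * r n ≤ (1 / 2) ^ n) ∧
      (∀ i n x, 2 * r n * |ballCutoff n x * f i n x| ≤ (1 / 2) ^ n) ∧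
      ∀ i n, ∀ k < n, ∀ q, ‖iteratedFDeriv ℝ k (fun q : E3 × ℝ =>
        borelCoeff r n q.2 * (ballCutoff n q.1 * f i n q.1)) q‖ ≤ (1 / 2) ^ n := by
  let B : ι → ℕ → E3 → ℝ := fun i n x => ballCutoff n x * f i n x
  have hB : ∀ i n, ContDiff ℝ ∞ (B i n) := fun i n => (ballCutoff n).contDiff.mul (hf i n)
  have hBs : ∀ i n, HasCompactSupport (B i n) := fun i n =>
    (ballCutoff n).hasCompactSupport.mul_right
  let h : ι → ℕ → E3 × ℝ → ℝ := fun i n q => q.2 ^ n * parCutoff q.2 * B i n q.1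
  have hh : ∀ i n, ContDiff ℝ ∞ (h i n) := fun i n =>
    ((contDiff_snd.pow n).mul (parCutoff.contDiff.comp contDiff_snd)).mul
      ((hB i n).comp contDiff_fst)
  have hhs : ∀ i n, HasCompactSupport (h i n) := fun i n => by
    refine HasCompactSupport.intro ((hBs i n).prod parCutoff.hasCompactSupport) fun q hq => ?_
    rw [mem_prod, not_and_or] at hq
    rcases hq with hq | hq
    · simp [h, image_eq_zero_of_notMem_tsupport hq]
    · simp [h, image_eq_zero_of_notMem_tsupport hq]
  have h1 : ∀ n, ∃ r : ℝ, 0 < r ∧ 2 * r ≤ (1 / 2) ^ n ∧ (∀ i x, 2 * r * |B i n x| ≤ (1 / 2) ^ n) ∧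
      ∀ i, ∀ k < n, ∀ q, ‖iteratedFDeriv ℝ k (fun q => r ^ n * h i n (dilate r q)) q‖ ≤
        (1 / 2) ^ n := by
    intro n
    choose C hC0 hC using fun i => exists_bound_iteratedFDeriv (hh i n) (hhs i n) n
    choose D hD using fun i => (hBs i n).exists_bound_of_continuous (hB i n).continuous
    set S : ℝ := 1 + ∑ i, (C i + |D i|) with hS
    have hS1 : 1 ≤ S := le_add_of_nonneg_right
      (Finset.sum_nonneg fun i _ => add_nonneg (hC0 i) (abs_nonneg _))
    have hCS : ∀ i, C i + |D i| ≤ S := fun i => by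
      have := Finset.single_le_sum (f := fun i => C i + |D i|)
        (fun i _ => add_nonneg (hC0 i) (abs_nonneg _)) (Finset.mem_univ i)
      linarith
    have hp : (0 : ℝ) < (1 / 2) ^ n := by positivity
    have hp1 : ((1 : ℝ) / 2) ^ n ≤ 1 := pow_le_one₀ (by norm_num) (by norm_num)
    have hS0 : 0 < S := by linarith
    have h2S : 2 * ((1 / 2) ^ n / (2 * S)) = (1 / 2) ^ n / S := by field_simp
    -- `S` dominates 1 and, for each index, both the derivative bound and the sup bound, so this one
    -- radius meets all three requirements.
    refine ⟨(1 / 2) ^ n / (2 * S), by positivity, ?_, ?_, ?_⟩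
    · rw [h2S]
      exact div_le_self hp.le hS1
    · intro i x
      rw [h2S, div_mul_eq_mul_div, div_le_iff₀ hS0]
      refine mul_le_mul_of_nonneg_left ?_ hp.le
      have := hD i x
      rw [Real.norm_eq_abs] at this
      linarith [le_abs_self (D i), hCS i, hC0 i]
    · intro i k hk q
      have hr1 : (1 / 2) ^ n / (2 * S) ≤ 1 := by
        rw [div_le_one (by positivity)]
        linarith
      refine (norm_iteratedFDeriv_dilate_le (hh i n) (by positivity) hr1 hk (hC i k hk) q).trans ?_
      rw [div_mul_eq_mul_div, div_le_iff₀ (by positivity)]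
      refine mul_le_mul_of_nonneg_left ?_ hp.le
      linarith [hCS i, abs_nonneg (D i)]
  choose r hr hr1 hrB hrD using h1
  refine ⟨r, hr, hr1, fun i n x => hrB n i x, fun i n k hk q => ?_⟩
  have h2 : (fun q : E3 × ℝ => borelCoeff r n q.2 * (ballCutoff n q.1 * f i n q.1)) =
      fun q => r n ^ n * h i n (dilate (r n) q) := by
    ext q
    have := (hr n).ne'
    simp only [borelCoeff, h, B, dilate, ContinuousLinearMap.prod_apply,
      ContinuousLinearMap.coe_fst', smul_apply, ContinuousLinearMap.coe_snd', smul_eq_mul,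
      ← div_eq_inv_mul, div_pow]
    field_simp
  rw [h2]
  exact hrD n i k hk q

/-- The Borel sum of the formal power series `∑ f_n(x) ε^n`. -/
def borelSum (r : ℕ → ℝ) (f : ℕ → E3 → ℝ) (q : E3 × ℝ) : ℝ := ∑' n, borelCoeff r n q.2 * f n q.1

/-- The cut-offs kill every term with $2^{-n}\le|\varepsilon|$. The number of surviving terms
depends neither on `x` nor on the sequence of functions, which is why linear relations between
sequences pass to their Borel sums. -/
theorem exists_borelSum_eq_sum {r : ℕ → ℝ} (hr : ∀ n, 0 < r n) (hr2 : ∀ n, 2 * r n ≤ (1 / 2) ^ n)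
    {ε : ℝ} (hε : ε ≠ 0) : ∃ K : ℕ, ∀ (m : ℕ) (f : ℕ → E3 → ℝ) (x : E3), K ≤ m →
      borelSum r f (x, ε) = ∑ n ∈ Finset.range m, borelCoeff r n ε * f n x := by
  obtain ⟨K, hK⟩ := exists_pow_lt_of_lt_one (abs_pos.2 hε) (by norm_num : (1 / 2 : ℝ) < 1)
  refine ⟨K, fun m f x hm => tsum_eq_sum fun n hn => ?_⟩
  have h1 : K ≤ n := hm.trans (by simpa using hn)
  have h2 : ((1 : ℝ) / 2) ^ n ≤ (1 / 2) ^ K :=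
    pow_le_pow_of_le_one (by norm_num) (by norm_num) h1
  rw [borelCoeff_eq_zero hr (by linarith [hr2 n]), zero_mul]

/-- With the ball cut-offs inserted, the $k$-th derivatives of all terms beyond the $k$-th are
bounded by a geometric series. Over a bounded set of `x` only finitely many terms notice the ball
cut-offs, and these are corrected by a finite smooth sum. -/
theorem contDiff_borelSum {r : ℕ → ℝ} {f : ℕ → E3 → ℝ}
    (hf : ∀ n, ContDiff ℝ ∞ (f n)) (hD : ∀ n, ∀ k < n, ∀ q, ‖iteratedFDeriv ℝ k
      (fun q : E3 × ℝ => borelCoeff r n q.2 * (ballCutoff n q.1 * f n q.1)) q‖ ≤ (1 / 2) ^ n) :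
    ContDiff ℝ ∞ (borelSum r f) := by
  let g : ℕ → E3 × ℝ → ℝ := fun n q => borelCoeff r n q.2 * (ballCutoff n q.1 * f n q.1)
  have hc : ∀ n, ContDiff ℝ ∞ fun q : E3 × ℝ => borelCoeff r n q.2 := fun n =>
    (contDiff_borelCoeff r n).comp contDiff_snd
  have hf' : ∀ n, ContDiff ℝ ∞ fun q : E3 × ℝ => f n q.1 := fun n => (hf n).comp contDiff_fst
  have hg : ∀ n, ContDiff ℝ ∞ (g n) := fun n =>
    (hc n).mul (((ballCutoff n).contDiff.comp contDiff_fst).mul (hf' n))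
  have hgs : ContDiff ℝ ∞ fun q => ∑' n, g n q := by
    refine contDiff_tsum_of_eventually (N := ⊤) hg (v := fun _ n => (1 / 2 : ℝ) ^ n)
      (fun k _ => summable_geometric_of_lt_one (by norm_num) (by norm_num)) fun k _ => ?_
    rw [Nat.cofinite_eq_atTop]
    filter_upwards [eventually_gt_atTop k] with n hn q using hD n k hn q
  have hsum : ∀ q, Summable fun n => g n q := fun q => by
    refine Summable.of_norm_bounded_eventually_nat (g := fun n => (1 / 2 : ℝ) ^ n)
      (summable_geometric_of_lt_one (by norm_num) (by norm_num)) ?_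
    filter_upwards [eventually_gt_atTop 0] with n hn
    have := hD n 0 hn q
    rwa [norm_iteratedFDeriv_zero] at this
  rw [contDiff_iff_contDiffAt]
  intro q₀
  obtain ⟨m, hm⟩ := exists_nat_gt ‖q₀.1‖
  have h1 : ∀ᶠ q : E3 × ℝ in 𝓝 q₀, ‖q.1‖ < m :=
    (continuous_fst.norm.tendsto q₀).eventually_lt_const hm
  have h2 : ContDiff ℝ ∞ fun q => (∑' n, g n q) +
      ∑ n ∈ Finset.range m, (borelCoeff r n q.2 * f n q.1 - g n q) :=
    hgs.add (ContDiff.sum fun n _ => ((hc n).mul (hf' n)).sub (hg n))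
  refine h2.contDiffAt.congr_of_eventuallyEq ?_
  filter_upwards [h1] with q hq
  have h3 : ∀ n ∉ Finset.range m, borelCoeff r n q.2 * f n q.1 - g n q = 0 := fun n hn => by
    have h4 : (m : ℝ) ≤ n := by simpa using hn
    have h5 : ballCutoff n q.1 = 1 := (ballCutoff n).one_of_mem_closedBall (by
      simp only [ballCutoff, mem_closedBall_zero_iff]
      linarith)
    simp [g, h5]
  have h6 : ∑' n, (borelCoeff r n q.2 * f n q.1 - g n q) =
      ∑ n ∈ Finset.range m, (borelCoeff r n q.2 * f n q.1 - g n q) := tsum_eq_sum h3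
  rw [← h6, ← (hsum q).tsum_add (summable_of_ne_finset_zero h3)]
  simp [borelSum]

/-- For small $\varepsilon$ the first `m` weights are exactly $\varepsilon^n$. Each later term
either vanishes or has $\varepsilon<2r_n$, and then one spare factor $\varepsilon$ is traded for
$2r_n$, which makes the tail geometric. -/
theorem hasExpansion_borelSum {r : ℕ → ℝ} (hr : ∀ n, 0 < r n)
    (hr2 : ∀ n, 2 * r n ≤ (1 / 2) ^ n) {f : ℕ → E3 → ℝ}
    (hB : ∀ n x, 2 * r n * |ballCutoff n x * f n x| ≤ (1 / 2) ^ n) (x : E3) :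
    HasExpansion (fun ε => borelSum r f (x, ε)) fun n => f n x := by
  intro N
  obtain ⟨m', hm'⟩ := exists_nat_gt ‖x‖
  -- Beyond `m'` the ball cut-off equals 1 at `x`; the bound $n\ge N+1$ provides the spare factor
  -- $\varepsilon$.
  set m := max m' (N + 1) with hm
  let b : ℕ → ℝ := fun n => (if n < m then |f n x| else 0) + (1 / 2) ^ n
  have hb0 : ∀ n, 0 ≤ b n := fun n => by
    simp only [b]
    split_ifs <;> positivity
  have hbs : Summable b := by
    refine Summable.add ?_ (summable_geometric_of_lt_one (by norm_num) (by norm_num))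
    refine summable_of_ne_finset_zero (s := Finset.range m) fun n hn => ?_
    rw [if_neg (by simpa using hn)]
  refine IsBigO.of_bound (∑' n, b n) ?_
  have h1 : ∀ᶠ ε in 𝓝[>] (0 : ℝ), ∀ n < m, borelCoeff r n ε = ε ^ n :=
    nhdsWithin_le_nhds ((finite_lt_nat m).eventually_all.2
      fun n _ => borelCoeff_eventually_eq hr n)
  filter_upwards [h1, Ioo_mem_nhdsGT one_pos] with ε hε hε01
  obtain ⟨K, hK⟩ := exists_borelSum_eq_sum hr hr2 hε01.1.ne'
  have hNm : N < m := (Nat.lt_succ_self N).trans_le (le_max_right _ _)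
  rw [hK (max K m) f x (le_max_left _ _)]
  have h2 : ∑ n ∈ Finset.range N, ε ^ n * f n x =
      ∑ n ∈ Finset.range N, borelCoeff r n ε * f n x :=
    Finset.sum_congr rfl fun n hn => by rw [hε n ((Finset.mem_range.1 hn).trans hNm)]
  rw [h2, ← Finset.sum_Ico_eq_sub _ (hNm.le.trans (le_max_right _ _))]
  have h3 : ∀ n ∈ Finset.Ico N (max K m), ‖borelCoeff r n ε * f n x‖ ≤ b n * ε ^ N := by
    intro n hn
    have hNn := (Finset.mem_Ico.1 hn).1
    have hc := abs_borelCoeff_le r n ε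
    rw [abs_of_pos hε01.1] at hc
    rw [Real.norm_eq_abs, abs_mul]
    have hεN : 0 < ε ^ N := pow_pos hε01.1 N
    by_cases hnm : n < m
    · calc |borelCoeff r n ε| * |f n x| ≤ ε ^ N * |f n x| :=
            mul_le_mul_of_nonneg_right (hc.trans
              (pow_le_pow_of_le_one hε01.1.le hε01.2.le hNn)) (abs_nonneg _)
        _ ≤ ε ^ N * b n := by
            refine mul_le_mul_of_nonneg_left ?_ hεN.le
            simp only [b, if_pos hnm]
            exact le_add_of_nonneg_right (by positivity)
        _ = _ := mul_comm _ _
    · have h4 : ballCutoff n x = 1 := (ballCutoff n).one_of_mem_closedBall (by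
        simp only [ballCutoff, mem_closedBall_zero_iff]
        have h5 : m' ≤ n := (le_max_left _ _).trans (not_lt.1 hnm)
        have h6 : (m' : ℝ) ≤ n := by exact_mod_cast h5
        linarith)
      have h7 := hB n x
      rw [h4, one_mul] at h7
      have h8 : b n = (1 / 2) ^ n := by simp [b, hnm]
      rw [h8]
      by_cases h9 : 2 * r n ≤ |ε|
      · rw [borelCoeff_eq_zero hr h9]
        simp only [abs_zero, zero_mul]
        positivity
      · rw [not_le, abs_of_pos hε01.1] at h9
        have h10 : N + 1 ≤ n := (le_max_right _ _).trans (not_lt.1 hnm)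
        calc |borelCoeff r n ε| * |f n x| ≤ (ε ^ N * (2 * r n)) * |f n x| := by
              refine mul_le_mul_of_nonneg_right (hc.trans ?_) (abs_nonneg _)
              refine (pow_le_pow_of_le_one hε01.1.le hε01.2.le h10).trans ?_
              rw [pow_succ]
              exact mul_le_mul_of_nonneg_left h9.le hεN.le
          _ = (2 * r n * |f n x|) * ε ^ N := by ring
          _ ≤ _ := mul_le_mul_of_nonneg_right h7 hεN.le
  refine (norm_sum_le_of_le _ h3).trans ?_
  rw [← Finset.sum_mul, norm_pow, Real.norm_of_nonneg hε01.1.le]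
  exact mul_le_mul_of_nonneg_right (hbs.sum_le_tsum _ fun n _ => hb0 n) (pow_nonneg hε01.1.le N)

/-- Borel summation, simultaneously for finitely many sequences of functions. -/
theorem exists_borelSum {ι : Type*} [Fintype ι] {f : ι → ℕ → E3 → ℝ}
    (hf : ∀ i n, ContDiff ℝ ∞ (f i n)) : ∃ r : ℕ → ℝ, (∀ i, ContDiff ℝ ∞ (borelSum r (f i))) ∧
      (∀ i x, HasExpansion (fun ε => borelSum r (f i) (x, ε)) fun n => f i n x) ∧
      ∀ ε : ℝ, ε ≠ 0 → ∃ K : ℕ, ∀ (g : ℕ → E3 → ℝ) (x : E3),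
        borelSum r g (x, ε) = ∑ n ∈ Finset.range K, borelCoeff r n ε * g n x := by
  obtain ⟨r, hr, hr2, hB, hD⟩ := exists_borel_radii hf
  refine ⟨r, fun i => contDiff_borelSum (hf i) (hD i),
    fun i x => hasExpansion_borelSum hr hr2 (hB i) x, fun ε hε => ?_⟩
  obtain ⟨K, hK⟩ := exists_borelSum_eq_sum hr hr2 hε
  exact ⟨K, fun g x => hK K g x le_rfl⟩

end

section

/-! ### The circle bundle -/

theorem spinProj_mul_self {u : E3} (hu : ‖u‖ = 1) : spinProj u * spinProj u = spinProj u := by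
  have h := norm_sq_eq_sum u
  rw [hu] at h
  have h' : (u 0 : ℂ) ^ 2 + (u 1 : ℂ) ^ 2 + (u 2 : ℂ) ^ 2 = 1 := by
    exact_mod_cast h.symm.trans (by norm_num)
  ext i j
  fin_cases i <;> fin_cases j <;>
    simp [spinProj, Matrix.mul_apply, Fin.sum_univ_two]
  · linear_combination (1 / 4 : ℂ) * h' - (1 / 4 : ℂ) * (u 1 : ℂ) ^ 2 * Complex.I_sq
  · ring
  · ring
  · linear_combination (1 / 4 : ℂ) * h' - (1 / 4 : ℂ) * (u 1 : ℂ) ^ 2 * Complex.I_sq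

/-- The $2\times2$ minors vanish because the determinant is $(1-|u|^2)/4=0$. Tensor products inherit
this, so the range is a line. -/
theorem spinProj_rank_one {u : E3} (hu : ‖u‖ = 1) (a b c d : Fin 2) :
    spinProj u a b * spinProj u c d = spinProj u a d * spinProj u c b := by
  have h := norm_sq_eq_sum u
  rw [hu] at h
  have h' : (u 0 : ℂ) ^ 2 + (u 1 : ℂ) ^ 2 + (u 2 : ℂ) ^ 2 = 1 := by
    exact_mod_cast h.symm.trans (by norm_num)
  fin_cases a <;> fin_cases b <;> fin_cases c <;> fin_cases d <;>
    simp [spinProj] <;> try ring1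
  · linear_combination (-1 / 4 : ℂ) * h' + (1 / 4 : ℂ) * (u 1 : ℂ) ^ 2 * Complex.I_sq
  · linear_combination (1 / 4 : ℂ) * h' - (1 / 4 : ℂ) * (u 1 : ℂ) ^ 2 * Complex.I_sq
  · linear_combination (1 / 4 : ℂ) * h' - (1 / 4 : ℂ) * (u 1 : ℂ) ^ 2 * Complex.I_sq
  · linear_combination (-1 / 4 : ℂ) * h' + (1 / 4 : ℂ) * (u 1 : ℂ) ^ 2 * Complex.I_sq

variable {k : ℕ}

/-- The matrix of the tensor product of the spinor projections in the directions `u j`. -/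
def tensMat (u : Site k → E3) (i i' : Site k → Fin 2) : ℂ := ∏ j, spinProj (u j) (i j) (i' j)

/-- The tensor product of the spinor projections in the directions `u j`. -/
def tensProj (u : Site k → E3) (T : Tens k) : Tens k := fun i => ∑ i', tensMat u i i' * T i'

/-- The unit vectors in the range of `tensProj u`. -/
def unitFibre (u : Site k → E3) : Set (Tens k) := {T | tensProj u T = T ∧ tnorm T = 1}

/-- The normalized projection of `T`. -/
def section_ (u : Site k → E3) (T : Tens k) : Tens k :=
  (tnorm (tensProj u T))⁻¹ • tensProj u T

theorem sum_prod_mul_prod (A B : Site k → Matrix (Fin 2) (Fin 2) ℂ) (i l : Site k → Fin 2) :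
    ∑ i' : Site k → Fin 2, (∏ j, A j (i j) (i' j)) * ∏ j, B j (i' j) (l j) =
      ∏ j, (A j * B j) (i j) (l j) := by
  simp only [Matrix.mul_apply, ← Finset.prod_mul_distrib]
  rw [Finset.prod_univ_sum]
  simp [Fintype.piFinset_univ]

theorem tensProj_tensProj {u : Site k → E3} (hu : ∀ j, ‖u j‖ = 1) (T : Tens k) :
    tensProj u (tensProj u T) = tensProj u T := by
  ext i
  simp only [tensProj, Finset.mul_sum]
  rw [Finset.sum_comm]
  refine Finset.sum_congr rfl fun l _ => ?_
  simp only [← mul_assoc]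
  rw [← Finset.sum_mul]
  congr 1
  simp only [tensMat]
  rw [sum_prod_mul_prod]
  exact Finset.prod_congr rfl fun j _ => by rw [spinProj_mul_self (hu j)]

theorem tensMat_rank_one {u : Site k → E3} (hu : ∀ j, ‖u j‖ = 1) (a b c d : Site k → Fin 2) :
    tensMat u a b * tensMat u c d = tensMat u a d * tensMat u c b := by
  simp only [tensMat, ← Finset.prod_mul_distrib]
  exact Finset.prod_congr rfl fun j _ => spinProj_rank_one (hu j) _ _ _ _

theorem tensProj_mul_comm {u : Site k → E3} (hu : ∀ j, ‖u j‖ = 1) {T T' : Tens k}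
    (hT : tensProj u T = T) (hT' : tensProj u T' = T') (i l : Site k → Fin 2) :
    T i * T' l = T' i * T l := by
  have h : ∀ S S' : Tens k, tensProj u S i * tensProj u S' l =
      ∑ a, ∑ b, tensMat u i a * tensMat u l b * (S a * S' b) := fun S S' => by
    simp only [tensProj]
    rw [Finset.sum_mul_sum]
    exact Finset.sum_congr rfl fun a _ => Finset.sum_congr rfl fun b _ => by ring
  rw [← hT, ← hT', h, h, Finset.sum_comm]
  refine Finset.sum_congr rfl fun a _ => Finset.sum_congr rfl fun b _ => ?_
  rw [tensMat_rank_one hu]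
  ring

/-- The trace is the product of the traces of the factors, each equal to 1. -/
theorem exists_tensMat_ne_zero (u : Site k → E3) : ∃ i, tensMat u i i ≠ 0 := by
  by_contra! h
  have h1 : ∑ i, tensMat u i i = ∏ j : Site k, ∑ a, spinProj (u j) a a := by
    rw [Finset.prod_univ_sum]
    simp [Fintype.piFinset_univ, tensMat]
  have h2 : ∀ j : Site k, ∑ a, spinProj (u j) a a = 1 := fun j => by
    simp [spinProj, Fin.sum_univ_two]
    ring
  simp [h, h2] at h1

theorem tnorm_nonneg (T : Tens k) : 0 ≤ tnorm T := Real.sqrt_nonneg _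

theorem tnorm_eq_zero {T : Tens k} : tnorm T = 0 ↔ T = 0 := by
  rw [tnorm, Real.sqrt_eq_zero (Finset.sum_nonneg fun i _ => Complex.normSq_nonneg _),
    Finset.sum_eq_zero_iff_of_nonneg fun i _ => Complex.normSq_nonneg _]
  simp [funext_iff]

theorem tnorm_smul (c : ℝ) (T : Tens k) : tnorm (c • T) = |c| * tnorm T := by
  have : ∀ i, Complex.normSq ((c • T) i) = c ^ 2 * Complex.normSq (T i) := fun i => by
    simp [Complex.normSq_mul, sq]
  rw [tnorm, tnorm]
  simp only [this]
  rw [← Finset.mul_sum, Real.sqrt_mul (sq_nonneg c), Real.sqrt_sq_eq_abs]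

theorem tnorm_csmul (c : ℂ) (T : Tens k) : tnorm (c • T) = ‖c‖ * tnorm T := by
  have : ∀ i, Complex.normSq ((c • T) i) = ‖c‖ ^ 2 * Complex.normSq (T i) := fun i => by
    simp [Complex.normSq_eq_norm_sq, mul_pow]
  rw [tnorm, tnorm]
  simp only [this]
  rw [← Finset.mul_sum, Real.sqrt_mul (sq_nonneg _), Real.sqrt_sq (norm_nonneg c)]

theorem tensProj_smul (u : Site k → E3) (c : ℝ) (T : Tens k) :
    tensProj u (c • T) = c • tensProj u T := by
  ext i
  simp only [tensProj, Pi.smul_apply, Finset.smul_sum, mul_smul_comm]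

theorem tensProj_csmul (u : Site k → E3) (c : ℂ) (T : Tens k) :
    tensProj u (c • T) = c • tensProj u T := by
  ext i
  simp only [tensProj, Pi.smul_apply, Finset.smul_sum, mul_smul_comm]

theorem section_mem_unitFibre {u : Site k → E3} (hu : ∀ j, ‖u j‖ = 1) {T : Tens k}
    (hT : tensProj u T ≠ 0) : section_ u T ∈ unitFibre u := by
  have h : tnorm (tensProj u T) ≠ 0 := fun h => hT (tnorm_eq_zero.1 h)
  refine ⟨?_, ?_⟩
  · rw [section_, tensProj_smul, tensProj_tensProj hu]
  · rw [section_, tnorm_smul, abs_of_nonneg (inv_nonneg.2 (tnorm_nonneg _)), inv_mul_cancel₀ h]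

theorem unitFibre_nonempty {u : Site k → E3} (hu : ∀ j, ‖u j‖ = 1) : (unitFibre u).Nonempty := by
  obtain ⟨i, hi⟩ := exists_tensMat_ne_zero u
  refine ⟨section_ u (Pi.single i 1), section_mem_unitFibre hu fun h => hi ?_⟩
  have := congrFun h i
  simpa [tensProj, Pi.single_apply] using this

theorem exp_smul_mem_unitFibre {u : Site k → E3} {T : Tens k} (hT : T ∈ unitFibre u) (θ : ℝ) :
    Complex.exp (θ * Complex.I) • T ∈ unitFibre u := by
  refine ⟨by rw [tensProj_csmul, hT.1], ?_⟩
  rw [tnorm_csmul, Complex.norm_exp_ofReal_mul_I, hT.2, one_mul]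

/-- Both vectors lie on one complex line by `tensProj_mul_comm`, so they differ by a scalar, which
is a phase since both are unit vectors: a fibre is a single orbit of the circle. -/
theorem exists_exp_smul_eq {u : Site k → E3} (hu : ∀ j, ‖u j‖ = 1) {T T' : Tens k}
    (hT : T ∈ unitFibre u) (hT' : T' ∈ unitFibre u) :
    ∃ θ : ℝ, T' = Complex.exp (θ * Complex.I) • T := by
  have h0 : T ≠ 0 := fun h => by
    have := hT.2
    rw [tnorm_eq_zero.2 h] at this
    exact zero_ne_one this
  obtain ⟨l, hl⟩ := Function.ne_iff.1 h0
  have h1 : T' = (T' l / T l) • T := by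
    ext i
    have := tensProj_mul_comm hu hT.1 hT'.1 i l
    simp only [Pi.zero_apply] at hl
    simp only [Pi.smul_apply, smul_eq_mul]
    field_simp
    linear_combination -this
  have h2 : ‖T' l / T l‖ = 1 := by
    have := hT'.2
    rw [h1, tnorm_csmul, hT.2, mul_one] at this
    exact this
  refine ⟨(T' l / T l).arg, ?_⟩
  have h3 := Complex.norm_mul_exp_arg_mul_I (T' l / T l)
  rw [h2, Complex.ofReal_one, one_mul] at h3
  rw [h3]
  exact h1

theorem contDiff_spinProj (a b : Fin 2) : ContDiff ℝ ∞ fun u : E3 => spinProj u a b := by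
  have h : ∀ i : Fin 3, ContDiff ℝ ∞ fun u : E3 => ((u i : ℝ) : ℂ) := fun i =>
    Complex.ofRealCLM.contDiff.comp (EuclideanSpace.proj i : E3 →L[ℝ] ℝ).contDiff
  have h0 := h 0
  have h1 := h 1
  have h2 := h 2
  fin_cases a <;> fin_cases b <;> simp only [spinProj, Matrix.smul_apply, Fin.zero_eta, Fin.mk_one,
    Matrix.of_apply, Matrix.cons_val_zero, Matrix.cons_val_one, smul_eq_mul, Fin.isValue] <;>
    fun_prop

theorem contDiff_tensProj :
    ContDiff ℝ ∞ fun q : (Site k → E3) × Tens k => tensProj q.1 q.2 := by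
  rw [contDiff_pi]
  intro i
  refine ContDiff.sum fun i' _ => ContDiff.mul (contDiff_prod fun j _ => ?_) ?_
  · have h1 : ContDiff ℝ ∞ fun q : (Site k → E3) × Tens k => q.1 j := by fun_prop
    exact (contDiff_spinProj _ _).comp h1
  · fun_prop

theorem contDiffAt_tnorm {T : Tens k} (hT : T ≠ 0) : ContDiffAt ℝ ∞ (tnorm (k := k)) T := by
  have h1 : ContDiff ℝ ∞ fun T : Tens k => ∑ i, Complex.normSq (T i) := by
    simp only [Complex.normSq_eq_norm_sq]
    exact ContDiff.sum fun i _ => (by fun_prop : ContDiff ℝ ∞ fun T : Tens k => T i).norm_sq ℝ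
  refine h1.contDiffAt.sqrt fun h => hT (tnorm_eq_zero.1 ?_)
  rw [tnorm, h, Real.sqrt_zero]

theorem contDiffAt_section {q : (Site k → E3) × Tens k} (hq : tensProj q.1 q.2 ≠ 0) :
    ContDiffAt ℝ ∞ (fun q : (Site k → E3) × Tens k => section_ q.1 q.2) q := by
  have h := contDiff_tensProj (k := k).contDiffAt (x := q)
  have h1 : ContDiffAt ℝ ∞ (fun q : (Site k → E3) × Tens k => tnorm (tensProj q.1 q.2)) q :=
    ContDiffAt.comp q (g := tnorm) (f := fun q : (Site k → E3) × Tens k => tensProj q.1 q.2)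
      (contDiffAt_tnorm hq) h
  exact (h1.inv fun h => hq (tnorm_eq_zero.1 h)).smul h

/-- The directions at `x` of the factors of the tensor product. -/
def siteDir (p : Fin k → E3) (x : E3) (j : Site k) : E3 := siteSign j • dir (sitePos p j) x

theorem exists_centre_eq (p : Fin k → E3) (j : Site k) : ∃ c, sitePos p j = centre p c := by
  rcases j with a | a
  · exact ⟨some a, rfl⟩
  · exact ⟨none, rfl⟩

theorem abs_siteSign (j : Site k) : |siteSign j| = 1 := by
  rcases j with a | a <;> simp [siteSign]

theorem norm_dir {c x : E3} (h : x ≠ c) : ‖dir c x‖ = 1 := by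
  rw [dir, norm_smul, norm_inv, norm_norm, inv_mul_cancel₀ (norm_ne_zero_iff.2 (sub_ne_zero.2 h))]

theorem norm_siteSign_smul (j : Site k) {v : E3} (hv : ‖v‖ = 1) : ‖siteSign j • v‖ = 1 := by
  rw [norm_smul, Real.norm_eq_abs, abs_siteSign, hv, one_mul]

theorem norm_siteDir {p : Fin k → E3} {x : E3} (h : ∀ c, x ≠ centre p c) (j : Site k) :
    ‖siteDir p x j‖ = 1 := by
  obtain ⟨c, hc⟩ := exists_centre_eq p j
  exact norm_siteSign_smul j (norm_dir (hc ▸ h c))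

/-! ### The involution -/

/-- The quaternionic structure on $\mathbb C^2$ anticommutes with the Pauli matrices, hence
exchanges the eigenlines of $u\cdot\sigma$. -/
theorem spinProj_neg (u : E3) (a b : Fin 2) : spinProj (-u) a b =
    (if a = 0 then -1 else 1) * (if b = 0 then -1 else 1) *
      starRingEnd ℂ (spinProj u (1 - a) (1 - b)) := by
  have h2 : starRingEnd ℂ 2 = 2 := Complex.conj_ofNat 2
  fin_cases a <;> fin_cases b <;> simp [spinProj, h2] <;> ring

theorem siteRefl_siteRefl (j : Site k) : siteRefl (siteRefl j) = j := by
  rcases j with ⟨ν, s⟩ | a <;> simp [siteRefl]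

theorem siteDir_neg (p : Fin k → E3) (x : E3) (j : Site k) :
    siteDir p (-x) (siteRefl j) = - siteDir p x j := by
  have h : sitePos p (siteRefl j) = - sitePos p j := by
    rcases j with ⟨ν, s⟩ | a
    · cases s <;> simp [siteRefl, sitePos, centre]
    · simp [siteRefl, sitePos]
  have h2 : siteSign (siteRefl j) = siteSign j := by
    rcases j with ⟨ν, s⟩ | a <;> simp [siteRefl, siteSign]
  have h3 : -x - -sitePos p j = -(x - sitePos p j) := by abel
  rw [siteDir, siteDir, h, h2, dir, dir, h3, norm_neg, smul_neg, smul_neg]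

/-- The permutation of the indices of tensors underlying the involution. -/
def indexFlip : (Site k → Fin 2) ≃ (Site k → Fin 2) where
  toFun i := fun j => 1 - i (siteRefl j)
  invFun i := fun j => 1 - i (siteRefl j)
  left_inv i := by ext j; simp [siteRefl_siteRefl]
  right_inv i := by ext j; simp [siteRefl_siteRefl]

theorem tensMat_neg (p : Fin k → E3) (x : E3) (i i' : Site k → Fin 2) :
    tensMat (siteDir p (-x)) i i' =
      (∏ j, if i j = 0 then (-1 : ℂ) else 1) * (∏ j, if i' j = 0 then (-1 : ℂ) else 1) *
        starRingEnd ℂ (tensMat (siteDir p x) (indexFlip i) (indexFlip i')) := by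
  let e : Site k ≃ Site k := ⟨siteRefl, siteRefl, siteRefl_siteRefl, siteRefl_siteRefl⟩
  have h : starRingEnd ℂ (tensMat (siteDir p x) (indexFlip i) (indexFlip i')) =
      ∏ j, starRingEnd ℂ (spinProj (siteDir p x (siteRefl j)) (1 - i j) (1 - i' j)) := by
    rw [tensMat, map_prod, ← e.prod_comp]
    simp [e, indexFlip, siteRefl_siteRefl]
  rw [h, ← Finset.prod_mul_distrib, ← Finset.prod_mul_distrib, tensMat]
  refine Finset.prod_congr rfl fun j _ => ?_
  have h1 := siteDir_neg p x (siteRefl j)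
  rw [siteRefl_siteRefl] at h1
  rw [h1, spinProj_neg]

theorem iota_T_mem_fibre {p : Fin k → E3} {z : Pt k} (hz : z.T ∈ fibre p z.x) :
    (iota z).T ∈ fibre p (iota z).x := by
  have hs : ∀ i : Site k → Fin 2, (∏ j, if i j = 0 then (-1 : ℂ) else 1) *
      (∏ j, if i j = 0 then (-1 : ℂ) else 1) = 1 := fun i => by
    rw [← Finset.prod_mul_distrib]
    exact Finset.prod_eq_one fun j _ => by split_ifs <;> simp
  have hi : ∀ i, (iota z).T i = (∏ j, if i j = 0 then (-1 : ℂ) else 1) *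
      starRingEnd ℂ (z.T (indexFlip i)) := fun i => rfl
  refine ⟨?_, ?_⟩
  · ext i
    have h1 : lineProj p (iota z).x (iota z).T i =
        ∑ i', tensMat (siteDir p (-z.x)) i i' * (iota z).T i' := rfl
    have h2 : z.T (indexFlip i) =
        ∑ i', tensMat (siteDir p z.x) (indexFlip i) (indexFlip i') * z.T (indexFlip i') := by
      rw [indexFlip.sum_comp fun i' => tensMat (siteDir p z.x) (indexFlip i) i' * z.T i']
      exact (congrFun hz.1 (indexFlip i)).symm
    rw [h1, hi i, h2, map_sum, Finset.mul_sum]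
    refine Finset.sum_congr rfl fun i' _ => ?_
    rw [hi i', tensMat_neg, map_mul]
    linear_combination (∏ j, if i j = 0 then (-1 : ℂ) else 1) *
      starRingEnd ℂ (tensMat (siteDir p z.x) (indexFlip i) (indexFlip i')) *
      starRingEnd ℂ (z.T (indexFlip i')) * hs i'
  · rw [← hz.2, tnorm, tnorm, ← indexFlip.sum_comp fun i => Complex.normSq (z.T i)]
    congr 1
    refine Finset.sum_congr rfl fun i _ => ?_
    have h1 : Complex.normSq (∏ j, if i j = 0 then (-1 : ℂ) else 1) = 1 := by
      have h2 := congrArg Complex.normSq (hs i)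
      rw [Complex.normSq_mul, Complex.normSq_one] at h2
      nlinarith [Complex.normSq_nonneg (∏ j, if i j = 0 then (-1 : ℂ) else 1)]
    rw [hi i, Complex.normSq_mul, Complex.normSq_conj, h1, one_mul]

/-! ### The defining functions of the faces -/

theorem profile_of_le {δ t : ℝ} (hδ : 0 < δ) (ht : t ≤ δ) : profile δ t = t := by
  rw [profile, Real.smoothTransition.zero_of_nonpos]
  · ring
  · rw [sub_nonpos, div_le_one hδ]
    exact ht

theorem profile_of_ge {δ t : ℝ} (hδ : 0 < δ) (ht : 2 * δ ≤ t) : profile δ t = 1 := by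
  rw [profile, Real.smoothTransition.one_of_one_le]
  · ring
  · rw [le_sub_iff_add_le, le_div_iff₀ hδ]
    linarith

theorem profile_pos {δ t : ℝ} (ht : 0 < t) : 0 < profile δ t := by
  have h0 := Real.smoothTransition.nonneg (t / δ - 1)
  have h1 := Real.smoothTransition.le_one (t / δ - 1)
  rw [profile]
  rcases h0.eq_or_lt with h | h
  · rw [← h]
    linarith
  · have : 0 ≤ (1 - Real.smoothTransition (t / δ - 1)) * t :=
      mul_nonneg (by linarith) ht.le
    linarith

theorem contDiff_profile (δ : ℝ) : ContDiff ℝ ∞ (profile δ) := by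
  have h : ContDiff ℝ ∞ fun t : ℝ => Real.smoothTransition (t / δ - 1) :=
    Real.smoothTransition.contDiff.comp ((contDiff_id.div_const _).sub contDiff_const)
  exact ((contDiff_const.sub h).mul contDiff_id).add h

theorem sigmaFin_eq_prod (p : Fin k → E3) (δ : ℝ) (x : E3) :
    sigmaFin p δ x = ∏ c, profile δ ‖x - centre p c‖ := by
  rw [Fintype.prod_option, sigmaFin, Fintype.prod_prod_type]
  simp [centre, sub_neg_eq_add]

theorem sigmaFin_pos {p : Fin k → E3} (δ : ℝ) {x : E3} (h : ∀ c, x ≠ centre p c) :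
    0 < sigmaFin p δ x := by
  rw [sigmaFin_eq_prod]
  exact Finset.prod_pos fun c _ => profile_pos (norm_pos_iff.2 (sub_ne_zero.2 (h c)))

theorem contDiffAt_sigmaFin {p : Fin k → E3} (δ : ℝ) {x : E3} (h : ∀ c, x ≠ centre p c) :
    ContDiffAt ℝ ∞ (sigmaFin p δ) x := by
  rw [show sigmaFin p δ = fun x => ∏ c, profile δ ‖x - centre p c‖ from
    funext (sigmaFin_eq_prod p δ)]
  refine contDiffAt_prod fun c _ => (contDiff_profile δ).contDiffAt.comp x ?_
  exact (contDiffAt_id.sub contDiffAt_const).norm ℝ (sub_ne_zero.2 (h c))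

/-- Within $\delta$ of one centre, all other centres are at distance at least $3\delta$, where their
profiles equal 1. -/
theorem sigmaFin_near {p : Fin k → E3} {δ : ℝ} (hδ : 0 < δ)
    (hsep : ∀ c c', c ≠ c' → 4 * δ ≤ dist (centre p c) (centre p c')) (c : Option (Fin k × Bool))
    {x : E3} (hx : ‖x - centre p c‖ ≤ δ) : sigmaFin p δ x = ‖x - centre p c‖ := by
  rw [sigmaFin_eq_prod, Finset.prod_eq_single c, profile_of_le hδ hx]
  · intro c' _ hc
    refine profile_of_ge hδ ?_
    have h1 := hsep c' c hc
    rw [dist_eq_norm] at h1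
    have h2 : ‖centre p c' - centre p c‖ ≤ ‖x - centre p c‖ + ‖x - centre p c'‖ := by
      rw [← norm_neg (x - centre p c')]
      refine (le_of_eq ?_).trans (norm_add_le _ _)
      congr 1
      abel
    linarith
  · simp

theorem exists_sigmaFin_eq_one (p : Fin k → E3) {δ : ℝ} (hδ : 0 < δ) :
    ∃ R : ℝ, 0 < R ∧ ∀ x : E3, R ≤ ‖x‖ → (∀ c, x ≠ centre p c) ∧ sigmaFin p δ x = 1 := by
  refine ⟨∑ c, ‖centre p c‖ + 2 * δ, by positivity, fun x hx => ?_⟩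
  have h : ∀ c, 2 * δ ≤ ‖x - centre p c‖ := fun c => by
    have h1 := Finset.single_le_sum (f := fun c => ‖centre p c‖) (fun _ _ => norm_nonneg _)
      (Finset.mem_univ c)
    have h2 := norm_sub_norm_le x (centre p c)
    linarith
  refine ⟨fun c hc => ?_, ?_⟩
  · have := h c
    rw [hc, sub_self, norm_zero] at this
    linarith
  · rw [sigmaFin_eq_prod]
    exact Finset.prod_eq_one fun c _ => profile_of_ge hδ (h c)

theorem sigmaI_pos (x : E3) : 0 < sigmaI x := by
  rw [sigmaI]
  positivity

theorem contDiff_sigmaI : ContDiff ℝ ∞ sigmaI := by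
  have : sigmaI = regKernel 1 := by
    ext x
    rw [sigmaI, regKernel, one_pow, add_comm]
  rw [this]
  exact contDiff_regKernel one_pos

theorem sigmaI_neg (x : E3) : sigmaI (-x) = sigmaI x := by rw [sigmaI, sigmaI, norm_neg]

theorem centre_neg (p : Fin k → E3) (c : Option (Fin k × Bool)) :
    ∃ c', centre p c' = - centre p c := by
  rcases c with _ | ⟨ν, s⟩
  · exact ⟨none, by simp [centre]⟩
  · refine ⟨some (ν, !s), ?_⟩
    cases s <;> simp [centre]

theorem neg_ne_centre {p : Fin k → E3} {x : E3} (h : ∀ c, x ≠ centre p c) (c) :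
    -x ≠ centre p c := fun hx => by
  obtain ⟨c', hc'⟩ := centre_neg p c
  exact h c' (by rw [hc', ← hx, neg_neg])

end

section

variable {k : ℕ}

/-! ### Taylor coefficients at the adiabatic face -/

/-- Projecting a fixed fibre vector over `q₀` and normalizing gives the section. The directions `u`
are a parameter independent of the base point, so sections also exist over boundary points of the
blow-up. -/
theorem exists_local_section {Y : Type} [NormedAddCommGroup Y] [NormedSpace ℝ Y]
    {u : Y → Site k → E3} {q₀ : Y} {V : Set Y} (hV : IsOpen V) (hq₀ : q₀ ∈ V)
    (hu : ContDiffOn ℝ ∞ u V) (hu₀ : ∀ j, ‖u q₀ j‖ = 1) :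
    ∃ (V' : Set Y) (s : Y → Tens k), IsOpen V' ∧ q₀ ∈ V' ∧ ContDiffOn ℝ ∞ s V' ∧
      ∀ q ∈ V', (∀ j, ‖u q j‖ = 1) → s q ∈ unitFibre (u q) := by
  obtain ⟨T₀, hT₀⟩ := unitFibre_nonempty hu₀
  have hT₀' : tensProj (u q₀) T₀ ≠ 0 := by
    rw [hT₀.1]
    intro h
    have := hT₀.2
    rw [tnorm_eq_zero.2 h] at this
    exact zero_ne_one this
  have hc : ContinuousOn (fun q => (u q, T₀)) V := hu.continuousOn.prodMk continuousOn_const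
  have huT : ContinuousOn ((fun r : (Site k → E3) × Tens k => tensProj r.1 r.2) ∘
      fun q => (u q, T₀)) V := contDiff_tensProj.continuous.comp_continuousOn hc
  have ho : IsOpen (V ∩ {q | tensProj (u q) T₀ ≠ 0}) :=
    huT.isOpen_inter_preimage hV (isOpen_compl_singleton (x := (0 : Tens k)))
  refine ⟨_, fun q => section_ (u q) T₀, ho, ⟨hq₀, hT₀'⟩, fun q hq => ?_,
    fun q hq h => section_mem_unitFibre h hq.2⟩
  have h1 : ContDiffAt ℝ ∞ (fun q => (u q, T₀)) q :=
    (hu.contDiffAt (hV.mem_nhds hq.1)).prodMk contDiffAt_const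
  have h2 : ContDiffAt ℝ ∞ (fun r : (Site k → E3) × Tens k => section_ r.1 r.2) (u q, T₀) :=
    contDiffAt_section hq.2
  exact (ContDiffAt.comp q (f := fun q => (u q, T₀)) h2 h1).contDiffWithinAt

/-- The common argument for the three charts. `Y` parametrizes the base of the adiabatic face up to
its boundary, `adm` consists of interior parameters, and $\tau$ is the variable transverse to the
face. Composing the smooth extension of `f` with a local section gives a smooth function of
$(q,\tau)$, whose Taylor coefficients in $\tau$ are smooth in `q` across the boundary. -/
theorem exists_smooth_expansion {Y X : Type} [NormedAddCommGroup Y] [NormedSpace ℝ Y]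
    [FiniteDimensional ℝ Y] [NormedAddCommGroup X] [NormedSpace ℝ X] [FiniteDimensional ℝ X]
    {S : Set (Pt k)} {Ψ : Pt k → X} {f : Pt k → ℝ} (J : Y × Tens k × ℝ →L[ℝ] X)
    {u : Y → Site k → E3} {q₀ : Y} {V : Set Y} (hV : IsOpen V) (hq₀ : q₀ ∈ V)
    (hu : ContDiffOn ℝ ∞ u V) (hu₀ : ∀ j, ‖u q₀ j‖ = 1) {adm : Set Y}
    (hadm : ∃ᶠ q in 𝓝 q₀, q ∈ adm) (hu₁ : ∀ q ∈ adm, ∀ j, ‖u q j‖ = 1)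
    {P : Y → Tens k → ℝ → Pt k}
    (hP : ∀ q ∈ adm, ∀ T ∈ unitFibre (u q), ∀ᶠ τ in 𝓝[>] 0, P q T τ ∈ S)
    (hΨ : ∀ q ∈ adm, ∀ T τ, Ψ (P q T τ) = J (q, T, τ))
    (hf : ∀ T ∈ unitFibre (u q₀), J (q₀, T, 0) ∈ closure (Ψ '' S) →
      ExtendsSmoothlyAt S Ψ (J (q₀, T, 0)) f) :
    ∃ a : ℕ → Y → ℝ, (∀ n, ContDiff ℝ ∞ (a n)) ∧ ∀ᶠ q in 𝓝 q₀, q ∈ adm →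
      ∃ T ∈ unitFibre (u q), HasExpansion (fun τ => f (P q T τ)) fun n => a n q := by
  obtain ⟨V', s, hV'o, hq₀', hs, hsm⟩ := exists_local_section hV hq₀ hu hu₀
  have hsmem : ∀ q ∈ V', q ∈ adm → s q ∈ unitFibre (u q) := fun q hq ha => hsm q hq (hu₁ q ha)
  have hJs : ContDiffOn ℝ ∞ (fun r : Y × ℝ => J (r.1, s r.1, r.2)) (V' ×ˢ univ) :=
    J.contDiff.comp_contDiffOn (contDiff_fst.contDiffOn.prodMk
      ((hs.comp contDiff_fst.contDiffOn fun r hr => hr.1).prodMk contDiff_snd.contDiffOn))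
  have hV'u : IsOpen (V' ×ˢ (univ : Set ℝ)) := hV'o.prod isOpen_univ
  have hm₀ : (q₀, (0 : ℝ)) ∈ V' ×ˢ (univ : Set ℝ) := ⟨hq₀', mem_univ _⟩
  have hcont : ContinuousAt (fun r : Y × ℝ => J (r.1, s r.1, r.2)) (q₀, 0) :=
    hJs.continuousOn.continuousAt (hV'u.mem_nhds hm₀)
  have hcl : J (q₀, s q₀, 0) ∈ closure (Ψ '' S) := by
    rw [mem_closure_iff_nhds]
    intro N hN
    have h1 : ∀ᶠ r : Y × ℝ in 𝓝 (q₀, 0), J (r.1, s r.1, r.2) ∈ N := by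
      exact hcont hN
    have h2 := h1.curry_nhds.and (hV'o.mem_nhds hq₀')
    obtain ⟨q, hqa, hq, hqV⟩ := (hadm.and_eventually h2).exists
    obtain ⟨τ, hτ, hτN⟩ := ((hP q hqa (s q) (hsmem q hqV hqa)).and (nhdsWithin_le_nhds hq)).exists
    exact ⟨_, hτN, ⟨P q (s q) τ, hτ, hΨ q hqa _ _⟩⟩
  obtain ⟨U, F, hU, hwU, hF, hfF⟩ := (hf _ (hsm q₀ hq₀' hu₀) hcl).exists_contDiff
  obtain ⟨W, G, hW, hmW, hWV, hG, hGe⟩ := exists_contDiff_eqOn_nhds hV'u hm₀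
    (hF.comp_contDiffOn hJs)
  obtain ⟨a, ha, haG⟩ := exists_taylor_coeff (ContinuousLinearMap.snd ℝ Y ℝ) ((0 : Y), (1 : ℝ)) hG
  refine ⟨fun n q => a n (q, 0), fun n => (ha n).comp (by fun_prop), ?_⟩
  have h3 : ∀ᶠ r : Y × ℝ in 𝓝 (q₀, 0), r ∈ W ∧ J (r.1, s r.1, r.2) ∈ U := by
    exact Eventually.and (hW.mem_nhds hmW) (hcont (hU.mem_nhds hwU))
  filter_upwards [h3.curry_nhds, hV'o.mem_nhds hq₀'] with q hq hqV hqa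
  refine ⟨s q, hsmem q hqV hqa, ?_⟩
  refine (hasExpansion_of_taylor (t := ContinuousLinearMap.snd ℝ Y ℝ) (e := ((0 : Y), (1 : ℝ)))
    (by simp) ha haG (x := (q, 0)) (by simp)).congr ?_
  filter_upwards [nhdsWithin_le_nhds hq, hP q hqa (s q) (hsmem q hqV hqa)] with τ hτ hτS
  have h4 : (q, (0 : ℝ)) + τ • ((0 : Y), (1 : ℝ)) = (q, τ) := by simp
  rw [h4, ← hGe hτ.1, hfF _ hτS (by rw [hΨ q hqa]; exact hτ.2), hΨ q hqa]
  rfl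

theorem eventually_mem_interiorV {p : Fin k → E3} {δ ε₀ : ℝ} (hδ : 0 < δ) (hε₀ : 0 < ε₀) {x : E3}
    (hx : ∀ c, x ≠ centre p c) {T : Tens k} (hT : T ∈ fibre p x) {m : ℝ} (hm : 0 < m) :
    ∀ᶠ τ in 𝓝[>] (0 : ℝ), (⟨x, T, τ * m⟩ : Pt k) ∈ interiorV p δ ε₀ := by
  have h1 : ∀ᶠ τ in 𝓝 (0 : ℝ), τ * m < ε₀ := by
    have : Tendsto (fun τ : ℝ => τ * m) (𝓝 0) (𝓝 (0 * m)) := tendsto_id.mul_const m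
    rw [zero_mul] at this
    exact this.eventually_lt_const hε₀
  have h2 : ∀ᶠ τ in 𝓝 (0 : ℝ), τ * m / sigmaFin p δ x < δ := by
    have : Tendsto (fun τ : ℝ => τ * m / sigmaFin p δ x) (𝓝 0) (𝓝 (0 * m / sigmaFin p δ x)) :=
      (tendsto_id.mul_const m).div_const _
    rw [zero_mul, zero_div] at this
    exact this.eventually_lt_const hδ
  filter_upwards [nhdsWithin_le_nhds h1, nhdsWithin_le_nhds h2, self_mem_nhdsWithin] with τ a b c
  exact ⟨hx, hT, mul_pos c hm, a, b⟩

theorem IsSmooth.extends_base {p : Fin k → E3} {δ ε₀ : ℝ} (hδ : 0 < δ) (hε₀ : 0 < ε₀)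
    {f : Pt k → ℝ} (hf : IsSmooth p δ ε₀ f) {x : E3} (hx : ∀ c, x ≠ centre p c) {T : Tens k}
    (hT : T ∈ fibre p x) : ExtendsSmoothlyAt (interiorV p δ ε₀) chartBase (x, T, (0 : ℝ)) f := by
  refine hf.1 _ ?_ hx hε₀ (by simpa using hδ)
  rw [mem_closure_iff_nhds]
  intro N hN
  have h1 : Tendsto (fun τ : ℝ => (x, T, τ)) (𝓝[>] 0) (𝓝 (x, T, 0)) := by
    have : Continuous fun τ : ℝ => (x, T, τ) := by fun_prop
    exact (this.tendsto 0).mono_left nhdsWithin_le_nhds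
  obtain ⟨τ, hτ, hτS⟩ := ((h1.eventually hN).and
    (eventually_mem_interiorV hδ hε₀ hx hT one_pos)).exists
  rw [mul_one] at hτS
  exact ⟨_, hτ, ⟨x, T, τ⟩, hτS, rfl⟩

theorem hasExpansion_deriv_of_taylor {Φ : ℝ × ℝ → ℝ} {a : ℕ → ℝ × ℝ → ℝ}
    (ha : ∀ n, ContDiff ℝ ∞ (a n)) (hΦ : ∀ N x, Φ x = ∑ n ∈ Finset.range N,
      x.2 ^ n * a n (x.1, 0) + x.2 ^ N * a N x) (θ : ℝ) :
    HasExpansion (fun τ => deriv (fun θ => Φ (θ, τ)) θ) fun n => deriv (fun θ => a n (θ, 0)) θ := by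
  intro N
  have hd : ∀ n τ, HasDerivAt (fun θ => a n (θ, τ)) (fderiv ℝ (a n) (θ, τ) (1, 0)) θ := by
    intro n τ
    have h1 : HasDerivAt (fun θ : ℝ => (θ, τ)) ((1 : ℝ), (0 : ℝ)) θ :=
      (hasDerivAt_id θ).prodMk (hasDerivAt_const θ τ)
    exact ((ha n).differentiable (by simp) (θ, τ)).hasFDerivAt.comp_hasDerivAt θ h1
  have h2 : ∀ τ, deriv (fun θ => Φ (θ, τ)) θ -
      ∑ n ∈ Finset.range N, τ ^ n * deriv (fun θ => a n (θ, 0)) θ =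
      τ ^ N * fderiv ℝ (a N) (θ, τ) (1, 0) := by
    intro τ
    have h3 : HasDerivAt (fun θ => Φ (θ, τ)) (∑ n ∈ Finset.range N,
        τ ^ n * fderiv ℝ (a n) (θ, 0) (1, 0) + τ ^ N * fderiv ℝ (a N) (θ, τ) (1, 0)) θ := by
      have h4 := (HasDerivAt.fun_sum (u := Finset.range N)
        fun n _ => (hd n 0).const_mul (τ ^ n)).add ((hd N τ).const_mul (τ ^ N))
      refine h4.congr_of_eventuallyEq (Eventually.of_forall fun θ => ?_)
      simp [hΦ N]
    rw [h3.deriv]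
    simp only [(hd _ 0).deriv]
    ring
  simp only [h2]
  have h5 : Continuous fun τ : ℝ => fderiv ℝ (a N) (θ, τ) (1, 0) :=
    (((ha N).continuous_fderiv (by simp)).comp (by fun_prop)).clm_apply continuous_const
  exact isBigO_pow_mul_of_continuous h5 N

/-- The expansion at the adiabatic face of an essentially invariant function does not depend on
the point in the fibre. -/
theorem EssInv.exists_expansion {p : Fin k → E3} {δ ε₀ : ℝ} (hδ : 0 < δ) (hε₀ : 0 < ε₀)
    {g : Pt k → ℝ} (hg : EssInv p δ ε₀ g) {x : E3} (hx : ∀ c, x ≠ centre p c) :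
    ∃ a : ℕ → ℝ, ∀ T ∈ fibre p x, HasExpansion (fun τ => g ⟨x, T, τ⟩) a := by
  obtain ⟨T₀, hT₀⟩ := unitFibre_nonempty (norm_siteDir hx)
  let E : ℝ → Tens k := fun θ => Complex.exp (θ * Complex.I) • T₀
  have hE : ContDiff ℝ ∞ E := by
    have h1 : ContDiff ℝ ∞ fun θ : ℝ => Complex.exp (θ * Complex.I) :=
      (Complex.ofRealCLM.contDiff.mul contDiff_const).cexp
    exact h1.smul contDiff_const
  have hEm : ∀ θ, E θ ∈ fibre p x := fun θ => exp_smul_mem_unitFibre hT₀ θ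
  have hEadd : ∀ θ t : ℝ, Complex.exp (t * Complex.I) • E θ = E (θ + t) := fun θ t => by
    simp only [E, smul_smul, ← Complex.exp_add]
    congr 2
    push_cast
    ring
  -- Along the orbit $\theta\mapsto e^{i\theta}T_0$ the Taylor coefficients are locally smooth in
  -- $\theta$. Their derivatives are the Taylor coefficients of $\partial_\theta g$, and these
  -- vanish because $\partial_\theta g=O(\rho^\infty)$.
  have key : ∀ θ₀, ∃ a : ℕ → ℝ → ℝ,
      (∀ᶠ θ in 𝓝 θ₀, HasExpansion (fun τ => g ⟨x, E θ, τ⟩) fun n => a n θ) ∧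
      ∀ n, HasDerivAt (a n) 0 θ₀ := by
    intro θ₀
    obtain ⟨U, F, hU, hwU, hF, hgF⟩ := (hg.1.extends_base hδ hε₀ hx (hEm θ₀)).exists_contDiff
    let Φ : ℝ × ℝ → ℝ := fun r => F (x, E r.1, r.2)
    have hΦ : ContDiff ℝ ∞ Φ := hF.comp (contDiff_const.prodMk
      ((hE.comp contDiff_fst).prodMk contDiff_snd))
    obtain ⟨a, ha, haΦ⟩ := exists_taylor_coeff (ContinuousLinearMap.snd ℝ ℝ ℝ)
      ((0 : ℝ), (1 : ℝ)) hΦ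
    have haΦ' : ∀ N x, Φ x = ∑ n ∈ Finset.range N, x.2 ^ n * a n (x.1, 0) + x.2 ^ N * a N x := by
      intro N x
      have h1 : x - x.2 • ((0 : ℝ), (1 : ℝ)) = (x.1, 0) := by ext <;> simp
      rw [haΦ N x]
      simp only [ContinuousLinearMap.coe_snd', h1]
    have hnear : ∀ᶠ r : ℝ × ℝ in 𝓝 (θ₀, 0), (x, E r.1, r.2) ∈ U := by
      have : Continuous fun r : ℝ × ℝ => (x, E r.1, r.2) :=
        continuous_const.prodMk ((hE.continuous.comp continuous_fst).prodMk continuous_snd)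
      exact this.continuousAt (hU.mem_nhds hwU)
    have hS : ∀ θ, ∀ᶠ τ in 𝓝[>] (0 : ℝ), (⟨x, E θ, τ⟩ : Pt k) ∈ interiorV p δ ε₀ := fun θ => by
      simpa using eventually_mem_interiorV hδ hε₀ hx (hEm θ) one_pos
    refine ⟨fun n θ => a n (θ, 0), ?_, fun n => ?_⟩
    · filter_upwards [hnear.curry_nhds] with θ hθ
      refine (hasExpansion_of_taylor (t := ContinuousLinearMap.snd ℝ ℝ ℝ)
        (e := ((0 : ℝ), (1 : ℝ))) (by simp) ha haΦ (x := (θ, 0)) (by simp)).congr ?_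
      filter_upwards [nhdsWithin_le_nhds hθ, hS θ] with τ hτ hτS
      rw [hgF _ hτS hτ]
      simp [Φ, chartBase]
    · have h1 := hasExpansion_deriv_of_taylor ha haΦ' θ₀
      have h2 : HasExpansion (fun τ => deriv (fun θ => Φ (θ, τ)) θ₀) fun _ => 0 := by
        refine HasExpansion.congr (φ := fun τ => derivTheta g ⟨x, E θ₀, τ⟩) ?_ ?_
        · refine hasExpansion_zero_of_isBigO fun N => ?_
          obtain ⟨U', F', hU', hwU', hF', hgF'⟩ :=
            ((hg.2 N).extends_base hδ hε₀ hx (hEm θ₀)).exists_contDiff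
          have hc : Continuous fun τ : ℝ => F' (x, E θ₀, τ) := hF'.continuous.comp (by fun_prop)
          have h3 : ∀ᶠ τ in 𝓝 (0 : ℝ), (x, E θ₀, τ) ∈ U' := by
            have : Continuous fun τ : ℝ => (x, E θ₀, τ) := by fun_prop
            exact this.continuousAt (hU'.mem_nhds hwU')
          have h4 : (fun τ => (sigmaI x / sigmaFin p δ x) ^ N * (τ ^ N * F' (x, E θ₀, τ)))
              =O[𝓝[>] 0] fun τ : ℝ => τ ^ N := by
            exact (isBigO_pow_mul_of_continuous hc N).const_mul_left _
          refine h4.congr' ?_ EventuallyEq.rfl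
          filter_upwards [nhdsWithin_le_nhds h3, hS θ₀, self_mem_nhdsWithin] with τ hτ hτS hτ0
          have h5 := hgF' _ hτS hτ
          have h6 := (sigmaFin_pos δ hx).ne'
          have h7 := (sigmaI_pos x).ne'
          have h8 : τ ≠ 0 := ne_of_gt hτ0
          simp only [rho, chartBase] at h5
          have h9 : (τ / sigmaFin p δ x * sigmaI x) ^ N ≠ 0 :=
            pow_ne_zero _ (mul_ne_zero (div_ne_zero h8 h6) h7)
          rw [← mul_assoc, ← mul_pow, ← h5,
            show sigmaI x / sigmaFin p δ x * τ = τ / sigmaFin p δ x * sigmaI x by ring]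
          exact mul_div_cancel₀ _ h9
        · filter_upwards [nhdsWithin_le_nhds hnear.curry_nhds.self_of_nhds, hS θ₀] with τ hτ hτS
          rw [derivTheta]
          have h3 : ∀ᶠ t in 𝓝 (0 : ℝ), (x, E (θ₀ + t), τ) ∈ U := by
            have : Continuous fun t : ℝ => (x, E (θ₀ + t), τ) :=
              continuous_const.prodMk ((hE.continuous.comp (by fun_prop)).prodMk continuous_const)
            refine this.continuousAt (hU.mem_nhds ?_)
            rw [add_zero]
            exact hτ
          have h4 : (fun t : ℝ => g ⟨x, Complex.exp (t * Complex.I) • E θ₀, τ⟩) =ᶠ[𝓝 0]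
              fun t => Φ (θ₀ + t, τ) := by
            filter_upwards [h3] with t ht
            rw [hEadd]
            exact hgF ⟨x, E (θ₀ + t), τ⟩ ⟨hx, hEm _, hτS.2.2⟩ ht
          rw [h4.deriv_eq, deriv_comp_const_add (f := fun θ => Φ (θ, τ)), add_zero]
      have h3 := congrFun (h1.unique h2) n
      have h4 : DifferentiableAt ℝ (fun θ : ℝ => a n (θ, 0)) θ₀ :=
        ((ha n).comp (by fun_prop : ContDiff ℝ ∞ fun θ : ℝ => (θ, (0 : ℝ)))).differentiable
          (by simp) θ₀
      have h5 := h4.hasDerivAt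
      rwa [h3] at h5
  choose A hA hA0 using key
  -- By uniqueness the local families of coefficients glue to functions on the whole line, whose
  -- derivative is zero.
  have hAA : ∀ θ₀, ∀ᶠ θ in 𝓝 θ₀, (fun n => A θ n θ) = fun n => A θ₀ n θ := fun θ₀ => by
    filter_upwards [hA θ₀] with θ hθ using (hA θ).self_of_nhds.unique hθ
  have hconst : ∀ n θ, A θ n θ = A 0 n 0 := fun n θ => by
    have h1 : ∀ θ₀, HasDerivAt (fun θ => A θ n θ) 0 θ₀ := fun θ₀ =>
      (hA0 θ₀ n).congr_of_eventuallyEq ((hAA θ₀).mono fun θ hθ => congrFun hθ n)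
    exact is_const_of_deriv_eq_zero (fun θ => (h1 θ).differentiableAt) (fun θ => (h1 θ).deriv) θ 0
  refine ⟨fun n => A 0 n 0, fun T hT => ?_⟩
  obtain ⟨θ, rfl⟩ := exists_exp_smul_eq (norm_siteDir hx) hT₀ hT
  have h1 := (hA θ).self_of_nhds
  simpa only [hconst] using h1

end

section

variable {k : ℕ}

/-! ### Expansions at the adiabatic face in the three kinds of charts -/

theorem isOpen_ne_centre (p : Fin k → E3) : IsOpen {x : E3 | ∀ c, x ≠ centre p c} := by
  simp only [ofPred_forall]
  exact isOpen_iInter_of_finite fun c => isOpen_ne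

theorem contDiffAt_dir {c x : E3} (h : x ≠ c) : ContDiffAt ℝ ∞ (dir c) x :=
  have h1 : ContDiffAt ℝ ∞ (fun x : E3 => x - c) x := by fun_prop
  ContDiffAt.smul ((h1.norm ℝ (sub_ne_zero.2 h)).inv (norm_ne_zero_iff.2 (sub_ne_zero.2 h))) h1

theorem contDiffAt_siteDir {p : Fin k → E3} {x : E3} (h : ∀ c, x ≠ centre p c) :
    ContDiffAt ℝ ∞ (siteDir p) x := by
  rw [contDiffAt_pi]
  intro j
  obtain ⟨c, hc⟩ := exists_centre_eq p j
  exact (contDiffAt_dir (hc ▸ h c)).const_smul (siteSign j)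

theorem frequently_pos (y : E3) {s : Set (E3 × ℝ)} (h : ∀ᶠ σ in 𝓝[>] (0 : ℝ), (y, σ) ∈ s) :
    ∃ᶠ q in 𝓝 (y, (0 : ℝ)), q ∈ s := by
  have h1 : Tendsto (fun σ : ℝ => (y, σ)) (𝓝[>] 0) (𝓝 (y, 0)) := by
    have : Continuous fun σ : ℝ => (y, σ) := by fun_prop
    exact (this.tendsto 0).mono_left nhdsWithin_le_nhds
  exact h1.frequently h.frequently

theorem expansion_base {p : Fin k → E3} {δ ε₀ : ℝ} (hδ : 0 < δ) (hε₀ : 0 < ε₀) {f : Pt k → ℝ}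
    (hf : IsSmooth p δ ε₀ f) {x₀ : E3} (hx₀ : ∀ c, x₀ ≠ centre p c) :
    ∃ a : ℕ → E3 → ℝ, (∀ n, ContDiff ℝ ∞ (a n)) ∧ ∀ᶠ x in 𝓝 x₀, (∀ c, x ≠ centre p c) →
      ∃ T ∈ fibre p x, HasExpansion (fun τ => f ⟨x, T, τ⟩) fun n => a n x := by
  have hV := isOpen_ne_centre p
  refine exists_smooth_expansion (ContinuousLinearMap.id ℝ (E3 × Tens k × ℝ)) hV hx₀
    (fun x hx => (contDiffAt_siteDir hx).contDiffWithinAt) (norm_siteDir hx₀)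
    (eventually_mem_set.2 (hV.mem_nhds hx₀)).frequently (fun x hx => norm_siteDir hx)
    (S := interiorV p δ ε₀) (Ψ := chartBase) (P := fun x T τ => ⟨x, T, τ⟩) ?_ (fun _ _ _ _ => rfl) ?_
  · intro x hx T hT
    simpa using eventually_mem_interiorV hδ hε₀ hx hT one_pos
  · intro T hT _
    exact hf.extends_base hδ hε₀ hx₀ hT

/-- Points near a centre are no centres. -/
theorem add_smul_ne_centre {p : Fin k → E3} {δ : ℝ}
    (hsep : ∀ c c', c ≠ c' → 4 * δ ≤ dist (centre p c) (centre p c')) (c : Option (Fin k × Bool))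
    {y : E3} {σ : ℝ} (hy : ‖y‖ = 1) (hσ : 0 < σ) (hσδ : σ < δ) (c') :
    centre p c + σ • y ≠ centre p c' := by
  have hn : ‖σ • y‖ = σ := by rw [norm_smul, hy, mul_one, Real.norm_of_nonneg hσ.le]
  intro h
  by_cases hc : c' = c
  · rw [hc, add_eq_left] at h
    rw [h, norm_zero] at hn
    linarith
  · have h1 := hsep c' c hc
    rw [dist_eq_norm, ← h, add_sub_cancel_left, hn] at h1
    linarith

/-- The chart at the front face, as a linear map. -/
def frontCoord (k : ℕ) : (E3 × ℝ) × Tens k × ℝ →L[ℝ] E3 × Tens k × ℝ × ℝ :=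
  let A := ContinuousLinearMap.fst ℝ (E3 × ℝ) (Tens k × ℝ)
  let B := ContinuousLinearMap.snd ℝ (E3 × ℝ) (Tens k × ℝ)
  ((ContinuousLinearMap.fst ℝ E3 ℝ).comp A).prod
    (((ContinuousLinearMap.fst ℝ (Tens k) ℝ).comp B).prod
      (((ContinuousLinearMap.snd ℝ (Tens k) ℝ).comp B).prod
        ((ContinuousLinearMap.snd ℝ E3 ℝ).comp A)))

theorem frontCoord_apply (q : E3 × ℝ) (T : Tens k) (τ : ℝ) :
    frontCoord k (q, T, τ) = (q.1, T, τ, q.2) := rfl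

/-- The chart at infinity, as a linear map. -/
def inftyCoord (k : ℕ) : (E3 × ℝ) × Tens k × ℝ →L[ℝ] E3 × Tens k × ℝ × ℝ :=
  let A := ContinuousLinearMap.fst ℝ (E3 × ℝ) (Tens k × ℝ)
  let B := ContinuousLinearMap.snd ℝ (E3 × ℝ) (Tens k × ℝ)
  ((ContinuousLinearMap.fst ℝ E3 ℝ).comp A).prod
    (((ContinuousLinearMap.fst ℝ (Tens k) ℝ).comp B).prod
      (((ContinuousLinearMap.snd ℝ E3 ℝ).comp A).prod
        ((ContinuousLinearMap.snd ℝ (Tens k) ℝ).comp B)))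

theorem inftyCoord_apply (q : E3 × ℝ) (T : Tens k) (τ : ℝ) :
    inftyCoord k (q, T, τ) = (q.1, T, q.2, τ) := rfl

theorem dir_add_smul (c : E3) {y : E3} {σ : ℝ} (hy : ‖y‖ = 1) (hσ : 0 < σ) :
    dir c (c + σ • y) = y := by
  rw [dir, add_sub_cancel_left, norm_smul, hy, mul_one, Real.norm_of_nonneg hσ.le, smul_smul,
    inv_mul_cancel₀ hσ.ne', one_smul]

theorem expansion_front {p : Fin k → E3} {δ ε₀ : ℝ} (hp : Function.Injective (centre p))
    (hδ : 0 < δ) (hε₀ : 0 < ε₀)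
    (hsep : ∀ c c', c ≠ c' → 4 * δ ≤ dist (centre p c) (centre p c')) {f : Pt k → ℝ}
    (hf : IsSmooth p δ ε₀ f) (c : Option (Fin k × Bool)) {y₀ : E3} (hy₀ : ‖y₀‖ = 1) :
    ∃ a : ℕ → E3 × ℝ → ℝ, (∀ n, ContDiff ℝ ∞ (a n)) ∧ ∀ᶠ q : E3 × ℝ in 𝓝 (y₀, 0),
      ‖q.1‖ = 1 → 0 < q.2 → q.2 < δ → ∃ T ∈ fibre p (centre p c + q.2 • q.1),
        HasExpansion (fun τ => f ⟨centre p c + q.2 • q.1, T, τ * q.2⟩) fun n => a n q := by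
  -- At the factors located at the blown-up centre the direction is `y` itself, for every positive
  -- radius; this continues the bundle smoothly to radius zero.
  let u : E3 × ℝ → Site k → E3 := fun q j =>
    if sitePos p j = centre p c then siteSign j • q.1 else siteDir p (centre p c + q.2 • q.1) j
  let V : Set (E3 × ℝ) := {q | ∀ c', c' ≠ c → centre p c + q.2 • q.1 ≠ centre p c'}
  have hV : IsOpen V := by
    simp only [V, ofPred_forall]
    refine isOpen_iInter_of_finite fun c' => isOpen_iInter_of_finite fun _ => ?_
    exact isOpen_ne_fun (by fun_prop) continuous_const
  have hV0 : (y₀, (0 : ℝ)) ∈ V := fun c' hc' => by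
    simpa using fun h => hc' (hp h.symm)
  have hu : ContDiffOn ℝ ∞ u V := by
    rw [contDiffOn_pi]
    intro j
    by_cases hj : sitePos p j = centre p c
    · simp only [u, hj, if_true]
      exact (contDiff_fst.const_smul (siteSign j)).contDiffOn
    · simp only [u, hj, if_false]
      intro q hq
      obtain ⟨c', hc'⟩ := exists_centre_eq p j
      have h1 : centre p c + q.2 • q.1 ≠ sitePos p j := by
        rw [hc']
        exact hq c' fun h => hj (by rw [hc', h])
      have h2 : ContDiffAt ℝ ∞ (fun q : E3 × ℝ => centre p c + q.2 • q.1) q := by fun_prop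
      have h3 := ContDiffAt.comp q (g := dir (sitePos p j)) (contDiffAt_dir h1) h2
      exact (h3.const_smul (siteSign j)).contDiffWithinAt
  have hn : ∀ q : E3 × ℝ, ‖q.1‖ = 1 → q ∈ V → ∀ j, ‖u q j‖ = 1 := by
    intro q hq hqV j
    by_cases hj : sitePos p j = centre p c
    · simp only [u, hj, if_true]
      exact norm_siteSign_smul j hq
    · simp only [u, hj, if_false]
      obtain ⟨c', hc'⟩ := exists_centre_eq p j
      refine norm_siteSign_smul j (norm_dir ?_)
      rw [hc']
      exact hqV c' fun h => hj (by rw [hc', h])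
  let adm : Set (E3 × ℝ) := {q | ‖q.1‖ = 1 ∧ 0 < q.2 ∧ q.2 < δ}
  have hne : ∀ q ∈ adm, ∀ c', centre p c + q.2 • q.1 ≠ centre p c' := fun q hq c' =>
    add_smul_ne_centre hsep c hq.1 hq.2.1 hq.2.2 c'
  have hue : ∀ q ∈ adm, u q = siteDir p (centre p c + q.2 • q.1) := by
    intro q hq
    ext1 j
    by_cases hj : sitePos p j = centre p c
    · simp only [u, hj, if_true, siteDir, dir_add_smul _ hq.1 hq.2.1]
    · simp only [u, hj, if_false]
  refine (exists_smooth_expansion (frontCoord k) hV hV0 hu (hn _ hy₀ hV0)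
    (adm := adm) (frequently_pos y₀ (by
      filter_upwards [Ioo_mem_nhdsGT hδ] with σ hσ using ⟨hy₀, hσ.1, hσ.2⟩))
    (fun q hq => hn q hq.1 fun c' _ => hne q hq c') (S := interiorV p δ ε₀)
    (Ψ := chartFront (centre p c)) (f := f)
    (P := fun q T τ => ⟨centre p c + q.2 • q.1, T, τ * q.2⟩) ?_ ?_ ?_).imp fun a ha => ⟨ha.1, ?_⟩
  · intro q hq T hT
    rw [hue q hq] at hT
    exact eventually_mem_interiorV hδ hε₀ (hne q hq) hT hq.2.1
  · intro q hq T τ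
    have hn : ‖q.2 • q.1‖ = q.2 := by
      rw [norm_smul, hq.1, mul_one, Real.norm_of_nonneg hq.2.1.le]
    have h0 := hq.2.1.ne'
    simp only [chartFront, frontCoord_apply, dir_add_smul _ hq.1 hq.2.1, add_sub_cancel_left, hn]
    rw [mul_div_cancel_right₀ _ h0]
  · intro T hT hcl
    exact hf.2.1 c _ hcl rfl hδ
  · filter_upwards [ha.2] with q hq h1 h2 h3
    obtain ⟨T, hT, hE⟩ := hq ⟨h1, h2, h3⟩
    rw [hue q ⟨h1, h2, h3⟩] at hT
    exact ⟨T, hT, hE⟩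

theorem expansion_infty {p : Fin k → E3} {δ ε₀ : ℝ} (hδ : 0 < δ) (hε₀ : 0 < ε₀) {f : Pt k → ℝ}
    (hf : IsSmooth p δ ε₀ f) {y₀ : E3} (hy₀ : ‖y₀‖ = 1) {R : ℝ} (hR : 0 < R)
    (hRc : ∀ x : E3, R ≤ ‖x‖ → ∀ c, x ≠ centre p c) :
    ∃ a : ℕ → E3 × ℝ → ℝ, (∀ n, ContDiff ℝ ∞ (a n)) ∧ ∀ᶠ q : E3 × ℝ in 𝓝 (y₀, 0),
      ‖q.1‖ = 1 → 0 < q.2 → q.2 < R⁻¹ → ∃ T ∈ fibre p (q.2⁻¹ • q.1),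
        HasExpansion (fun τ => f ⟨q.2⁻¹ • q.1, T, τ⟩) fun n => a n q := by
  -- Seen from the site `c`, the point $y/s$ lies in the direction of $y-sc$, which is smooth down
  -- to $s=0$.
  let u : E3 × ℝ → Site k → E3 := fun q j => siteSign j • dir 0 (q.1 - q.2 • sitePos p j)
  let V : Set (E3 × ℝ) := {q | ∀ j, q.1 - q.2 • sitePos p j ≠ 0}
  have hV : IsOpen V := by
    simp only [V, ofPred_forall]
    exact isOpen_iInter_of_finite fun j => isOpen_ne_fun (by fun_prop) continuous_const
  have hy0 : y₀ ≠ 0 := norm_ne_zero_iff.1 (by rw [hy₀]; exact one_ne_zero)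
  have hV0 : (y₀, (0 : ℝ)) ∈ V := fun j => by simpa using hy0
  have hu : ContDiffOn ℝ ∞ u V := by
    rw [contDiffOn_pi]
    intro j q hq
    have h2 : ContDiffAt ℝ ∞ (fun q : E3 × ℝ => q.1 - q.2 • sitePos p j) q := by fun_prop
    have h3 := ContDiffAt.comp q (g := dir 0) (contDiffAt_dir (hq j)) h2
    exact (h3.const_smul (siteSign j)).contDiffWithinAt
  have hn : ∀ q ∈ V, ∀ j, ‖u q j‖ = 1 := fun q hq j =>
    norm_siteSign_smul j (norm_dir (hq j))
  let adm : Set (E3 × ℝ) := {q | ‖q.1‖ = 1 ∧ 0 < q.2 ∧ q.2 < R⁻¹}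
  have hnorm : ∀ q ∈ adm, ‖q.2⁻¹ • q.1‖ = q.2⁻¹ := fun q hq => by
    rw [norm_smul, hq.1, mul_one, Real.norm_of_nonneg (inv_nonneg.2 hq.2.1.le)]
  have hne : ∀ q ∈ adm, ∀ c, q.2⁻¹ • q.1 ≠ centre p c := fun q hq => by
    refine hRc _ ?_
    rw [hnorm q hq]
    exact (le_inv_comm₀ hR hq.2.1).2 hq.2.2.le
  have hsub : ∀ q ∈ adm, ∀ c : E3, q.1 - q.2 • c = q.2 • (q.2⁻¹ • q.1 - c) := fun q hq c => by
    rw [smul_sub, smul_smul, mul_inv_cancel₀ hq.2.1.ne', one_smul]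
  have hue : ∀ q ∈ adm, u q = siteDir p (q.2⁻¹ • q.1) := by
    intro q hq
    ext1 j
    simp only [u, siteDir]
    congr 1
    have h0 := hq.2.1.ne'
    rw [dir, dir, sub_zero, hsub q hq, norm_smul, Real.norm_of_nonneg hq.2.1.le, smul_smul,
      mul_inv]
    congr 1
    field_simp
  refine (exists_smooth_expansion (inftyCoord k) hV hV0 hu (hn _ hV0)
    (adm := adm) (frequently_pos y₀ (by
      filter_upwards [Ioo_mem_nhdsGT (inv_pos.2 hR)] with σ hσ using ⟨hy₀, hσ.1, hσ.2⟩))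
    (fun q hq => by rw [hue q hq]; exact norm_siteDir (hne q hq)) (S := interiorV p δ ε₀)
    (Ψ := chartInfty) (f := f) (P := fun q T τ => ⟨q.2⁻¹ • q.1, T, τ⟩) ?_ ?_ ?_).imp fun a ha => ⟨ha.1, ?_⟩
  · intro q hq T hT
    rw [hue q hq] at hT
    simpa using eventually_mem_interiorV hδ hε₀ (hne q hq) hT one_pos
  · intro q hq T τ
    simp only [chartInfty, inftyCoord_apply, hnorm q hq, inv_inv]
    rw [dir, sub_zero, hnorm q hq, inv_inv, smul_smul, mul_inv_cancel₀ hq.2.1.ne', one_smul]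
  · intro T hT hcl
    exact hf.2.2 _ hcl rfl hε₀
  · filter_upwards [ha.2] with q hq h1 h2 h3
    obtain ⟨T, hT, hE⟩ := hq ⟨h1, h2, h3⟩
    rw [hue q ⟨h1, h2, h3⟩] at hT
    exact ⟨T, hT, hE⟩

end

section

variable {k : ℕ}

/-! ### The Taylor coefficients as smooth functions on ℝ³ -/

theorem PolarFlat.hasExpansion_zero {f : E3 → ℝ} (hf : PolarFlat f) {y : E3} (hy : ‖y‖ = 1) :
    HasExpansion (fun σ => f (σ • y)) fun _ => 0 := by
  refine hasExpansion_zero_of_isBigO fun N => ?_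
  obtain ⟨C, r, hr, h⟩ := hf.exists_bound N
  refine IsBigO.of_bound C ?_
  filter_upwards [Ioo_mem_nhdsGT hr] with σ hσ
  have hn : ‖σ • y‖ = σ := by rw [norm_smul, hy, mul_one, Real.norm_of_nonneg hσ.1.le]
  have h0 : σ • y ≠ 0 := norm_pos_iff.1 (by rw [hn]; exact hσ.1)
  have h1 := h _ h0 (by rw [hn]; exact hσ.2)
  rw [hn] at h1
  rwa [norm_pow, Real.norm_of_nonneg hσ.1.le]

theorem sigmaI_inv_smul {y : E3} {s : ℝ} (hy : ‖y‖ = 1) (hs : 0 < s) :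
    sigmaI (s⁻¹ • y) = s * sigmaI (s • y) := by
  have h1 : ‖s⁻¹ • y‖ = s⁻¹ := by
    rw [norm_smul, hy, mul_one, Real.norm_of_nonneg (inv_nonneg.2 hs.le)]
  have h2 : ‖s • y‖ = s := by rw [norm_smul, hy, mul_one, Real.norm_of_nonneg hs.le]
  have h3 : √(1 + s ^ 2) = s * √(1 + s⁻¹ ^ 2) := by
    rw [← Real.sqrt_sq hs.le, ← Real.sqrt_mul (sq_nonneg s), Real.sqrt_sq hs.le]
    congr 1
    field_simp
    ring
  rw [sigmaI, sigmaI, h1, h2, h3, mul_inv, ← mul_assoc, mul_inv_cancel₀ hs.ne', one_mul]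

theorem add_ne_centre {p : Fin k → E3} {δ : ℝ}
    (hsep : ∀ c c', c ≠ c' → 4 * δ ≤ dist (centre p c) (centre p c')) (c : Option (Fin k × Bool))
    {x : E3} (hx : x ≠ 0) (hxδ : ‖x‖ < δ) (c') : centre p c + x ≠ centre p c' := by
  have hn := norm_pos_iff.2 hx
  have h := add_smul_ne_centre hsep c (y := ‖x‖⁻¹ • x) (σ := ‖x‖)
    (by rw [norm_smul, norm_inv, norm_norm, inv_mul_cancel₀ hn.ne']) hn hxδ c'
  rwa [smul_smul, mul_inv_cancel₀ hn.ne', one_smul] at h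

/-- The coefficients of the expansion at the adiabatic face of an essentially invariant function
which vanishes to infinite order at the other faces. -/
theorem exists_coefficients {p : Fin k → E3} {δ ε₀ : ℝ} (hp : Function.Injective (centre p))
    (hδ : 0 < δ) (hε₀ : 0 < ε₀)
    (hsep : ∀ c c', c ≠ c' → 4 * δ ≤ dist (centre p c) (centre p c')) {g : Pt k → ℝ}
    (hinv : IotaInvariant4 p δ ε₀ g)
    (hg : ∀ N : ℕ, EssInv p δ ε₀ fun z => g z / sigma p δ z ^ N) :
    ∃ G g' : ℕ → E3 → ℝ, (∀ n, ContDiff ℝ ∞ (G n)) ∧ (∀ n, ContDiff ℝ ∞ (g' n)) ∧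
      (∀ n c, PolarFlat fun x => G n (centre p c + x)) ∧ (∀ n, PolarFlat (g' n)) ∧
      (∀ n, ∀ x ≠ 0, G n x = ‖x‖⁻¹ ^ 5 * g' n (inv3 x)) ∧ (∀ n x, G n (-x) = G n x) ∧
      ∀ x, (∀ c, x ≠ centre p c) → ∀ T ∈ fibre p x,
        HasExpansion (fun τ => g ⟨x, T, τ⟩) fun n => G n x := by
  classical
  have hg0 : EssInv p δ ε₀ g := by simpa using hg 0
  -- The value 0 at the centres is the one compatible with the flatness proved below.
  let G : ℕ → E3 → ℝ := fun n x => if hx : ∀ c, x ≠ centre p c then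
    (hg0.exists_expansion hδ hε₀ hx).choose n else 0
  have hG : ∀ x, (∀ c, x ≠ centre p c) → ∀ T ∈ fibre p x,
      HasExpansion (fun τ => g ⟨x, T, τ⟩) fun n => G n x := fun x hx => by
    simp only [G, dif_pos hx]
    exact (hg0.exists_expansion hδ hε₀ hx).choose_spec
  have hG0 : ∀ n c, G n (centre p c) = 0 := fun n c => dif_neg fun h => h c rfl
  have hsm : ∀ n x, (∀ c, x ≠ centre p c) → ContDiffAt ℝ ∞ (G n) x := fun n x hx => by
    obtain ⟨a, ha, h⟩ := expansion_base hδ hε₀ hg0.1 hx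
    refine (ha n).contDiffAt.congr_of_eventuallyEq ?_
    filter_upwards [h, (isOpen_ne_centre p).mem_nhds hx] with y hy hyc
    obtain ⟨T, hT, hE⟩ := hy hyc
    exact congrFun ((hG y hyc T hT).unique hE) n
  have hflat : ∀ n c, PolarFlat fun x => G n (centre p c + x) := by
    intro n c M y₀ hy₀
    -- With $\varepsilon=\tau\sigma$ the coefficient of $\tau^n$ is $\sigma^nG_n$. Dividing `g` by
    -- the power $M+n$ of the defining function thus leaves $G_n=\sigma^M\cdot$ smooth.
    obtain ⟨a, ha, h⟩ := expansion_front hp hδ hε₀ hsep (hg (M + n)).1 c hy₀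
    have h2 : ∀ᶠ q : E3 × ℝ in 𝓝 (y₀, 0), q.2 < δ :=
      continuous_snd.continuousAt.eventually_lt_const hδ
    obtain ⟨U, hUs, hU, hmem⟩ := eventually_nhds_iff.1 (h.and h2)
    refine ⟨U, fun q => sigmaI (centre p c + q.2 • q.1) ^ (M + n) * a n q, hU, hmem, ?_, ?_⟩
    · exact ((contDiff_sigmaI.comp (by fun_prop)).pow _ |>.mul (ha n)).contDiffOn
    intro y σ hy hσ hq
    obtain ⟨h3, hσδ⟩ := hUs _ hq
    obtain ⟨T, hT, hE⟩ := h3 hy hσ hσδ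
    have hne := add_smul_ne_centre hsep c hy hσ hσδ
    simp only [sigma] at hE
    have hsig : sigmaFin p δ (centre p c + σ • y) = σ := by
      have hn : ‖σ • y‖ = σ := by rw [norm_smul, hy, mul_one, Real.norm_of_nonneg hσ.le]
      rw [sigmaFin_near hδ hsep c (by rw [add_sub_cancel_left, hn]; exact hσδ.le),
        add_sub_cancel_left, hn]
    rw [hsig] at hE
    have h4 := ((hG _ hne T hT).comp_mul hσ).const_mul
      (((σ * sigmaI (centre p c + σ • y)) ^ (M + n))⁻¹)
    have h5 := congrFun (h4.unique (hE.congr (Eventually.of_forall fun τ => by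
      simp only [div_eq_inv_mul, mul_comm τ]))) n
    have h6 := (sigmaI_pos (centre p c + σ • y)).ne'
    have h7 := hσ.ne'
    simp only [smul_eq_mul]
    rw [← h5]
    field_simp
    ring
  let g' : ℕ → E3 → ℝ := fun n ζ => ‖ζ‖⁻¹ ^ 5 * G n (inv3 ζ)
  obtain ⟨R, hR, hRc⟩ := exists_sigmaFin_eq_one p hδ
  have hflat' : ∀ n, PolarFlat (g' n) := by
    intro n M y₀ hy₀
    -- Five additional powers absorb the factor $|\zeta|^{-5}$ in `g'`.
    obtain ⟨a, ha, h⟩ := expansion_infty hδ hε₀ (hg (M + 5)).1 hy₀ hR fun x hx => (hRc x hx).1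
    have h2 : ∀ᶠ q : E3 × ℝ in 𝓝 (y₀, 0), q.2 < R⁻¹ :=
      continuous_snd.continuousAt.eventually_lt_const (inv_pos.2 hR)
    obtain ⟨U, hUs, hU, hmem⟩ := eventually_nhds_iff.1 (h.and h2)
    refine ⟨U, fun q => sigmaI (q.2 • q.1) ^ (M + 5) * a n q, hU, hmem, ?_, ?_⟩
    · exact ((contDiff_sigmaI.comp (by fun_prop)).pow _ |>.mul (ha n)).contDiffOn
    intro y s hy hs hq
    obtain ⟨h3, hsR⟩ := hUs _ hq
    obtain ⟨T, hT, hE⟩ := h3 hy hs hsR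
    have hn : ‖s • y‖ = s := by rw [norm_smul, hy, mul_one, Real.norm_of_nonneg hs.le]
    have hn' : ‖s⁻¹ • y‖ = s⁻¹ := by
      rw [norm_smul, hy, mul_one, Real.norm_of_nonneg (inv_nonneg.2 hs.le)]
    have hx := hRc (s⁻¹ • y) (by rw [hn']; exact (le_inv_comm₀ hR hs).2 hsR.le)
    simp only [sigma, hx.2, one_mul, sigmaI_inv_smul hy hs] at hE
    have h4 := (hG _ hx.1 T hT).const_mul (((s * sigmaI (s • y)) ^ (M + 5))⁻¹)
    have h5 := congrFun (h4.unique (hE.congr (Eventually.of_forall fun τ => by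
      simp only [div_eq_inv_mul]))) n
    have h6 := (sigmaI_pos (s • y)).ne'
    have h7 := hs.ne'
    have h8 : inv3 (s • y) = s⁻¹ • y := by
      rw [inv3, hn, smul_smul]
      congr 1
      field_simp
    simp only [smul_eq_mul, g', hn, h8]
    rw [← h5]
    field_simp
    ring
  have hsmG : ∀ n, ContDiff ℝ ∞ (G n) := fun n => by
    rw [contDiff_iff_contDiffAt]
    intro x
    by_cases hx : ∀ c, x ≠ centre p c
    · exact hsm n x hx
    push Not at hx
    obtain ⟨c, rfl⟩ := hx
    have h1 := (hflat n c).contDiffOn Metric.isOpen_ball (U := Metric.ball 0 δ)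
      (by simpa using hG0 n c) fun x hx => by
        have h2 := hsm n _ (add_ne_centre hsep c (x := x) hx.2 (by simpa using hx.1))
        exact (ContDiffAt.comp x h2 (contDiffAt_const.add contDiffAt_id)).contDiffWithinAt
    have h2 := h1.contDiffAt (x := centre p c - centre p c)
      (by rw [sub_self]; exact Metric.ball_mem_nhds _ hδ)
    have h3 := ContDiffAt.comp (centre p c) (f := fun x => x - centre p c) h2
      (contDiffAt_id.sub contDiffAt_const)
    simpa [Function.comp_def] using h3
  have hsmg : ∀ n, ContDiff ℝ ∞ (g' n) := fun n => by
    rw [← contDiffOn_univ]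
    refine (hflat' n).contDiffOn isOpen_univ (by simp [g']) fun x hx => ?_
    exact (((contDiffAt_norm_inv hx.2).pow 5).mul
      (ContDiffAt.comp x (hsmG n).contDiffAt (contDiffAt_inv3 hx.2))).contDiffWithinAt
  refine ⟨G, g', hsmG, hsmg, hflat, hflat', fun n x hx => ?_, fun n x => ?_, hG⟩
  · have := norm_ne_zero_iff.2 hx
    simp only [g', inv3_inv3, norm_inv3]
    field_simp
  · by_cases hx : ∀ c, x ≠ centre p c
    · obtain ⟨T, hT⟩ := unitFibre_nonempty (norm_siteDir hx)
      -- The involution maps the ray over `x` to a ray over `-x`; `g` agrees on both, hence so do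
      -- the coefficients.
      have h1 := hG (-x) (neg_ne_centre hx) _ (iota_T_mem_fibre (z := ⟨x, T, 0⟩) hT)
      have h2 := h1.unique ((hG x hx T hT).congr (by
        filter_upwards [eventually_mem_interiorV hδ hε₀ hx hT one_pos] with τ hτ
        rw [mul_one] at hτ
        exact (hinv _ hτ).symm))
      exact congrFun h2 n
    · push Not at hx
      obtain ⟨c, rfl⟩ := hx
      obtain ⟨c', hc'⟩ := centre_neg p c
      rw [← hc', hG0, hG0]

end

section

variable {k : ℕ}

/-! ### Smooth and rapidly vanishing functions on `V` -/

section Extends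

variable {X : Type} [NormedAddCommGroup X] [NormedSpace ℝ X] {S : Set (Pt k)} {Ψ : Pt k → X}
  {w : X} {f g : Pt k → ℝ}

theorem ExtendsSmoothlyAt.add (hf : ExtendsSmoothlyAt S Ψ w f) (hg : ExtendsSmoothlyAt S Ψ w g) :
    ExtendsSmoothlyAt S Ψ w fun z => f z + g z := by
  obtain ⟨U, F, hU, hw, hF, hfF⟩ := hf
  obtain ⟨U', F', hU', hw', hF', hfF'⟩ := hg
  exact ⟨U ∩ U', fun x => F x + F' x, hU.inter hU', ⟨hw, hw'⟩,
    (hF.mono inter_subset_left).add (hF'.mono inter_subset_right),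
    fun z hz hzU => by simp only [hfF z hz hzU.1, hfF' z hz hzU.2]⟩

theorem ExtendsSmoothlyAt.mul (hf : ExtendsSmoothlyAt S Ψ w f) (hg : ExtendsSmoothlyAt S Ψ w g) :
    ExtendsSmoothlyAt S Ψ w fun z => f z * g z := by
  obtain ⟨U, F, hU, hw, hF, hfF⟩ := hf
  obtain ⟨U', F', hU', hw', hF', hfF'⟩ := hg
  exact ⟨U ∩ U', fun x => F x * F' x, hU.inter hU', ⟨hw, hw'⟩,
    (hF.mono inter_subset_left).mul (hF'.mono inter_subset_right),
    fun z hz hzU => by simp only [hfF z hz hzU.1, hfF' z hz hzU.2]⟩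

theorem ExtendsSmoothlyAt.congr (hf : ExtendsSmoothlyAt S Ψ w f) {U : Set X} (hU : IsOpen U)
    (hw : w ∈ U) (h : ∀ z ∈ S, Ψ z ∈ U → f z = g z) : ExtendsSmoothlyAt S Ψ w g := by
  obtain ⟨U', F, hU', hw', hF, hfF⟩ := hf
  exact ⟨U' ∩ U, F, hU'.inter hU, ⟨hw', hw⟩, hF.mono inter_subset_left,
    fun z hz hzU => by rw [← h z hz hzU.2, hfF z hz hzU.1]⟩

theorem extendsSmoothlyAt_of_contDiffOn {F : X → ℝ} {U : Set X} (hU : IsOpen U) (hw : w ∈ U)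
    (hF : ContDiffOn ℝ ∞ F U) (h : ∀ z ∈ S, Ψ z ∈ U → f z = F (Ψ z)) :
    ExtendsSmoothlyAt S Ψ w f := ⟨U, F, hU, hw, hF, h⟩

/-- Division of a function by powers of a coordinate `t`, if the function vanishes to infinite
order along the rays in the direction of this coordinate. -/
theorem ExtendsSmoothlyAt.div_pow [FiniteDimensional ℝ X] (hf : ExtendsSmoothlyAt S Ψ w f)
    {t : X →L[ℝ] ℝ} {e : X} (he : t e = 1) (ht : ∀ z ∈ S, t (Ψ z) ≠ 0)
    (hray : ∀ z ∈ S, ∃ r : ℝ → Pt k, (∀ᶠ τ in 𝓝[>] 0, r τ ∈ S) ∧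
      (∀ τ, Ψ (r τ) = Ψ z - t (Ψ z) • e + τ • e) ∧
      HasExpansion (fun τ => f (r τ)) fun _ => 0) (N : ℕ) :
    ExtendsSmoothlyAt S Ψ w fun z => f z / t (Ψ z) ^ N := by
  obtain ⟨U, F, hU, hw, hF, hfF⟩ := hf.exists_contDiff
  by_cases htw : t w = 0
  · obtain ⟨R, hR, hRF⟩ := exists_quotient_of_hasExpansion_zero he hF N
    have hπ : Continuous fun x : X => x - t x • e := by fun_prop
    -- The foot of the ray must lie in `U` as well, since the expansion there is read off from the
    -- extension `F`.
    refine ⟨U ∩ (fun x : X => x - t x • e) ⁻¹' U, R, hU.inter (hU.preimage hπ),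
      ⟨hw, by simpa [htw] using hw⟩, hR.contDiffOn, fun z hz hzU => ?_⟩
    obtain ⟨r, hrS, hrΨ, hr⟩ := hray z hz
    have h1 : ∀ᶠ τ in 𝓝 (0 : ℝ), Ψ z - t (Ψ z) • e + τ • e ∈ U := by
      have : Continuous fun τ : ℝ => Ψ z - t (Ψ z) • e + τ • e := by fun_prop
      refine this.continuousAt (hU.mem_nhds ?_)
      simpa using hzU.2
    have h2 := hRF (Ψ z) (hr.congr (by
      filter_upwards [hrS, nhdsWithin_le_nhds h1] with τ hτ hτU
      rw [hfF _ hτ (by rw [hrΨ]; exact hτU), hrΨ]))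
    simp only [hfF z hz hzU.1]
    rw [h2, mul_div_cancel_left₀ _ (pow_ne_zero N (ht z hz))]
  · refine ⟨U ∩ {x | t x ≠ 0}, fun x => F x / t x ^ N,
      hU.inter (isOpen_ne_fun t.continuous continuous_const), ⟨hw, htw⟩, ?_,
      fun z hz hzU => by simp only [hfF z hz hzU.1]⟩
    exact hF.contDiffOn.div (t.contDiff.pow N).contDiffOn fun x hx => pow_ne_zero N hx.2

end Extends

variable {p : Fin k → E3} {δ ε₀ : ℝ} {f g w : Pt k → ℝ}

theorem IsSmooth.add (hf : IsSmooth p δ ε₀ f) (hg : IsSmooth p δ ε₀ g) :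
    IsSmooth p δ ε₀ fun z => f z + g z :=
  ⟨fun w h1 h2 h3 h4 => (hf.1 w h1 h2 h3 h4).add (hg.1 w h1 h2 h3 h4),
    fun c w h1 h2 h3 => (hf.2.1 c w h1 h2 h3).add (hg.2.1 c w h1 h2 h3),
    fun w h1 h2 h3 => (hf.2.2 w h1 h2 h3).add (hg.2.2 w h1 h2 h3)⟩

theorem IsSmooth.mul (hf : IsSmooth p δ ε₀ f) (hg : IsSmooth p δ ε₀ g) :
    IsSmooth p δ ε₀ fun z => f z * g z :=
  ⟨fun w h1 h2 h3 h4 => (hf.1 w h1 h2 h3 h4).mul (hg.1 w h1 h2 h3 h4),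
    fun c w h1 h2 h3 => (hf.2.1 c w h1 h2 h3).mul (hg.2.1 c w h1 h2 h3),
    fun w h1 h2 h3 => (hf.2.2 w h1 h2 h3).mul (hg.2.2 w h1 h2 h3)⟩

theorem IsSmooth.congr (hf : IsSmooth p δ ε₀ f) (h : ∀ z ∈ interiorV p δ ε₀, f z = g z) :
    IsSmooth p δ ε₀ g :=
  ⟨fun w h1 h2 h3 h4 => (hf.1 w h1 h2 h3 h4).congr isOpen_univ (mem_univ _) fun z hz _ => h z hz,
    fun c w h1 h2 h3 => (hf.2.1 c w h1 h2 h3).congr isOpen_univ (mem_univ _) fun z hz _ => h z hz,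
    fun w h1 h2 h3 => (hf.2.2 w h1 h2 h3).congr isOpen_univ (mem_univ _) fun z hz _ => h z hz⟩

theorem IsRapid.congr (hf : IsRapid p δ ε₀ w f) (h : ∀ z ∈ interiorV p δ ε₀, f z = g z) :
    IsRapid p δ ε₀ w g := fun N => (hf N).congr fun z hz => by rw [h z hz]

theorem IsRapid.add (hf : IsRapid p δ ε₀ w f) (hg : IsRapid p δ ε₀ w g) :
    IsRapid p δ ε₀ w fun z => f z + g z :=
  fun N => ((hf N).add (hg N)).congr fun z _ => by rw [add_div]

theorem IsRapid.smooth_mul (hf : IsSmooth p δ ε₀ f) (hg : IsRapid p δ ε₀ w g) :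
    IsRapid p δ ε₀ w fun z => f z * g z :=
  fun N => (hf.mul (hg N)).congr fun z _ => by rw [mul_div_assoc]

/-- A smoothness criterion for functions which are pulled back from the base. -/
theorem isSmooth_of_base {φ : E3 × ℝ → ℝ} (hδ : 0 < δ)
    (h1 : ContDiffOn ℝ ∞ φ ({x | ∀ c, x ≠ centre p c} ×ˢ univ))
    (h2 : ∀ c, ∃ A : E3 × ℝ × ℝ → ℝ, ContDiff ℝ ∞ A ∧ ∀ y ε σ, ‖y‖ = 1 → 0 < ε → 0 < σ → σ < δ →
      φ (centre p c + σ • y, ε) = A (y, ε, σ))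
    {R : ℝ} (hR : 0 < R)
    (h3 : ∃ A : E3 × ℝ × ℝ → ℝ, ContDiff ℝ ∞ A ∧ ∀ y ε s, ‖y‖ = 1 → 0 < ε → 0 < s → s < R →
      φ (s⁻¹ • y, ε) = A (y, ε, s)) :
    IsSmooth p δ ε₀ fun z => φ (z.x, z.eps) := by
  refine ⟨fun w _ hw _ _ => ?_, fun c w _ hw _ => ?_, fun w _ hw _ => ?_⟩
  · refine extendsSmoothlyAt_of_contDiffOn (F := fun q : E3 × Tens k × ℝ => φ (q.1, q.2.2))
      (U := {x | ∀ c, x ≠ centre p c} ×ˢ univ) ((isOpen_ne_centre p).prod isOpen_univ)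
      ⟨hw, mem_univ _⟩ (h1.comp (by fun_prop) fun q hq => ⟨hq.1, mem_univ _⟩) fun z _ _ => rfl
  · obtain ⟨A, hA, hφ⟩ := h2 c
    refine extendsSmoothlyAt_of_contDiffOn
      (F := fun q : E3 × Tens k × ℝ × ℝ => A (q.1, q.2.2.1 * q.2.2.2, q.2.2.2))
      (U := {q | q.2.2.2 < δ}) (isOpen_lt (by fun_prop) continuous_const)
      (by simpa [hw] using hδ) (hA.comp (by fun_prop)).contDiffOn fun z hz hzU => ?_
    have hn := norm_pos_iff.2 (sub_ne_zero.2 (hz.1 c))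
    have h := hφ (dir (centre p c) z.x) z.eps ‖z.x - centre p c‖ (norm_dir (hz.1 c)) hz.2.2.1 hn hzU
    rw [dir, smul_smul, mul_inv_cancel₀ hn.ne', one_smul, add_sub_cancel] at h
    rw [h]
    simp only [chartFront, div_mul_cancel₀ _ hn.ne', dir]
  · obtain ⟨A, hA, hφ⟩ := h3
    refine extendsSmoothlyAt_of_contDiffOn
      (F := fun q : E3 × Tens k × ℝ × ℝ => A (q.1, q.2.2.2, q.2.2.1))
      (U := {q | q.2.2.1 < R}) (isOpen_lt (by fun_prop) continuous_const)
      (by simpa [hw] using hR) (hA.comp (by fun_prop)).contDiffOn fun z hz hzU => ?_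
    have hn := norm_pos_iff.2 (hz.1 none)
    have hd : dir 0 z.x = ‖z.x‖⁻¹ • z.x := by rw [dir, sub_zero]
    have h := hφ (dir 0 z.x) z.eps ‖z.x‖⁻¹ (norm_dir (hz.1 none)) hz.2.2.1 (inv_pos.2 hn) hzU
    rw [hd, smul_smul, inv_inv, mul_inv_cancel₀ hn.ne', one_smul] at h
    rw [h]
    simp only [chartInfty, hd]

theorem isSmooth_const (hδ : 0 < δ) (a : ℝ) : IsSmooth p δ ε₀ fun _ => a :=
  isSmooth_of_base (φ := fun _ => a) hδ contDiffOn_const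
    (fun _ => ⟨fun _ => a, contDiff_const, fun _ _ _ _ _ _ _ => rfl⟩) one_pos
    ⟨fun _ => a, contDiff_const, fun _ _ _ _ _ _ _ => rfl⟩

theorem isSmooth_eps (hδ : 0 < δ) : IsSmooth p δ ε₀ fun z => z.eps :=
  isSmooth_of_base (φ := fun q => q.2) hδ contDiffOn_snd
    (fun _ => ⟨fun q => q.2.1, by fun_prop, fun _ _ _ _ _ _ _ => rfl⟩) one_pos
    ⟨fun q => q.2.1, by fun_prop, fun _ _ _ _ _ _ _ => rfl⟩

/-- A function which vanishes to infinite order at the other faces, and at each point of the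
adiabatic face, is `O((ε σ_I)^∞)`. -/
theorem isRapid_of_pointwise (hδ : 0 < δ) (hε₀ : 0 < ε₀)
    (hsep : ∀ c c', c ≠ c' → 4 * δ ≤ dist (centre p c) (centre p c'))
    (hf : ∀ N : ℕ, IsSmooth p δ ε₀ fun z => f z / sigma p δ z ^ N)
    (h0 : ∀ x, (∀ c, x ≠ centre p c) → ∀ T ∈ fibre p x,
      HasExpansion (fun τ => f ⟨x, T, τ⟩) fun _ => 0) :
    IsRapid p δ ε₀ (fun z => z.eps * sigmaI z.x) f := by
  have hf0 : IsSmooth p δ ε₀ f := by simpa using hf 0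
  have hq : ∀ N x, (∀ c, x ≠ centre p c) → ∀ T ∈ fibre p x, HasExpansion
      (fun τ => f ⟨x, T, τ⟩ / sigma p δ ⟨x, T, τ⟩ ^ N) fun _ => 0 := fun N x hx T hT => by
    have h := (h0 x hx T hT).const_mul ((sigmaFin p δ x * sigmaI x) ^ N)⁻¹
    simp only [mul_zero] at h
    exact h.congr (Eventually.of_forall fun τ => by simp only [sigma, div_eq_inv_mul])
  have hS : ∀ z ∈ interiorV p δ ε₀, ∀ m : ℝ, 0 < m → ∀ᶠ τ in 𝓝[>] (0 : ℝ),
      (⟨z.x, z.T, τ * m⟩ : Pt k) ∈ interiorV p δ ε₀ := fun z hz m hm =>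
    eventually_mem_interiorV hδ hε₀ hz.1 hz.2.1 hm
  have hS1 : ∀ z ∈ interiorV p δ ε₀, ∀ᶠ τ in 𝓝[>] (0 : ℝ),
      (⟨z.x, z.T, τ⟩ : Pt k) ∈ interiorV p δ ε₀ := fun z hz => by
    simpa using hS z hz 1 one_pos
  intro N
  refine ⟨fun w h1 h2 h3 h4 => ?_, fun c w h1 h2 h3 => ?_, fun w h1 h2 h3 => ?_⟩
  · let t : E3 × Tens k × ℝ →L[ℝ] ℝ :=
      (ContinuousLinearMap.snd ℝ (Tens k) ℝ).comp (ContinuousLinearMap.snd ℝ E3 (Tens k × ℝ))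
    have h5 := (hf0.1 w h1 h2 h3 h4).div_pow (t := t) (e := (0, 0, 1)) rfl
      (fun z hz => hz.2.2.1.ne') (fun z hz => ⟨fun τ => ⟨z.x, z.T, τ⟩, hS1 z hz,
        fun τ => by simp [t, chartBase], h0 _ hz.1 _ hz.2.1⟩) N
    have h6 : ExtendsSmoothlyAt (interiorV p δ ε₀) chartBase w fun z => (sigmaI z.x ^ N)⁻¹ :=
      extendsSmoothlyAt_of_contDiffOn (F := fun q : E3 × Tens k × ℝ => (sigmaI q.1 ^ N)⁻¹)
        isOpen_univ (mem_univ w) (((contDiff_sigmaI.comp contDiff_fst).pow N).inv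
          fun q => pow_ne_zero N (sigmaI_pos _).ne').contDiffOn fun z _ _ => rfl
    refine (h5.mul h6).congr isOpen_univ (mem_univ _) fun z _ _ => ?_
    rw [mul_pow, ← div_div, div_eq_mul_inv _ (sigmaI z.x ^ N)]
    rfl
  · let t : E3 × Tens k × ℝ × ℝ →L[ℝ] ℝ :=
      (ContinuousLinearMap.fst ℝ ℝ ℝ).comp ((ContinuousLinearMap.snd ℝ (Tens k) (ℝ × ℝ)).comp
        (ContinuousLinearMap.snd ℝ E3 (Tens k × ℝ × ℝ)))
    have hn : ∀ z ∈ interiorV p δ ε₀, 0 < ‖z.x - centre p c‖ := fun z hz =>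
      norm_pos_iff.2 (sub_ne_zero.2 (hz.1 c))
    -- Near the front face $\varepsilon\sigma_I=\rho\cdot\sigma$. The power of $\sigma$ is divided
    -- out by hypothesis, and the power of $\rho=\varepsilon/|x-c|$ by Hadamard division.
    have h5 := ((hf N).2.1 c w h1 h2 h3).div_pow (t := t) (e := (0, 0, 1, 0)) rfl
      (fun z hz => (div_pos hz.2.2.1 (hn z hz)).ne')
      (fun z hz => ⟨fun τ => ⟨z.x, z.T, τ * ‖z.x - centre p c‖⟩, hS z hz _ (hn z hz),
        fun τ => by simp [t, chartFront, (hn z hz).ne'], by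
          have h := (hq N _ hz.1 _ hz.2.1).comp_mul (hn z hz)
          simp only [mul_zero] at h
          simpa only [mul_comm] using h⟩) N
    refine h5.congr (U := {q | q.2.2.2 < δ}) (isOpen_lt (by fun_prop) continuous_const)
      (by simpa [h2] using hδ) fun z hz hzU => ?_
    have h6 : sigmaFin p δ z.x = ‖z.x - centre p c‖ :=
      sigmaFin_near hδ hsep c (le_of_lt hzU)
    have h7 := (hn z hz).ne'
    rw [sigma, h6, div_div, ← mul_pow]
    congr 2
    change ‖z.x - centre p c‖ * sigmaI z.x * (z.eps / ‖z.x - centre p c‖) = _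
    field_simp
  · obtain ⟨R, hR, hRc⟩ := exists_sigmaFin_eq_one p hδ
    let t : E3 × Tens k × ℝ × ℝ →L[ℝ] ℝ :=
      (ContinuousLinearMap.snd ℝ ℝ ℝ).comp ((ContinuousLinearMap.snd ℝ (Tens k) (ℝ × ℝ)).comp
        (ContinuousLinearMap.snd ℝ E3 (Tens k × ℝ × ℝ)))
    -- Near infinity $\sigma=\sigma_I$, so only the division by $\varepsilon^N$ is left.
    have h5 := ((hf N).2.2 w h1 h2 h3).div_pow (t := t) (e := (0, 0, 0, 1)) rfl
      (fun z hz => hz.2.2.1.ne') (fun z hz => ⟨fun τ => ⟨z.x, z.T, τ⟩, hS1 z hz,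
        fun τ => by simp [t, chartInfty], hq N _ hz.1 _ hz.2.1⟩) N
    refine h5.congr (U := {q | q.2.2.1 < R⁻¹}) (isOpen_lt (by fun_prop) continuous_const)
      (by simpa [h2] using hR) fun z hz hzU => ?_
    have hx := norm_pos_iff.2 (hz.1 none)
    have h6 : ‖z.x‖⁻¹ < R⁻¹ := hzU
    have h7 := (hRc z.x ((inv_lt_inv₀ hx hR).1 h6).le).2
    rw [sigma, h7, one_mul, div_div, ← mul_pow, mul_comm (sigmaI z.x)]
    rfl

end

section

variable {k : ℕ}

/-! ### Solution of the Poisson equation to infinite order -/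

theorem lap_sum {u : ℕ → E3 → ℝ} (hu : ∀ n, ContDiff ℝ ∞ (u n)) (c : ℕ → ℝ) (K : ℕ) (x : E3) :
    lap (fun y => ∑ n ∈ Finset.range K, c n * u n y) x =
      ∑ n ∈ Finset.range K, c n * lap (u n) x := by
  induction K with
  | zero =>
    have h : ∀ j, pd j (fun _ : E3 => (0 : ℝ)) = fun _ => 0 := fun j => by
      ext y
      simp [pd]
    simp [lap, h]
  | succ K ih =>
    simp only [Finset.sum_range_succ]
    rw [lap_add (ContDiff.sum fun n _ => contDiff_const.mul (hu n)) (contDiff_const.mul (hu K)),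
      ih, lap_const_mul _ (hu K)]

/-- In polar coordinates $(y,\varepsilon,\sigma)\mapsto B(c+\sigma y,\varepsilon)$ is smooth also
for $\sigma\le0$, so Hadamard division in $\sigma$ applies. -/
theorem exists_quotient_of_flat {B : E3 × ℝ → ℝ} (hB : ContDiff ℝ ∞ B) (c : E3)
    (hflat : ∀ y ε, ‖y‖ = 1 → 0 < ε → HasExpansion (fun σ => B (c + σ • y, ε)) fun _ => 0)
    (N : ℕ) : ∃ R : E3 × ℝ × ℝ → ℝ, ContDiff ℝ ∞ R ∧ ∀ y ε σ, ‖y‖ = 1 → 0 < ε →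
      B (c + σ • y, ε) = σ ^ N * R (y, ε, σ) := by
  let t : E3 × ℝ × ℝ →L[ℝ] ℝ :=
    (ContinuousLinearMap.snd ℝ ℝ ℝ).comp (ContinuousLinearMap.snd ℝ E3 (ℝ × ℝ))
  have hF : ContDiff ℝ ∞ fun q : E3 × ℝ × ℝ => B (c + q.2.2 • q.1, q.2.1) := hB.comp (by fun_prop)
  obtain ⟨R, hR, h⟩ := exists_quotient_of_hasExpansion_zero (t := t) (e := (0, 0, 1)) rfl hF N
  refine ⟨R, hR, fun y ε σ hy hε => h (y, ε, σ) ?_⟩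
  simpa [t] using hflat y ε hy hε

theorem hasExpansion_zero_sum {ψ : ℕ → ℝ → ℝ} (h : ∀ n, HasExpansion (ψ n) fun _ => 0)
    (c : ℕ → ℝ) (K : ℕ) :
    HasExpansion (fun σ => ∑ n ∈ Finset.range K, c n * ψ n σ) fun _ => 0 :=
  hasExpansion_zero_of_isBigO fun N => IsBigO.fun_sum fun n _ => ((h n).isBigO N).const_mul_left (c n)

variable {p : Fin k → E3} {δ ε₀ : ℝ}

/-- Smoothness, with infinite order of vanishing, of a pull-back from the base. -/
theorem isSmooth_div_sigma_pow (hδ : 0 < δ)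
    (hsep : ∀ c c', c ≠ c' → 4 * δ ≤ dist (centre p c) (centre p c')) {B B' : E3 × ℝ → ℝ}
    (hB : ContDiff ℝ ∞ B) (hB' : ContDiff ℝ ∞ B')
    (hflat : ∀ c y ε, ‖y‖ = 1 → 0 < ε →
      HasExpansion (fun σ => B (centre p c + σ • y, ε)) fun _ => 0)
    (hflat' : ∀ y ε, ‖y‖ = 1 → 0 < ε → HasExpansion (fun s => B' (s • y, ε)) fun _ => 0)
    (hBB : ∀ x ε, x ≠ 0 → 0 < ε → B (x, ε) = ‖x‖⁻¹ ^ 5 * B' (inv3 x, ε)) (N : ℕ) :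
    IsSmooth p δ ε₀ fun z => B (z.x, z.eps) / sigma p δ z ^ N := by
  obtain ⟨R₀, hR₀, hRc⟩ := exists_sigmaFin_eq_one p hδ
  refine isSmooth_of_base (φ := fun q => B q / (sigmaFin p δ q.1 * sigmaI q.1) ^ N) hδ ?_
    (fun c => ?_) (inv_pos.2 hR₀) ?_
  · intro q hq
    have h1 : ContDiffAt ℝ ∞ (fun q : E3 × ℝ => sigmaFin p δ q.1) q :=
      ContDiffAt.comp q (contDiffAt_sigmaFin δ hq.1) contDiffAt_fst
    have h2 : ContDiffAt ℝ ∞ (fun q : E3 × ℝ => sigmaI q.1) q :=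
      (contDiff_sigmaI.comp contDiff_fst).contDiffAt
    exact (hB.contDiffAt.div ((h1.mul h2).pow N) (pow_ne_zero N
      (mul_pos (sigmaFin_pos δ hq.1) (sigmaI_pos _)).ne')).contDiffWithinAt
  · obtain ⟨R, hR, h⟩ := exists_quotient_of_flat hB (centre p c) (hflat c) N
    refine ⟨fun q => R q / sigmaI (centre p c + q.2.2 • q.1) ^ N, hR.div
      ((contDiff_sigmaI.comp (by fun_prop)).pow N) fun q => pow_ne_zero N (sigmaI_pos _).ne', ?_⟩
    intro y ε σ hy hε hσ hσδ
    have hn : ‖σ • y‖ = σ := by rw [norm_smul, hy, mul_one, Real.norm_of_nonneg hσ.le]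
    have hsig : sigmaFin p δ (centre p c + σ • y) = σ := by
      rw [sigmaFin_near hδ hsep c (by rw [add_sub_cancel_left, hn]; exact hσδ.le),
        add_sub_cancel_left, hn]
    simp only [hsig]
    rw [h y ε σ hy hε, mul_pow, mul_div_mul_left _ _ (pow_ne_zero N hσ.ne')]
  · obtain ⟨R, hR, h⟩ := exists_quotient_of_flat hB' 0 (by simpa using hflat') N
    refine ⟨fun q => q.2.2 ^ 5 * (R q / sigmaI (q.2.2 • q.1) ^ N),
      ContDiff.mul (by fun_prop) (hR.div ((contDiff_sigmaI.comp (by fun_prop)).pow N)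
        fun q => pow_ne_zero N (sigmaI_pos _).ne'), ?_⟩
    intro y ε s hy hε hs hsR
    have hn : ‖s⁻¹ • y‖ = s⁻¹ := by
      rw [norm_smul, hy, mul_one, Real.norm_of_nonneg (inv_nonneg.2 hs.le)]
    have hx : s⁻¹ • y ≠ 0 := norm_pos_iff.1 (by rw [hn]; exact inv_pos.2 hs)
    have hsig := (hRc (s⁻¹ • y) (by rw [hn]; exact (le_inv_comm₀ hR₀ hs).2 hsR.le)).2
    have hi : inv3 (s⁻¹ • y) = s • y := by
      rw [inv3, hn, smul_smul]
      congr 1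
      field_simp
    have h1 := h y ε s hy hε
    rw [zero_add] at h1
    simp only [hsig, one_mul, sigmaI_inv_smul hy hs]
    rw [hBB _ _ hx hε, hi, hn, inv_inv, h1, mul_pow, mul_div_assoc,
      mul_div_mul_left _ _ (pow_ne_zero N hs.ne')]

/-- An even solution of the Poisson equation `ΔH = g`, up to terms that vanish to infinite order,
which has an expansion at infinity. -/
theorem exists_potential_of_essInv (hp : Function.Injective (centre p)) (hδ : 0 < δ) (hε₀ : 0 < ε₀)
    (hsep : ∀ c c', c ≠ c' → 4 * δ ≤ dist (centre p c) (centre p c')) {g : Pt k → ℝ}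
    (hinv : IotaInvariant4 p δ ε₀ g)
    (hg : ∀ N : ℕ, EssInv p δ ε₀ fun z => g z / sigma p δ z ^ N) :
    ∃ H K : E3 × ℝ → ℝ, ContDiff ℝ ∞ H ∧ ContDiff ℝ ∞ K ∧
      (∀ ε ≠ 0, ∀ x ≠ 0, H (x, ε) = kelvin (fun y => K (y, ε)) x) ∧
      (∀ ε ≠ 0, ∀ x, H (-x, ε) = H (x, ε)) ∧
      IsRapid p δ ε₀ (fun z => z.eps * sigmaI z.x)
        fun z => lap (fun x => H (x, z.eps)) z.x - g z := by
  obtain ⟨G, g', hG, hg', hfl, hfl', hrel, heven, hexp⟩ :=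
    exists_coefficients hp hδ hε₀ hsep hinv hg
  choose H K hH hK hlap hHK hHe using fun n =>
    exists_even_potential (hG n) (hg' n) (hrel n) (heven n)
  -- One sequence of radii serves all four families, so the weights agree and the relations between
  -- the families carry over to the Borel sums.
  obtain ⟨r, hr, hrexp, hrsum⟩ := exists_borelSum (f := ![H, K, G, g']) (by
    intro i
    fin_cases i
    exacts [hH, hK, hG, hg'])
  refine ⟨borelSum r H, borelSum r K, hr 0, hr 1, ?_, ?_, ?_⟩
  · intro ε hε x hx
    obtain ⟨m, hm⟩ := hrsum ε hε
    rw [kelvin, hm, hm, Finset.mul_sum]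
    refine Finset.sum_congr rfl fun n _ => ?_
    rw [hHK n x hx, kelvin]
    ring
  · intro ε hε x
    obtain ⟨m, hm⟩ := hrsum ε hε
    rw [hm, hm]
    exact Finset.sum_congr rfl fun n _ => by rw [hHe]
  -- The Borel sum of the coefficients has the same Taylor series as `g` at the adiabatic face and,
  -- like `g`, vanishes to infinite order at the other faces.
  have hE : IsRapid p δ ε₀ (fun z => z.eps * sigmaI z.x)
      fun z => borelSum r G (z.x, z.eps) - g z := by
    refine isRapid_of_pointwise hδ hε₀ hsep (fun N => ?_) fun x hx T hT => ?_
    · have h1 : IsSmooth p δ ε₀ fun z => borelSum r G (z.x, z.eps) / sigma p δ z ^ N := by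
        refine isSmooth_div_sigma_pow hδ hsep (B' := borelSum r g') (hr 2) (hr 3) ?_ ?_ ?_ N
        · intro c y ε hy hε
          obtain ⟨m, hm⟩ := hrsum ε hε.ne'
          simp only [hm]
          exact hasExpansion_zero_sum (fun n => (hfl n c).hasExpansion_zero hy) _ _
        · intro y ε hy hε
          obtain ⟨m, hm⟩ := hrsum ε hε.ne'
          simp only [hm]
          exact hasExpansion_zero_sum (fun n => (hfl' n).hasExpansion_zero hy) _ _
        · intro x ε hx hε
          obtain ⟨m, hm⟩ := hrsum ε hε.ne'
          rw [hm, hm, Finset.mul_sum]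
          refine Finset.sum_congr rfl fun n _ => ?_
          change _ * G n x = _
          rw [hrel n x hx]
          ring
      refine (h1.add ((isSmooth_const hδ (-1)).mul (hg N).1)).congr fun z _ => ?_
      ring
    · have h1 := (hrexp 2 x).sub (hexp x hx T hT)
      have h2 : ∀ n, (![H, K, G, g'] 2 n x) - G n x = 0 := fun n => sub_self _
      simp only [h2] at h1
      exact h1
  refine hE.congr fun z hz => ?_
  obtain ⟨m, hm⟩ := hrsum z.eps hz.2.2.1.ne'
  congr 1
  simp only [hm]
  rw [lap_sum hH]
  exact Finset.sum_congr rfl fun n _ => by rw [hlap n z.x (hz.1 none)]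

end

section

variable {k : ℕ}

/-! ### The 1-forms -/

theorem pd_comm (a b : Fin 3) {u : E3 → ℝ} (hu : ContDiff ℝ ∞ u) (x : E3) :
    pd a (pd b u) x = pd b (pd a u) x := by
  have hd : DifferentiableAt ℝ (fderiv ℝ u) x :=
    (hu.fderiv_right (m := ∞) (by simp)).differentiable (by simp) x
  have h : ∀ a b, pd a (pd b u) x = fderiv ℝ (fderiv ℝ u) x (coordVec a) (coordVec b) :=
    fun a b => by
      have h1 : HasFDerivAt (pd b u) _ x := hd.hasFDerivAt.clm_apply (hasFDerivAt_const (coordVec b) x)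
      rw [pd_eq_of_hasFDerivAt h1]
      simp
  rw [h, h]
  refine (hu.contDiffAt.isSymmSndFDerivAt ?_) _ _
  rw [minSmoothness_of_isRCLikeNormedField]
  exact WithTop.coe_le_coe.2 (le_top : (2 : ℕ∞) ≤ ⊤)

theorem contDiff_slice {H : E3 × ℝ → ℝ} (hH : ContDiff ℝ ∞ H) (ε : ℝ) :
    ContDiff ℝ ∞ fun x => H (x, ε) := hH.comp (by fun_prop)

theorem contDiff_pd_slice (j : Fin 3) {H : E3 × ℝ → ℝ} (hH : ContDiff ℝ ∞ H) :
    ContDiff ℝ ∞ fun q : E3 × ℝ => pd j (fun x => H (x, q.2)) q.1 := by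
  have h : ∀ q : E3 × ℝ, pd j (fun x => H (x, q.2)) q.1 = fderiv ℝ H q (coordVec j, 0) := by
    intro q
    have h1 : HasFDerivAt (fun x : E3 => (x, q.2)) (ContinuousLinearMap.inl ℝ E3 ℝ) q.1 :=
      hasFDerivAt_prodMk_left q.1 q.2
    have h2 : HasFDerivAt (fun x => H (x, q.2)) _ q.1 :=
      HasFDerivAt.comp q.1 (hH.differentiable (by simp) (q.1, q.2)).hasFDerivAt h1
    rw [pd_eq_of_hasFDerivAt h2]
    simp
  simp only [h]
  exact (hH.fderiv_right (by simp)).clm_apply contDiff_const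

variable {p : Fin k → E3} {δ ε₀ : ℝ}

/-- Functions on the base, odd in `x`, in `σ_I² C^∞`. -/
def IsOddDecaying (p : Fin k → E3) (δ ε₀ : ℝ) (φ : E3 → ℝ → ℝ) : Prop :=
  (∀ ε ≠ 0, ∀ x, φ (-x) ε = -φ x ε) ∧
    IsSmooth p δ ε₀ fun z => φ z.x z.eps / sigmaI z.x ^ 2

theorem IsOddDecaying.add {φ ψ : E3 → ℝ → ℝ} (hφ : IsOddDecaying p δ ε₀ φ)
    (hψ : IsOddDecaying p δ ε₀ ψ) : IsOddDecaying p δ ε₀ fun x ε => φ x ε + ψ x ε :=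
  ⟨fun ε hε x => by simp only [hφ.1 ε hε, hψ.1 ε hε]; ring,
    (hφ.2.add hψ.2).congr fun z _ => by rw [add_div]⟩

theorem IsOddDecaying.const_mul (hδ : 0 < δ) {φ : E3 → ℝ → ℝ} (hφ : IsOddDecaying p δ ε₀ φ)
    (c : ℝ) : IsOddDecaying p δ ε₀ fun x ε => c * φ x ε :=
  ⟨fun ε hε x => by simp only [hφ.1 ε hε]; ring,
    ((isSmooth_const hδ c).mul hφ.2).congr fun z _ => by rw [mul_div_assoc]⟩

theorem isOddDecaying_zero (hδ : 0 < δ) : IsOddDecaying p δ ε₀ fun _ _ => 0 :=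
  ⟨fun _ _ _ => neg_zero.symm, (isSmooth_const hδ 0).congr fun z _ => by rw [zero_div]⟩

/-- For $H=|x|^{-1}K(x/|x|^2)$ and $x=y/s$, each first derivative is $s^2$ times a smooth function
of $(y,\varepsilon,s)$. This is the source of the weight $\sigma_I^2$ in the theorem. -/
theorem isOddDecaying_pd (hδ : 0 < δ) {H K : E3 × ℝ → ℝ} (hH : ContDiff ℝ ∞ H)
    (hK : ContDiff ℝ ∞ K)
    (hHK : ∀ ε ≠ 0, ∀ x ≠ 0, H (x, ε) = kelvin (fun y => K (y, ε)) x)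
    (he : ∀ ε ≠ 0, ∀ x, H (-x, ε) = H (x, ε)) (j : Fin 3) :
    IsOddDecaying p δ ε₀ fun x ε => pd j (fun y => H (y, ε)) x := by
  refine ⟨fun ε hε x => ?_, ?_⟩
  · have h := congrFun (pd_comp_neg j fun y => H (y, ε)) (-x)
    simp only [he ε hε, neg_neg] at h
    exact h
  have hsI : ∀ x, sigmaI x ^ 2 ≠ 0 := fun x => pow_ne_zero 2 (sigmaI_pos x).ne'
  have hdiv : ContDiff ℝ ∞ fun q : E3 × ℝ => pd j (fun y => H (y, q.2)) q.1 / sigmaI q.1 ^ 2 :=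
    (contDiff_pd_slice j hH).div ((contDiff_sigmaI.comp contDiff_fst).pow 2) fun q => hsI _
  refine isSmooth_of_base (φ := fun q => pd j (fun y => H (y, q.2)) q.1 / sigmaI q.1 ^ 2) hδ
    hdiv.contDiffOn (fun c => ⟨_, hdiv.comp (by fun_prop :
      ContDiff ℝ ∞ fun q : E3 × ℝ × ℝ => (centre p c + q.2.2 • q.1, q.2.1)),
      fun y ε σ _ _ _ _ => rfl⟩) one_pos ?_
  have hm : ContDiff ℝ ∞ fun q : E3 × ℝ × ℝ => (q.2.2 • q.1, q.2.1) := by fun_prop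
  have hc : ∀ i : Fin 3, ContDiff ℝ ∞ fun q : E3 × ℝ × ℝ => q.1 i := fun i =>
    (EuclideanSpace.proj i : E3 →L[ℝ] ℝ).contDiff.comp contDiff_fst
  have hp : ∀ i, ContDiff ℝ ∞ fun q : E3 × ℝ × ℝ => pd i (fun y => K (y, q.2.1)) (q.2.2 • q.1) :=
    fun i => (contDiff_pd_slice i hK).comp hm
  have hs : ContDiff ℝ ∞ fun q : E3 × ℝ × ℝ => q.2.2 := by fun_prop
  refine ⟨fun q => (-(q.1 j * K (q.2.2 • q.1, q.2.1)) +
    q.2.2 * (pd j (fun y => K (y, q.2.1)) (q.2.2 • q.1) -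
      q.1 j * (2 * (q.1 0 * pd 0 (fun y => K (y, q.2.1)) (q.2.2 • q.1) +
        q.1 1 * pd 1 (fun y => K (y, q.2.1)) (q.2.2 • q.1) +
        q.1 2 * pd 2 (fun y => K (y, q.2.1)) (q.2.2 • q.1))))) / sigmaI (q.2.2 • q.1) ^ 2, ?_, ?_⟩
  · refine ContDiff.div ?_ ((contDiff_sigmaI.comp (by fun_prop)).pow 2) fun q => hsI _
    exact ((hc j).mul (hK.comp hm)).neg.add (hs.mul ((hp j).sub ((hc j).mul (contDiff_const.mul
      ((((hc 0).mul (hp 0)).add ((hc 1).mul (hp 1))).add ((hc 2).mul (hp 2)))))))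
  · intro y ε s hy hε hs0 _
    have hn : ‖s⁻¹ • y‖ = s⁻¹ := by
      rw [norm_smul, hy, mul_one, Real.norm_of_nonneg (inv_nonneg.2 hs0.le)]
    have hx : s⁻¹ • y ≠ 0 := norm_pos_iff.1 (by rw [hn]; exact inv_pos.2 hs0)
    have hi : inv3 (s⁻¹ • y) = s • y := by
      rw [inv3, hn, smul_smul]
      congr 1
      field_simp
    have h1 : pd j (fun y => H (y, ε)) (s⁻¹ • y) =
        pd j (kelvin fun y => K (y, ε)) (s⁻¹ • y) := by
      rw [pd, pd]
      congr 1
      refine Filter.EventuallyEq.fderiv_eq ?_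
      filter_upwards [isOpen_ne.mem_nhds hx] with w hw using hHK ε hε.ne' w hw
    have h2 := (sigmaI_pos (s • y)).ne'
    have h3 := hs0.ne'
    simp only [h1, pd_kelvin j (contDiff_slice hK ε) hx, hn, hi, inv_inv, sigmaI_inv_smul hy hs0,
      PiLp.smul_apply, smul_eq_mul]
    field_simp
    ring

/-- The divergence of a row of a matrix of functions. -/
def rowDiv (u : Fin 3 → Fin 3 → E3 → ℝ) (i : Fin 3) (x : E3) : ℝ :=
  pd 0 (u i 0) x + (pd 1 (u i 1) x + pd 2 (u i 2) x)

/-- The components `-(curl u_i)_j + ∑_l ε_{ijl} div u_l` of a triple of 1-forms, where `u_i` are the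
rows of a matrix of functions. -/
def gaugeForm (u : Fin 3 → Fin 3 → E3 → ℝ) (i j : Fin 3) (x : E3) : ℝ :=
  (pd (j + 2) (u i (j + 1)) x + -1 * pd (j + 1) (u i (j + 2)) x) +
    if j = i + 1 then rowDiv u (i + 2) x
    else if j = i + 2 then -1 * rowDiv u (i + 1) x else 0

section

variable {u : Fin 3 → Fin 3 → E3 → ℝ}

theorem contDiff_rowDiv (hu : ∀ i m, ContDiff ℝ ∞ (u i m)) (i : Fin 3) :
    ContDiff ℝ ∞ (rowDiv u i) :=
  (contDiff_pd _ (hu _ _)).add ((contDiff_pd _ (hu _ _)).add (contDiff_pd _ (hu _ _)))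

theorem contDiff_curl (hu : ∀ i m, ContDiff ℝ ∞ (u i m)) (i j : Fin 3) : ContDiff ℝ ∞ fun x =>
    pd (j + 2) (u i (j + 1)) x + -1 * pd (j + 1) (u i (j + 2)) x :=
  (contDiff_pd _ (hu _ _)).add (contDiff_const.mul (contDiff_pd _ (hu _ _)))

theorem contDiff_gaugeForm (hu : ∀ i m, ContDiff ℝ ∞ (u i m)) (i j : Fin 3) :
    ContDiff ℝ ∞ (gaugeForm u i j) := by
  refine (contDiff_curl hu i j).add ?_
  split_ifs
  exacts [contDiff_rowDiv hu _, contDiff_const.mul (contDiff_rowDiv hu _), contDiff_const]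

theorem pd_rowDiv (hu : ∀ i m, ContDiff ℝ ∞ (u i m)) (a i : Fin 3) : pd a (rowDiv u i) = fun x =>
    pd a (pd 0 (u i 0)) x + (pd a (pd 1 (u i 1)) x + pd a (pd 2 (u i 2)) x) := by
  have h := fun b m => contDiff_pd b (hu i m)
  change pd a (fun x => pd 0 (u i 0) x + (pd 1 (u i 1) x + pd 2 (u i 2) x)) = _
  rw [pd_add a (h 0 0) ((h 1 1).add (h 2 2)), pd_add a (h 1 1) (h 2 2)]

theorem pd_gaugeForm (hu : ∀ i m, ContDiff ℝ ∞ (u i m)) (a i j : Fin 3) (x : E3) :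
    pd a (gaugeForm u i j) x =
      (pd a (pd (j + 2) (u i (j + 1))) x + -1 * pd a (pd (j + 1) (u i (j + 2))) x) +
      if j = i + 1 then pd a (rowDiv u (i + 2)) x
      else if j = i + 2 then -1 * pd a (rowDiv u (i + 1)) x else 0 := by
  have h1 : pd a (fun x => pd (j + 2) (u i (j + 1)) x + -1 * pd (j + 1) (u i (j + 2)) x) =
      fun x => pd a (pd (j + 2) (u i (j + 1))) x + -1 * pd a (pd (j + 1) (u i (j + 2))) x := by
    rw [pd_add a (contDiff_pd _ (hu _ _)) (contDiff_const.mul (contDiff_pd _ (hu _ _))),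
      pd_const_mul a _ (contDiff_pd _ (hu _ _))]
  have h2 : ∀ v : E3 → ℝ, ContDiff ℝ ∞ v → pd a (fun x =>
      (pd (j + 2) (u i (j + 1)) x + -1 * pd (j + 1) (u i (j + 2)) x) + v x) x =
      (pd a (pd (j + 2) (u i (j + 1))) x + -1 * pd a (pd (j + 1) (u i (j + 2))) x) + pd a v x := by
    intro v hv
    rw [pd_add a (contDiff_curl hu i j) hv, h1]
  unfold gaugeForm
  split_ifs
  · exact h2 _ (contDiff_rowDiv hu _)
  · rw [h2 _ (contDiff_const.mul (contDiff_rowDiv hu _)), pd_const_mul a _ (contDiff_rowDiv hu _)]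
  · rw [h2 _ contDiff_const]
    simp [pd]

/-- The curl of `gaugeForm u` agrees with the Laplacian of `u` in the trace-free symmetric part. -/
theorem sym_curl_gaugeForm (hu : ∀ i m, ContDiff ℝ ∞ (u i m)) (x : E3) {C : Fin 3 → Fin 3 → ℝ}
    (hC : ∀ i j, C i j = pd (i + 1) (gaugeForm u j (i + 2)) x -
      pd (i + 2) (gaugeForm u j (i + 1)) x) (i j : Fin 3) :
    (C i j + C j i) / 2 - (if i = j then (∑ l, C l l) / 3 else 0) =
      (lap (u i j) x + lap (u j i) x) / 2 - if i = j then (∑ l, lap (u l l) x) / 3 else 0 := by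
  -- With $d_l=\mathrm{div}\,u_l$ one has $C_{ij}=\Delta
  -- u_{ji}-\partial_id_j+\partial_jd_i-\delta_{ij}\sum_l\partial_ld_l$, using the symmetry of
  -- second derivatives. The middle terms are antisymmetric and the last is a multiple of the
  -- identity.
  have hs := fun a b i m => pd_comm a b (hu i m) x
  simp only [hC, pd_gaugeForm hu, pd_rowDiv hu, lap, Fin.sum_univ_three]
  fin_cases i <;> fin_cases j <;>
    simp [hs 1 0, hs 2 0, hs 2 1, show (2 : Fin 3) + 1 = 0 from rfl,
      show (2 : Fin 3) + 2 = 1 from rfl, show (1 : Fin 3) + 1 = 2 from rfl,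
      show (1 : Fin 3) + 2 = 0 from rfl] <;> ring

end

theorem isOddDecaying_gaugeForm (hδ : 0 < δ) {H K : Fin 3 → Fin 3 → E3 × ℝ → ℝ}
    (hH : ∀ i m, ContDiff ℝ ∞ (H i m)) (hK : ∀ i m, ContDiff ℝ ∞ (K i m))
    (hHK : ∀ i m, ∀ ε ≠ 0, ∀ x ≠ 0, H i m (x, ε) = kelvin (fun y => K i m (y, ε)) x)
    (he : ∀ i m, ∀ ε ≠ 0, ∀ x, H i m (-x, ε) = H i m (x, ε)) (i j : Fin 3) :
    IsOddDecaying p δ ε₀ fun x ε => gaugeForm (fun i m y => H i m (y, ε)) i j x := by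
  have h := fun a i m => isOddDecaying_pd (p := p) (ε₀ := ε₀) hδ (hH i m) (hK i m) (hHK i m)
    (he i m) a
  have hr : ∀ i, IsOddDecaying p δ ε₀ fun x ε => rowDiv (fun i m y => H i m (y, ε)) i x :=
    fun i => (h 0 i 0).add ((h 1 i 1).add (h 2 i 2))
  refine ((h _ _ _).add ((h _ _ _).const_mul hδ (-1))).add ?_
  split_ifs
  exacts [hr _, (hr _).const_mul hδ (-1), isOddDecaying_zero hδ]

/-- The 1-form `∑_j φ_j dx_j/ε` on the base. -/
def basicForm (k : ℕ) (φ : Fin 3 → E3 → ℝ → ℝ) : Form1 k := fun a z =>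
  Fin.cases 0 (fun j => φ j z.x z.eps) a

theorem essBasic_basicForm (hδ : 0 < δ) {φ : Fin 3 → E3 → ℝ → ℝ}
    (hφ : ∀ j, IsOddDecaying p δ ε₀ (φ j)) :
    EssBasic p δ ε₀ fun a z => basicForm k φ a z / sigmaI z.x ^ 2 := by
  have h0 : ∀ w : Pt k → ℝ, IsRapid p δ ε₀ w fun _ => 0 := fun w N =>
    (isSmooth_const hδ 0).congr fun z _ => by rw [zero_div]
  refine ⟨fun z hz a => ?_, fun a => ⟨?_, ?_⟩, ?_⟩
  · have h1 : (iota z).x = -z.x := rfl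
    have h2 : (iota z).eps = z.eps := rfl
    refine Fin.cases ?_ (fun j => ?_) a
    · simp [basicForm]
    · simp only [basicForm, Fin.cases_succ, h1, h2, sigmaI_neg, (hφ j).1 _ hz.2.2.1.ne']
      ring
  · refine Fin.cases ?_ (fun j => (hφ j).2) a
    simpa [basicForm] using isSmooth_const hδ 0
  · refine (h0 _).congr fun z _ => ?_
    simp [derivTheta, basicForm]
  · simpa [basicForm] using h0 _

/-- The coefficients are constant along the circles, and the curvature enters only through the
vanishing $\alpha$-component. -/
theorem extD_basicForm_zero (φ : Fin 3 → E3 → ℝ → ℝ) (j : Fin 3) (z : Pt k) :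
    extD p (basicForm k φ) 0 j.succ z = 0 := by
  simp [extD, frameDeriv, basicForm, derivTheta, derivHor]

theorem extD_basicForm_succ {φ : Fin 3 → E3 → ℝ → ℝ} {z : Pt k}
    (hφ : ∀ j, ContDiff ℝ ∞ fun x => φ j x z.eps) (j l : Fin 3) :
    extD p (basicForm k φ) j.succ l.succ z = z.eps *
      (pd j (fun x => φ l x z.eps) z.x - pd l (fun x => φ j x z.eps) z.x) := by
  have h : ∀ j l, derivHor p j (basicForm k φ l.succ) z = pd j (fun x => φ l x z.eps) z.x :=
    fun j l => ((hφ l).differentiable (by simp) z.x).lineDeriv_eq_fderiv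
  have h1 : ∀ j : Fin 3, ∀ f, frameDeriv p j.succ f z = z.eps * derivHor p j f z := fun _ _ => rfl
  have h2 : basicForm k φ 0 z = 0 := rfl
  rw [extD, h1, h1, h, h, h2]
  ring

/-- The potential multiplies $e_j\wedge e_l$, which pairs only with the $e_0\wedge e_i$-component of
`η`, and this is zero. The hypothesis `h1` serves the case `i = 1`, where the cyclic order produces
the component with indices 3, 1. -/
theorem wedge_omegaAd (i : Fin 3) {η : Form2 k} {z : Pt k} (h0 : ∀ j : Fin 3, η 0 j.succ z = 0)
    (h1 : η 3 1 z = -η 1 3 z) :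
    wedge (omegaAd p i) η z = η (i + 1).succ (i + 2).succ z := by
  have h01 : η 0 1 z = 0 := h0 0
  have h02 : η 0 2 z = 0 := h0 1
  have h03 : η 0 3 z = 0 := h0 2
  fin_cases i <;> simp [wedge, omegaAd, coframeWedge, h01, h02, h03]
  exact h1.symm

end

section

variable {k : ℕ} {p : Fin k → E3} {δ ε₀ : ℝ}

/-! ### Reduction to the scalar Poisson equations and conclusion -/

theorem Qpol_omegaAd_basicForm {u : Fin 3 → Fin 3 → E3 × ℝ → ℝ}
    (hu : ∀ i m, ContDiff ℝ ∞ (u i m)) (i j : Fin 3) (z : Pt k) :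
    Qpol (omegaAd p) (fun l => extD p
      (basicForm k fun j x ε => gaugeForm (fun i m y => u i m (y, ε)) l j x)) i j z =
    z.eps * ((lap (fun y => u i j (y, z.eps)) z.x + lap (fun y => u j i (y, z.eps)) z.x) / 2 -
      if i = j then (∑ l, lap (fun y => u l l (y, z.eps)) z.x) / 3 else 0) := by
  have hu' : ∀ i m, ContDiff ℝ ∞ fun y => u i m (y, z.eps) := fun i m =>
    contDiff_slice (hu i m) z.eps
  have hc := fun l j => contDiff_gaugeForm hu' l j
  have hd := fun l => extD_basicForm_succ (p := p) (z := z)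
    (φ := fun j x ε => gaugeForm (fun i m y => u i m (y, ε)) l j x) (hc l)
  have hw : ∀ i l, wedge (omegaAd p i) (extD p
      (basicForm k fun j x ε => gaugeForm (fun i m y => u i m (y, ε)) l j x)) z = z.eps *
      (pd (i + 1) (gaugeForm (fun i m y => u i m (y, z.eps)) l (i + 2)) z.x -
        pd (i + 2) (gaugeForm (fun i m y => u i m (y, z.eps)) l (i + 1)) z.x) := fun i l => by
    rw [wedge_omegaAd i (fun j => extD_basicForm_zero _ j z), hd]
    have h1 := hd l 2 0
    have h2 := hd l 0 2
    change extD p _ 3 1 z = _ at h1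
    change extD p _ 1 3 z = _ at h2
    rw [h1, h2]
    ring
  rw [Qpol, ← sym_curl_gaugeForm hu' z.x fun _ _ => rfl]
  simp only [hw]
  split_ifs
  · rw [← Finset.mul_sum]
    ring
  · ring

theorem IsRapid.symTraceFree (hδ : 0 < δ) {w : Pt k → ℝ} {f : Fin 3 → Fin 3 → Pt k → ℝ}
    (hf : ∀ i j, IsRapid p δ ε₀ w (f i j)) (i j : Fin 3) :
    IsRapid p δ ε₀ w fun z =>
      z.eps * ((f i j z + f j i z) / 2 - if i = j then (∑ l, f l l z) / 3 else 0) := by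
  have h1 := IsRapid.smooth_mul (isSmooth_const hδ (1 / 2)) ((hf i j).add (hf j i))
  have h2 := ((hf 0 0).add (hf 1 1)).add (hf 2 2)
  refine IsRapid.smooth_mul (isSmooth_eps hδ) ?_
  by_cases h : i = j
  · refine (h1.add (IsRapid.smooth_mul (isSmooth_const hδ (-1 / 3)) h2)).congr fun z _ => ?_
    rw [if_pos h, Fin.sum_univ_three]
    ring
  · refine h1.congr fun z _ => ?_
    rw [if_neg h]
    ring

end

end SenGluing

end

theorem mainTheorem9 {k : ℕ} (p : Fin k → SenGluing.E3) (δ ε₀ : ℝ)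
    (hp : Function.Injective (SenGluing.centre p))
    (hδ : 0 < δ) (hδ_half : δ < 1 / 2)
    (hδ_sep : ∀ c c', c ≠ c' → 4 * δ ≤ dist (SenGluing.centre p c) (SenGluing.centre p c'))
    (hε₀ : 0 < ε₀) (hε₀_small : ε₀ ≤ δ ^ 2)
    (G : Fin 3 → Fin 3 → SenGluing.Form4 k)
    (hG : SenGluing.RapidEssInvSym p δ ε₀ G) :
    ∃ b : Fin 3 → SenGluing.Form1 k,
      (∀ i, SenGluing.EssBasic p δ ε₀ fun a z => b i a z / SenGluing.sigmaI z.x ^ 2) ∧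
      ∀ i j, SenGluing.IsRapid p δ ε₀ (fun z => z.eps * SenGluing.sigmaI z.x) fun z =>
        SenGluing.Qpol (SenGluing.omegaAd p) (fun l => SenGluing.extD p (b l)) i j z -
          z.eps * G i j z := by
  obtain ⟨hinv, hsym, hrap⟩ := hG
  choose H K hH hK hHK he hR using fun i j =>
    SenGluing.exists_potential_of_essInv hp hδ hε₀ hδ_sep (hinv i j) (hrap i j)
  refine ⟨fun i => SenGluing.basicForm k fun j x ε =>
    SenGluing.gaugeForm (fun i m y => H i m (y, ε)) i j x,
    fun i => SenGluing.essBasic_basicForm hδ (SenGluing.isOddDecaying_gaugeForm hδ hH hK hHK he i),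
    fun i j => ?_⟩
  -- The error is $\varepsilon$ times the trace-free symmetric part of the matrix $\Delta H-G$. As
  -- $G$ is symmetric and trace-free, the projection leaves it unchanged.
  refine (SenGluing.IsRapid.symTraceFree hδ hR i j).congr fun z hz => ?_
  obtain ⟨hs, ht⟩ := hsym z hz
  rw [SenGluing.Qpol_omegaAd_basicForm hH, hs j i]
  split_ifs
  · rw [Finset.sum_sub_distrib, ht]
    ring
  · ring
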